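/- Let $\mathbf{V\#L}$ be the two-sorted theory (numbers and strings, i.e. finite sets of numbers) over the Cook–Nguyen language $\{0,1,+,\cdot,|\ |;=_1,=_2,\le,\in\}$ whose axioms are: 2-BASIC; $\Sigma^B_0$-comprehension $\exists X\,(|X|\le y\wedge\forall z<y\,(z\in X\leftrightarrow\varphi(z)))$ for every $\Sigma^B_0$ formula $\varphi$ in which $X$ is not free; string multiplication $\forall X,Y\,\exists Z\,(Z=X\cdot Y)$, where strings are read as natural numbers in binary; and matrix powering: for every $m$, every $m\times m$ integer matrix $A$ (coded by strings, entries in binary) and every number $n$ the power $A^n$ exists. For a skew symmetric $2n\times 2n$ integer matrix $A$ the Pfaffian $\mathrm{pf}(A)$ is defined by the Pfaffian Berkowitz (PB) algorithm: the coefficient vector is $\bar p_\emptyset=(1)$ for the empty matrix and, for $n\ge 1$, $$\bar p_A=(p_n,\dots,p_0)=P_A\,\bar p_M,\qquad A=\begin{pmatrix}0&a_{12}&R\\-a_{12}&0&-{}^tS\\-{}^tR&S&M\end{pmatrix},$$ where $P_A$ is the $(n+1)\times n$ lower triangular Toeplitz matrix with $1$ on the diagonal, $a_{12}$ on the first subdiagonal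 and $RJ(MJ)^{s}S$ on the subdiagonal number $s+2$ $(0\le s\le n-2)$; here $J$ is the block diagonal matrix of the appropriate size with diagonal blocks $\begin{pmatrix}0&1\\-1&0\end{pmatrix}$. Then $\mathrm{pf}(A)=p_0$. Consider the following statements about the Pfaffian so defined, where $A$ ranges over skew symmetric integer matrices, of every size $2n\times 2n$: * (PCE) for all $n\ge 1$, all $A$ and all $1\le i\le 2n$: $\ \mathrm{pf}(A)=\sum_{1\le j\le 2n,\ j\ne i}(-1)^{i+j+\Theta(j-i)}a_{ij}\,\mathrm{pf}(A\langle i,j\rangle)$, where $A\langle i,j\rangle$ arises from $A$ by deleting the rows and columns $i,j$, and $\Theta(k)=1$ if $k>0$, $\Theta(k)=0$ if $k<0$; * (PAD) the conjunction of * Multilinearity: $\mathrm{pf}(A(\lambda,i))=\lambda\,\mathrm{pf}(A)$ for all $A$, all integers $\lambda$ and all $1\le i\le 2n$, where $A(\lambda,i)$ is $A$ with row $i$ and column $i$ multiplied by $\lambda$; * Alternation: $\mathrm{pf}(A[i:j])=-\mathrm{pf}(A)$ for all $A$ and all $i\ne j$, where $A[i:j]$ is $A$ with rows $i,j$ swapped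 and columns $i,j$ swapped; * Identity: $\mathrm{pf}(J_n)=1$ for all $n\ge 1$, where $J_n$ is the $2n\times 2n$ matrix $J$. Theorem. $\mathbf{V\#L}$ proves that (PCE) and (PAD) are equivalent; that is, the sentence $(\mathrm{PCE})\leftrightarrow(\mathrm{PAD})$ holds in every model of $\mathbf{V\#L}$. -/

import Mathlib

universe u v

namespace VSharpL

/-! ## Two-sorted first-order logic over the language `0, 1, +, ·, |·| ; =₁, =₂, ≤, ∈` -/

/-- Number terms. Number variables and string variables are named by natural numbers (two separate
supplies of names); the only string terms are the string variables. -/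
inductive NTerm : Type
  | var (x : ℕ)
  | zero
  | one
  | add (s t : NTerm)
  | mul (s t : NTerm)
  | len (X : ℕ)

instance : Zero NTerm := ⟨NTerm.zero⟩
instance : One NTerm := ⟨NTerm.one⟩
instance : Add NTerm := ⟨NTerm.add⟩
instance : Mul NTerm := ⟨NTerm.mul⟩

/-- Formulas. `mem t X` is `X(t)`, i.e. `t ∈ X`; `allN`, `exN` quantify over numbers and
`allS`, `exS` over strings (finite sets of numbers). -/
inductive Formula : Type
  | eqN (s t : NTerm)
  | eqS (X Y : ℕ)
  | le (s t : NTerm)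
  | mem (t : NTerm) (X : ℕ)
  | not (φ : Formula)
  | and (φ ψ : Formula)
  | or (φ ψ : Formula)
  | imp (φ ψ : Formula)
  | allN (x : ℕ) (φ : Formula)
  | exN (x : ℕ) (φ : Formula)
  | allS (X : ℕ) (φ : Formula)
  | exS (X : ℕ) (φ : Formula)

/-- A two-sorted structure for the language (`N` numbers, `S` strings); both equality symbols are
interpreted by equality. -/
structure TwoSorted where
  N : Type u
  S : Type v
  nonempty_S : Nonempty S
  zero : N
  one : N
  add : N → N → N
  mul : N → N → N
  len : S → N
  le : N → N → Prop
  mem : N → S → Prop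

def NTerm.eval (M : TwoSorted.{u, v}) (a : ℕ → M.N) (B : ℕ → M.S) : NTerm → M.N
  | .var x => a x
  | .zero => M.zero
  | .one => M.one
  | .add s t => M.add (s.eval M a B) (t.eval M a B)
  | .mul s t => M.mul (s.eval M a B) (t.eval M a B)
  | .len X => M.len (B X)

/-- Satisfaction of a formula in `M` under an assignment to number and string variables. -/
def Formula.Realize (M : TwoSorted.{u, v}) : Formula → (ℕ → M.N) → (ℕ → M.S) → Prop
  | .eqN s t, a, B => s.eval M a B = t.eval M a B
  | .eqS X Y, _, B => B X = B Y
  | .le s t, a, B => M.le (s.eval M a B) (t.eval M a B)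
  | .mem t X, a, B => M.mem (t.eval M a B) (B X)
  | .not φ, a, B => ¬ φ.Realize M a B
  | .and φ ψ, a, B => φ.Realize M a B ∧ ψ.Realize M a B
  | .or φ ψ, a, B => φ.Realize M a B ∨ ψ.Realize M a B
  | .imp φ ψ, a, B => φ.Realize M a B → ψ.Realize M a B
  | .allN x φ, a, B => ∀ c : M.N, φ.Realize M (Function.update a x c) B
  | .exN x φ, a, B => ∃ c : M.N, φ.Realize M (Function.update a x c) B
  | .allS X φ, a, B => ∀ C : M.S, φ.Realize M a (Function.update B X C)
  | .exS X φ, a, B => ∃ C : M.S, φ.Realize M a (Function.update B X C)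

/-- `M` satisfies (the universal closure of) `φ`. -/
def TwoSorted.Satisfies (M : TwoSorted.{u, v}) (φ : Formula) : Prop :=
  ∀ (a : ℕ → M.N) (B : ℕ → M.S), φ.Realize M a B

/-- `φ` is a consequence of the theory `T`: it holds in every model of `T`. (By the completeness
theorem of first-order logic, this is provability of `φ` from `T`.) -/
def Entails (T : Set Formula) (φ : Formula) : Prop :=
  ∀ M : TwoSorted.{u, v}, (∀ ψ ∈ T, M.Satisfies ψ) → M.Satisfies φ

def NTerm.Occurs (x : ℕ) : NTerm → Prop
  | .var y => x = y
  | .zero => False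
  | .one => False
  | .add s t => s.Occurs x ∨ t.Occurs x
  | .mul s t => s.Occurs x ∨ t.Occurs x
  | .len _ => False

def NTerm.OccursS (X : ℕ) : NTerm → Prop
  | .var _ => False
  | .zero => False
  | .one => False
  | .add s t => s.OccursS X ∨ t.OccursS X
  | .mul s t => s.OccursS X ∨ t.OccursS X
  | .len Y => X = Y

/-- The string variable `X` occurs free in a formula. -/
def Formula.FreeS (X : ℕ) : Formula → Prop
  | .eqN s t => s.OccursS X ∨ t.OccursS X
  | .eqS Y Z => X = Y ∨ X = Z
  | .le s t => s.OccursS X ∨ t.OccursS X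
  | .mem t Y => t.OccursS X ∨ X = Y
  | .not φ => φ.FreeS X
  | .and φ ψ => φ.FreeS X ∨ ψ.FreeS X
  | .or φ ψ => φ.FreeS X ∨ ψ.FreeS X
  | .imp φ ψ => φ.FreeS X ∨ ψ.FreeS X
  | .allN _ φ => φ.FreeS X
  | .exN _ φ => φ.FreeS X
  | .allS Y φ => X ≠ Y ∧ φ.FreeS X
  | .exS Y φ => X ≠ Y ∧ φ.FreeS X

/-- The `Σ₀ᴮ` formulas: the only quantifiers are bounded number quantifiers
`∀ x ≤ t` and `∃ x ≤ t`, where `x` does not occur in `t`. -/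
inductive Formula.IsSigma0B : Formula → Prop
  | eqN (s t : NTerm) : IsSigma0B (.eqN s t)
  | eqS (X Y : ℕ) : IsSigma0B (.eqS X Y)
  | le (s t : NTerm) : IsSigma0B (.le s t)
  | mem (t : NTerm) (X : ℕ) : IsSigma0B (.mem t X)
  | not {φ : Formula} : IsSigma0B φ → IsSigma0B (.not φ)
  | and {φ ψ : Formula} : IsSigma0B φ → IsSigma0B ψ → IsSigma0B (.and φ ψ)
  | or {φ ψ : Formula} : IsSigma0B φ → IsSigma0B ψ → IsSigma0B (.or φ ψ)
  | imp {φ ψ : Formula} : IsSigma0B φ → IsSigma0B ψ → IsSigma0B (.imp φ ψ)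
  | allN {x : ℕ} {t : NTerm} {φ : Formula} : ¬ t.Occurs x → IsSigma0B φ →
      IsSigma0B (.allN x (.imp (.le (.var x) t) φ))
  | exN {x : ℕ} {t : NTerm} {φ : Formula} : ¬ t.Occurs x → IsSigma0B φ →
      IsSigma0B (.exN x (.and (.le (.var x) t) φ))

/-! ## Writing formulas with bound variables handled by Lean functions

`Fm` is a formula waiting for a number `d` such that all variables named `d, d + 1, …` are
unused so far. A quantifier binds the variable named `d` and hands `d + 1` to its body, so
that no variable is ever captured. A closed formula is obtained by starting from `d = 0`. -/

abbrev Fm : Type := ℕ → Formula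

def eqNum (s t : NTerm) : Fm := fun _ => .eqN s t
def eqStr (X Y : ℕ) : Fm := fun _ => .eqS X Y
def leNum (s t : NTerm) : Fm := fun _ => .le s t
def memStr (t : NTerm) (X : ℕ) : Fm := fun _ => .mem t X
def neg (φ : Fm) : Fm := fun d => .not (φ d)
def conj (φ ψ : Fm) : Fm := fun d => .and (φ d) (ψ d)
def disj (φ ψ : Fm) : Fm := fun d => .or (φ d) (ψ d)
def impl (φ ψ : Fm) : Fm := fun d => .imp (φ d) (ψ d)

infixr:35 " ⋏ " => conj
infixr:30 " ⋎ " => disj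
infixr:25 " ⟹ " => impl

def equi (φ ψ : Fm) : Fm := (φ ⟹ ψ) ⋏ (ψ ⟹ φ)

infix:20 " ⟺ " => equi

def allNum (f : NTerm → Fm) : Fm := fun d => .allN d (f (.var d) (d + 1))
def exNum (f : NTerm → Fm) : Fm := fun d => .exN d (f (.var d) (d + 1))
def allStr (f : ℕ → Fm) : Fm := fun d => .allS d (f d (d + 1))
def exStr (f : ℕ → Fm) : Fm := fun d => .exS d (f d (d + 1))

def ltNum (s t : NTerm) : Fm := leNum s t ⋏ neg (eqNum s t)

/-- `∀ x < t, f x` -/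
def allLt (t : NTerm) (f : NTerm → Fm) : Fm := allNum fun x => ltNum x t ⟹ f x

/-! ## The base theory: 2-BASIC and `Σ₀ᴮ` comprehension -/

/-- The axioms 2-BASIC (B1–B12, L1, L2, SE). -/
def twoBasic : Set Formula :=
  { (allNum fun x => neg (eqNum (x + 1) 0)) 0,
    (allNum fun x => allNum fun y => eqNum (x + 1) (y + 1) ⟹ eqNum x y) 0,
    (allNum fun x => eqNum (x + 0) x) 0,
    (allNum fun x => allNum fun y => eqNum (x + (y + 1)) ((x + y) + 1)) 0,
    (allNum fun x => eqNum (x * 0) 0) 0,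
    (allNum fun x => allNum fun y => eqNum (x * (y + 1)) ((x * y) + x)) 0,
    (allNum fun x => allNum fun y => (leNum x y ⋏ leNum y x) ⟹ eqNum x y) 0,
    (allNum fun x => allNum fun y => leNum x (x + y)) 0,
    (allNum fun x => leNum 0 x) 0,
    (allNum fun x => allNum fun y => leNum x y ⋎ leNum y x) 0,
    (allNum fun x => allNum fun y => leNum x y ⟺ ltNum x (y + 1)) 0,
    (allNum fun x => neg (eqNum x 0) ⟹ exNum fun y => leNum y x ⋏ eqNum (y + 1) x) 0,
    (allStr fun X => allNum fun y => memStr y X ⟹ ltNum y (.len X)) 0,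
    (allStr fun X => allNum fun y => eqNum (y + 1) (.len X) ⟹ memStr y X) 0,
    (allStr fun X => allStr fun Y =>
      (eqNum (.len X) (.len Y) ⋏ allLt (.len X) fun i => memStr i X ⟺ memStr i Y)
        ⟹ eqStr X Y) 0 }

/-- `∃ X (|X| ≤ y ∧ ∀ z (z < y → (X(z) ↔ φ)))` -/
def compFormula (φ : Formula) (z y X : ℕ) : Formula :=
  .exS X (.and (.le (.len X) (.var y))
    (.allN z (.imp (.and (.le (.var z) (.var y)) (.not (.eqN (.var z) (.var y))))
      (.and (.imp (.mem (.var z) X) φ) (.imp φ (.mem (.var z) X))))))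

/-- The scheme `Σ₀ᴮ`-COMP. -/
def sigma0BComp : Set Formula :=
  { ψ | ∃ (φ : Formula) (z y X : ℕ),
      φ.IsSigma0B ∧ ¬ φ.FreeS X ∧ z ≠ y ∧ ψ = compFormula φ z y X }

/-! ## Binary arithmetic on strings

The string `X` stands for the natural number `∑_{i ∈ X} 2 ^ i`. -/

/-- The pairing function `⟨s, t⟩ = (s + t)(s + t + 1) + 2t`. -/
def pair (s t : NTerm) : NTerm := (s + t) * (s + t + 1) + (1 + 1) * t

/-- `X` is the row `Z^[t] = {j | ⟨t, j⟩ ∈ Z}` of the two-dimensional array `Z`. -/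
def isRow (Z : ℕ) (t : NTerm) (X : ℕ) : Fm :=
  allNum fun j => memStr j X ⟺ memStr (pair t j) Z

/-- There is a carry into position `i` in the addition of `X` and `Y`. -/
def carry (X Y : ℕ) (i : NTerm) : Fm :=
  exNum fun k => ltNum k i ⋏ memStr k X ⋏ memStr k Y ⋏
    allLt i fun j => ltNum k j ⟹ (memStr j X ⋎ memStr j Y)

/-- `X + Y = Z`: the bit `i` of `Z` is the exclusive or of the bits `i` of `X`, `Y` and the
carry, and `a ⊕ b ⊕ c` is the same as `a ↔ (b ↔ c)`. -/
def isSum (X Y Z : ℕ) : Fm :=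
  allNum fun i => memStr i Z ⟺ (memStr i X ⟺ (memStr i Y ⟺ carry X Y i))

/-- `Z = 2 ^ i · Y` -/
def isShift (i : NTerm) (Y Z : ℕ) : Fm :=
  allNum fun j => memStr j Z ⟺ (exNum fun k => eqNum j (i + k) ⋏ memStr k Y)

/-- `X · Y = Z` for strings: `W` lists the partial sums of the schoolbook multiplication,
`W^[0] = 0`, `W^[i+1] = W^[i] + X(i) · 2 ^ i · Y`, and `Z = W^[|X|]`. -/
def isProd (X Y Z : ℕ) : Fm :=
  exStr fun W =>
    (exStr fun U => isRow W 0 U ⋏ eqNum (.len U) 0) ⋏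
    (allLt (.len X) fun i => exStr fun U => exStr fun V =>
      isRow W i U ⋏ isRow W (i + 1) V ⋏
        ((memStr i X ⋏ exStr fun T => isShift i Y T ⋏ isSum U T V) ⋎
          (neg (memStr i X) ⋏ eqStr U V))) ⋏
    isRow W (.len X) Z

/-! ## Integers and integer matrices

An integer is given by two strings, as the difference of the numbers they stand for. -/

/-- A pair of string variables, standing for an integer `pos - neg`, or, row by row, for a
sequence of integers. -/
structure PairVar where
  pos : ℕ
  neg : ℕ

def allPair (f : PairVar → Fm) : Fm := allStr fun p => allStr fun n => f ⟨p, n⟩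
def exPair (f : PairVar → Fm) : Fm := exStr fun p => exStr fun n => f ⟨p, n⟩

/-- `x = y` as integers, i.e. `x.pos + y.neg = y.pos + x.neg`. -/
def eqInt (x y : PairVar) : Fm :=
  exStr fun U => isSum x.pos y.neg U ⋏ isSum y.pos x.neg U

/-- An integer-valued expression, given by the formula "the integer `z` is its value". -/
def ZExp : Type := PairVar → Fm

/-- The two expressions have the same value. -/
def eqZ (e f : ZExp) : Fm := exPair fun z => e z ⋏ f z

infix:40 " ≐ " => eqZ

def intVar (x : PairVar) : ZExp := fun z => eqInt x z

instance : Zero ZExp := ⟨fun z => eqStr z.pos z.neg⟩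

instance : One ZExp :=
  ⟨fun z => exStr fun U => (allNum fun i => memStr i U ⟺ eqNum i 0) ⋏ isSum z.neg U z.pos⟩

instance : Neg ZExp := ⟨fun e z => e ⟨z.neg, z.pos⟩⟩

instance : Add ZExp :=
  ⟨fun e f z => exPair fun x => exPair fun y => e x ⋏ f y ⋏
    exPair fun w => isSum x.pos y.pos w.pos ⋏ isSum x.neg y.neg w.neg ⋏ eqInt w z⟩

instance : Mul ZExp :=
  ⟨fun e f z => exPair fun x => exPair fun y => e x ⋏ f y ⋏
    exPair fun s => exPair fun t => exPair fun w =>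
      isProd x.pos y.pos s.pos ⋏ isProd x.neg y.neg s.neg ⋏
      isProd x.pos y.neg t.pos ⋏ isProd x.neg y.pos t.neg ⋏
      isSum s.pos s.neg w.pos ⋏ isSum t.pos t.neg w.neg ⋏ eqInt w z⟩

/-- The expression restricted to the case `φ`; combined by `orElse` into a case distinction. -/
def ZExp.when (e : ZExp) (φ : Fm) : ZExp := fun z => φ ⋏ e z

def ZExp.orElse (e f : ZExp) : ZExp := fun z => e z ⋎ f z

infixr:50 " ∥ " => ZExp.orElse

/-- The entry with index `t` of a sequence of integers. -/
def entry (A : PairVar) (t : NTerm) : ZExp := fun z =>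
  exPair fun x => isRow A.pos t x.pos ⋏ isRow A.neg t x.neg ⋏ eqInt x z

/-- `∑_{k < m} e k`: `T` lists the partial sums. -/
def sumLt (m : NTerm) (e : NTerm → ZExp) : ZExp := fun z =>
  exPair fun T => (entry T 0 ≐ 0) ⋏
    (allLt m fun k => entry T (k + 1) ≐ entry T k + e k) ⋏ entry T m z

/-- `(-1) ^ t` -/
def signPow (t : NTerm) : ZExp :=
  ((1 : ZExp).when (exNum fun k => eqNum t ((1 + 1) * k))) ∥
  ((-1 : ZExp).when (exNum fun k => eqNum t ((1 + 1) * k + 1)))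

/-- Matrices with integer-valued expressions as entries; rows and columns are counted from `0`. -/
abbrev Mat : Type := NTerm → NTerm → ZExp

/-- The matrix coded by a pair of strings. -/
def matVar (A : PairVar) : Mat := fun i j => entry A (pair i j)

def idMat : Mat := fun i j => ((1 : ZExp).when (eqNum i j)) ∥ ((0 : ZExp).when (neg (eqNum i j)))

/-- The product of two matrices with inner dimension `m`. -/
def mulMat (m : NTerm) (A B : Mat) : Mat := fun i j => sumLt m fun k => A i k * B k j

/-- The matrix number `t` of a sequence of matrices. -/
def seqMat (Q : PairVar) (t : NTerm) : Mat := fun i j => entry Q (pair t (pair i j))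

/-- The `m × m` matrices `A` and `B` are equal. -/
def eqMat (m : NTerm) (A B : Mat) : Fm := allLt m fun i => allLt m fun j => A i j ≐ B i j

/-- `B = A ^ n` for `m × m` matrices: `Q` lists the powers of `A`. -/
def isPow (m : NTerm) (A : Mat) (n : NTerm) (B : Mat) : Fm :=
  exPair fun Q => eqMat m (seqMat Q 0) idMat ⋏
    (allLt n fun t => eqMat m (seqMat Q (t + 1)) (mulMat m (seqMat Q t) A)) ⋏
    eqMat m B (seqMat Q n)

/-- The matrix `A ^ n`, for an `m × m` matrix `A`. -/
def powMat (m : NTerm) (A : Mat) (n : NTerm) : Mat := fun i j z =>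
  exPair fun B => isPow m A n (matVar B) ⋏ matVar B i j z

/-! ## The theory `V#L` -/

/-- String multiplication: `∀ X, Y ∃ Z (Z = X · Y)`. -/
def stringMultiplication : Formula :=
  (allStr fun X => allStr fun Y => exStr fun Z => isProd X Y Z) 0

/-- Matrix powering: every power of every square matrix exists. -/
def matrixPowering : Formula :=
  (allNum fun m => allNum fun n => allPair fun A => exPair fun B =>
    isPow m (matVar A) n (matVar B)) 0

def theory : Set Formula :=
  twoBasic ∪ sigma0BComp ∪ {stringMultiplication, matrixPowering}

/-! ## The Pfaffian by the Pfaffian Berkowitz algorithm -/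

/-- `t` is even, respectively odd. -/
def isEven (t : NTerm) : Fm := exNum fun k => eqNum t ((1 + 1) * k)
def isOdd (t : NTerm) : Fm := exNum fun k => eqNum t ((1 + 1) * k + 1)

/-- The block diagonal matrix `J` with blocks `(0, 1; -1, 0)`. -/
def matJ : Mat := fun i j =>
  ((1 : ZExp).when (isEven i ⋏ eqNum j (i + 1))) ∥
  ((-1 : ZExp).when (isEven j ⋏ eqNum i (j + 1))) ∥
  ((0 : ZExp).when (neg (isEven i ⋏ eqNum j (i + 1)) ⋏ neg (isEven j ⋏ eqNum i (j + 1))))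

/-- For a matrix `A` with blocks `(0, a₁₂, R; -a₁₂, 0, -ᵗS; -ᵗR, S, M)`, where `M` has size
`2p × 2p`: the number `R J (M J) ^ s S`. -/
def blockProd (p : NTerm) (A : Mat) (s : NTerm) : ZExp :=
  let m : NTerm := (1 + 1) * p
  let R : NTerm → ZExp := fun j => A 0 (j + (1 + 1))
  let S : NTerm → ZExp := fun i => A (i + (1 + 1)) 1
  let M : Mat := fun i j => A (i + (1 + 1)) (j + (1 + 1))
  let RJ : NTerm → ZExp := fun j => sumLt m fun i => R i * matJ i j
  let MJpowS : NTerm → ZExp := fun i => sumLt m fun j => powMat m (mulMat m M matJ) s i j * S j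
  sumLt m fun i => RJ i * MJpowS i

/-- The `(p + 2) × (p + 1)` Toeplitz matrix `P_A` of a `(2p + 2) × (2p + 2)` matrix `A`: `1` on the
diagonal, `a₁₂` below it, and `R J (M J) ^ s S` on the subdiagonal number `s + 2`. -/
def matP (p : NTerm) (A : Mat) : Mat := fun r c =>
  ((0 : ZExp).when (ltNum r c)) ∥
  ((1 : ZExp).when (eqNum r c)) ∥
  ((A 0 1).when (eqNum r (c + 1))) ∥
  (fun z => exNum fun s => eqNum r (c + s + (1 + 1)) ⋏ blockProd p A s z)

/-- `A` with its first `2k` rows and columns removed. -/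
def tailMat (A : Mat) (k : NTerm) : Mat := fun i j => A ((1 + 1) * k + i) ((1 + 1) * k + j)

/-- The Pfaffian of a `2n × 2n` matrix `A`. Row `k` of `C` lists the Pfaffian coefficients
(leading one first) of the matrix `A_k` that remains after the removal of the first `2k` rows and
columns of `A`; they are `(1)` for the empty matrix `A_n` and `P_{A_k}` times the coefficients of
`A_{k+1}` for `k < n`. The Pfaffian is the last coefficient of `A_0 = A`. -/
def pfaff (n : NTerm) (A : Mat) : ZExp := fun z =>
  exPair fun C => (entry C (pair n 0) ≐ 1) ⋏
    (allNum fun k => allNum fun p => eqNum (k + p + 1) n ⟹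
      allLt (p + (1 + 1)) fun r =>
        entry C (pair k r) ≐
          sumLt (p + 1) fun c => matP p (tailMat A k) r c * entry C (pair (k + 1) c)) ⋏
    entry C (pair 0 n) z

/-! ## The two principles -/

/-- The `m × m` matrix `A` is skew symmetric. -/
def isSkew (m : NTerm) (A : Mat) : Fm := eqMat m A fun i j => -A j i

/-- For `i < j`: `r'` is the element number `r` (from `0`) of the complement of `{i, j}`. -/
def skipLt (i j r r' : NTerm) : Fm :=
  (ltNum r i ⋏ eqNum r' r) ⋎
  (leNum i r ⋏ ltNum (r + 1) j ⋏ eqNum r' (r + 1)) ⋎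
  (leNum j (r + 1) ⋏ eqNum r' (r + (1 + 1)))

/-- The same for `i ≠ j`. -/
def skip (i j r r' : NTerm) : Fm :=
  (ltNum i j ⋏ skipLt i j r r') ⋎ (ltNum j i ⋏ skipLt j i r r')

/-- `A⟨i, j⟩`: the rows and columns `i`, `j` are removed. -/
def removeMat (A : Mat) (i j : NTerm) : Mat := fun r c z =>
  exNum fun r' => exNum fun c' => skip i j r r' ⋏ skip i j c c' ⋏ A r' c' z

/-- `r'` is the image of `r` under the transposition of `i` and `j`. -/
def transp (i j r r' : NTerm) : Fm :=
  (eqNum r i ⋏ eqNum r' j) ⋎ (eqNum r j ⋏ eqNum r' i) ⋎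
  (neg (eqNum r i) ⋏ neg (eqNum r j) ⋏ eqNum r' r)

/-- `A[i : j]`: the rows `i`, `j` are swapped, and so are the columns `i`, `j`. -/
def swapMat (A : Mat) (i j : NTerm) : Mat := fun r c z =>
  exNum fun r' => exNum fun c' => transp i j r r' ⋏ transp i j c c' ⋏ A r' c' z

def scaleRow (A : Mat) (l : ZExp) (i : NTerm) : Mat := fun r c =>
  ((l * A r c).when (eqNum r i)) ∥ ((A r c).when (neg (eqNum r i)))

def scaleCol (A : Mat) (l : ZExp) (i : NTerm) : Mat := fun r c =>
  ((l * A r c).when (eqNum c i)) ∥ ((A r c).when (neg (eqNum c i)))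

/-- `A(λ, i)`: the row `i` and the column `i` are multiplied by `λ`. -/
def scaleMat (A : Mat) (l : ZExp) (i : NTerm) : Mat := scaleCol (scaleRow A l i) l i

/-- The summand `(-1) ^ (i + j + Θ(j - i)) a_ij pf(A⟨i, j⟩)` of the expansion of a
`(2p + 2) × (2p + 2)` matrix along row `i`, and `0` for `j = i`. (Counting rows and columns from
`0` does not change the parity of `i + j`.) -/
def cofactorTerm (p : NTerm) (A : Mat) (i j : NTerm) : ZExp :=
  ((0 : ZExp).when (eqNum j i)) ∥
  ((signPow (i + j + 1) * (A i j * pfaff p (removeMat A i j))).when (ltNum i j)) ∥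
  ((signPow (i + j) * (A i j * pfaff p (removeMat A i j))).when (ltNum j i))

/-- Pfaffian cofactor expansion, for skew symmetric matrices of size `2n` with `n = p + 1`. -/
def PCE : Fm :=
  allNum fun p => allPair fun a => isSkew ((1 + 1) * (p + 1)) (matVar a) ⟹
    allLt ((1 + 1) * (p + 1)) fun i =>
      pfaff (p + 1) (matVar a) ≐
        sumLt ((1 + 1) * (p + 1)) fun j => cofactorTerm p (matVar a) i j

def multilinearity : Fm :=
  allNum fun n => allPair fun a => isSkew ((1 + 1) * n) (matVar a) ⟹
    allPair fun l => allLt ((1 + 1) * n) fun i =>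
      pfaff n (scaleMat (matVar a) (intVar l) i) ≐ intVar l * pfaff n (matVar a)

def alternation : Fm :=
  allNum fun n => allPair fun a => isSkew ((1 + 1) * n) (matVar a) ⟹
    allLt ((1 + 1) * n) fun i => allLt ((1 + 1) * n) fun j => neg (eqNum i j) ⟹
      pfaff n (swapMat (matVar a) i j) ≐ -pfaff n (matVar a)

def identity : Fm := allNum fun n => leNum 1 n ⟹ (pfaff n matJ ≐ 1)

/-- The axiomatic definition of the Pfaffian. -/
def PAD : Fm := multilinearity ⋏ alternation ⋏ identity

end VSharpL

/-! The argument takes place inside an arbitrary model `M` of the theory.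

The PB recursion makes the Pfaffian linear in the first row. The coefficient of the entry a_12 is
the Pfaffian of the trailing block, and the coefficient V_j of any other entry depends only on the
entries outside the first row and column (`exists_pf_succ`). This is the only point where the shape
of the algorithm matters.

Alternation gives the expansion. To find V_j, replace the first row by a unit vector (and the first
column by its negative). A transposition moves the entry 1 to the position of a_12, whose
coefficient is known. What remains is the wanted minor with its rows and columns permuted by a
cycle, and alternation turns the cycle into a sign (`Alternating.first_row`). Another cycle carries
row i to the front and yields the expansion along any row.

The expansion gives the axioms. Scaling is visible from the expansion along the scaled row. For a
swap of i and j, expand along i, and expand every minor that still contains j along j. The term with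
a_ij changes sign by skew symmetry. The others form a double sum over x ≠ y of a_ix a_jy
pf(A⟨i,j,x,y⟩), with a sign that is antisymmetric in x and y, while the swap exchanges x and y
(`Expandable.alternating`). No induction on the size of the matrix is needed. The Identity axiom
holds outright, since J has first row (0, 1, 0, ...) and trailing block J.

Most of the work is to make this legitimate in the theory, where induction is available only for
properties that agree with a string on each initial segment. The classes `Def` (predicates), `NF`
(number functions), `SF` (string functions) and `Inl` (integer functions) isolate such objects and
are closed under the operations used, so that instance search proves definability. String addition
and multiplication by bits give a ring `ZInt M`, at first without commutativity and associativity.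
Closure of `Inl` under products, sums and Pfaffians rests on matrix powering: one power of a block
diagonal matrix yields the powers of a whole family (`exists_powers`), and a layered matrix turns an
iterated product of different matrices into a power (`exists_recursion`). Finally the formulas are
evaluated compositionally, so that the sentences become `Expandable M`, `Scalable M`, `Alternating
M` and the identity for J. -/

set_option linter.unusedSectionVars false
set_option linter.unusedVariables false

namespace VSharpL

/-! ## Arithmetic in models of the theory -/

section Model

variable {M : TwoSorted.{u, v}}

/-- `M` is a model of the theory. -/
class IsModel (M : TwoSorted.{u, v}) : Prop where
  sat : ∀ ψ ∈ theory, M.Satisfies ψ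

instance : Zero M.N := ⟨M.zero⟩
instance : One M.N := ⟨M.one⟩
instance : Add M.N := ⟨M.add⟩
instance : Mul M.N := ⟨M.mul⟩
instance : LE M.N := ⟨M.le⟩
instance : Membership M.N M.S := ⟨fun X i => M.mem i X⟩
instance : Nonempty M.S := M.nonempty_S
instance : Inhabited M.N := ⟨0⟩

@[simp] theorem eval_var (a : ℕ → M.N) (B : ℕ → M.S) (x : ℕ) : (NTerm.var x).eval M a B = a x := rfl
@[simp] theorem eval_zero (a : ℕ → M.N) (B : ℕ → M.S) : (0 : NTerm).eval M a B = 0 := rfl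
@[simp] theorem eval_one (a : ℕ → M.N) (B : ℕ → M.S) : (1 : NTerm).eval M a B = 1 := rfl
@[simp] theorem eval_add (a : ℕ → M.N) (B : ℕ → M.S) (s t : NTerm) :
    (s + t).eval M a B = s.eval M a B + t.eval M a B := rfl
@[simp] theorem eval_mul (a : ℕ → M.N) (B : ℕ → M.S) (s t : NTerm) :
    (s * t).eval M a B = s.eval M a B * t.eval M a B := rfl
@[simp] theorem eval_len (a : ℕ → M.N) (B : ℕ → M.S) (X : ℕ) :
    (NTerm.len X).eval M a B = M.len (B X) := rfl

section realize
variable (a : ℕ → M.N) (B : ℕ → M.S)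
@[simp] theorem realize_eqN (s t : NTerm) :
    (Formula.eqN s t).Realize M a B ↔ s.eval M a B = t.eval M a B := Iff.rfl
@[simp] theorem realize_eqS (X Y : ℕ) : (Formula.eqS X Y).Realize M a B ↔ B X = B Y := Iff.rfl
@[simp] theorem realize_le (s t : NTerm) :
    (Formula.le s t).Realize M a B ↔ s.eval M a B ≤ t.eval M a B := Iff.rfl
@[simp] theorem realize_mem (t : NTerm) (X : ℕ) :
    (Formula.mem t X).Realize M a B ↔ t.eval M a B ∈ B X := Iff.rfl
@[simp] theorem realize_not (φ : Formula) : φ.not.Realize M a B ↔ ¬ φ.Realize M a B := Iff.rfl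
@[simp] theorem realize_and (φ ψ : Formula) :
    (φ.and ψ).Realize M a B ↔ φ.Realize M a B ∧ ψ.Realize M a B := Iff.rfl
@[simp] theorem realize_or (φ ψ : Formula) :
    (φ.or ψ).Realize M a B ↔ φ.Realize M a B ∨ ψ.Realize M a B := Iff.rfl
@[simp] theorem realize_imp (φ ψ : Formula) :
    (φ.imp ψ).Realize M a B ↔ (φ.Realize M a B → ψ.Realize M a B) := Iff.rfl
@[simp] theorem realize_allN (x : ℕ) (φ : Formula) :
    (Formula.allN x φ).Realize M a B ↔ ∀ c, φ.Realize M (Function.update a x c) B := Iff.rfl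
@[simp] theorem realize_exN (x : ℕ) (φ : Formula) :
    (Formula.exN x φ).Realize M a B ↔ ∃ c, φ.Realize M (Function.update a x c) B := Iff.rfl
@[simp] theorem realize_allS (X : ℕ) (φ : Formula) :
    (Formula.allS X φ).Realize M a B ↔ ∀ C, φ.Realize M a (Function.update B X C) := Iff.rfl
@[simp] theorem realize_exS (X : ℕ) (φ : Formula) :
    (Formula.exS X φ).Realize M a B ↔ ∃ C, φ.Realize M a (Function.update B X C) := Iff.rfl
end realize

variable [IsModel M]

theorem sat_of_mem {ψ : Formula} (h : ψ ∈ twoBasic) : M.Satisfies ψ :=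
  IsModel.sat ψ (Or.inl (Or.inl h))

theorem basic_axioms : 
    (∀ x : M.N, x + 1 ≠ 0) ∧ (∀ x y : M.N, x + 1 = y + 1 → x = y) ∧ (∀ x : M.N, x + 0 = x) ∧
    (∀ x y : M.N, x + (y + 1) = x + y + 1) ∧ (∀ x : M.N, x * 0 = 0) ∧
    (∀ x y : M.N, x * (y + 1) = x * y + x) ∧ (∀ x y : M.N, x ≤ y → y ≤ x → x = y) ∧
    (∀ x y : M.N, x ≤ x + y) ∧ (∀ x : M.N, 0 ≤ x) ∧ (∀ x y : M.N, x ≤ y ∨ y ≤ x) ∧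
    (∀ x y : M.N, x ≤ y ↔ x ≤ y + 1 ∧ x ≠ y + 1) ∧
    (∀ x : M.N, x ≠ 0 → ∃ y, y ≤ x ∧ y + 1 = x) ∧
    (∀ (X : M.S) (y : M.N), y ∈ X → y ≤ M.len X ∧ y ≠ M.len X) ∧
    (∀ (X : M.S) (y : M.N), y + 1 = M.len X → y ∈ X) ∧
    (∀ X Y : M.S, M.len X = M.len Y → (∀ i, i ≤ M.len X → i ≠ M.len X → (i ∈ X ↔ i ∈ Y)) → X = Y) := by
  have key : ∀ ψ ∈ twoBasic, ψ.Realize M (fun _ => 0) (fun _ => Classical.arbitrary _) :=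
    fun ψ h => sat_of_mem h _ _
  simp [twoBasic, allNum, exNum, allStr, eqNum, leNum, memStr, neg, conj, disj, impl, equi, ltNum, allLt, eqStr] at key
  obtain ⟨h1, h2, h3, h4, h5, h6, h7, h8, h9, h10, h11, h12, h13, h14, h15⟩ := key
  exact ⟨h1, h2, h3, h4, h5, h6, h7, h8, h9, h10,
    fun x y => ⟨(h11 x y).1, fun h => (h11 x y).2 h.1 h.2⟩, h12, h13, h14,
    fun X Y h h' => h15 X Y h fun i hi hi' =>
      ⟨fun hX => (h' i hi hi').1 hX, fun hY => (h' i hi hi').2 hY⟩⟩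

theorem comp_formula {φ : Formula} (hφ : φ.IsSigma0B) (hX : ¬ φ.FreeS 0) (a : ℕ → M.N)
    (B : ℕ → M.S) (b : M.N) : ∃ X : M.S, M.len X ≤ b ∧ ∀ z, z ≤ b → z ≠ b →
      (z ∈ X ↔ φ.Realize M (Function.update (Function.update a 1 b) 0 z) (Function.update B 0 X)) := by
  have h := IsModel.sat (M := M) (compFormula φ 0 1 0)
    (Or.inl (Or.inr ⟨φ, 0, 1, 0, hφ, hX, by decide, rfl⟩)) (Function.update a 1 b) B
  simp [compFormula] at h
  obtain ⟨X, h1, h2⟩ := h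
  exact ⟨X, h1, fun z hz hz' => ⟨(h2 z hz hz').1, (h2 z hz hz').2⟩⟩

/-- `P` agrees with a string on every initial segment. -/
class Def (P : M.N → Prop) : Prop where
  out : ∀ b, ∃ X : M.S, ∀ z, z ≤ b → z ≠ b → (z ∈ X ↔ P z)

/-- Comprehension for the formula z ∈ Y cuts Y off at b; this supplies the bound on the length that
`Def` does not include. -/
theorem exists_string_aux {P : M.N → Prop} [hP : Def P] (b : M.N) :
    ∃ X : M.S, M.len X ≤ b ∧ ∀ z, z ≤ b → z ≠ b → (z ∈ X ↔ P z) := by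
  obtain ⟨Y, hY⟩ := hP.out b
  obtain ⟨X, h, h'⟩ := comp_formula (M := M) (φ := .mem (.var 0) 1) (.mem _ _)
    (by simp [Formula.FreeS, NTerm.OccursS]) (fun _ => 0) (fun _ => Y) b
  refine ⟨X, h, fun z hz hz' => (h' z hz hz').trans ?_⟩
  simpa using hY z hz hz'

/-- The string Y of all z ≤ b with P z is nonempty, so its length is a successor w + 1, and by L2
its largest element is w. If P b failed, then w < b and the induction step would put w + 1 = |Y|
into Y, against L1. -/
theorem Def.induction {P : M.N → Prop} [Def P] (h0 : P 0) (hs : ∀ z, P z → P (z + 1)) (b : M.N) :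
    P b := by
  obtain ⟨B1, B2, B3, B4, B5, B6, B7, B8, B9, B10, B11, B12, L1, L2, -⟩ := basic_axioms (M := M)
  by_contra hb
  obtain ⟨Y, hY, hY'⟩ := exists_string_aux (P := P) (b + 1)
  have h0Y : (0 : M.N) ∈ Y := (hY' 0 (B9 _) (B1 b).symm).2 h0
  obtain ⟨w, hw, hw'⟩ := B12 (M.len Y) (fun h => by
    have := L1 Y 0 h0Y
    exact this.2 h.symm)
  have hwY := L2 Y w hw'
  have hwb : w ≤ b := by
    rcases B10 w b with h | h
    · exact h
    · rw [← hw'] at hY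
      by_cases e : w + 1 = b + 1
      · rw [B2 _ _ e]; rcases B10 b b with h | h <;> exact h
      · have h1 := (B11 (w + 1) b).2 ⟨hY, e⟩
        have h2 := (B11 b w).1 h
        exact absurd (B7 _ _ h2.1 h1) h2.2
  have hwP : P w := (hY' w ((B11 _ _).1 hwb).1 ((B11 _ _).1 hwb).2).1 hwY
  have hwP' := hs w hwP
  have hne : w + 1 ≠ b + 1 := fun e => hb (B2 _ _ e ▸ hwP)
  have hle : w + 1 ≤ b + 1 := hw' ▸ hY
  have := L1 Y _ ((hY' (w + 1) hle hne).2 hwP')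
  exact this.2 hw'

/-- Comprehension uses the number variables 0 (element) and 1 (bound) and the string variable 0.
Parameters therefore sit in the number variables 2, 3 and the string variables from 1 on, and bound
variables start at 3 or 4. -/
theorem Def.of_formula {φ : Formula} (hφ : φ.IsSigma0B) (hX : ¬ φ.FreeS 0) (a : ℕ → M.N)
    (B : ℕ → M.S) {P : M.N → Prop} (h : ∀ b z X, z ≤ b → z ≠ b →
      (φ.Realize M (Function.update (Function.update a 1 b) 0 z) (Function.update B 0 X) ↔ P z)) :
    Def P := ⟨fun b => by
  obtain ⟨X, -, h'⟩ := comp_formula hφ hX a B b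
  exact ⟨X, fun z hz hz' => (h' z hz hz').trans (h b z X hz hz')⟩⟩

theorem Def.of_eq (s t : NTerm) (a : ℕ → M.N) (hs : ¬ s.OccursS 0) (ht : ¬ t.OccursS 0)
    {P : M.N → Prop}
    (h : ∀ b z B, s.eval M (Function.update (Function.update a 1 b) 0 z) B =
      t.eval M (Function.update (Function.update a 1 b) 0 z) B ↔ P z) : Def P :=
  Def.of_formula (.eqN s t) (by simp [Formula.FreeS, hs, ht]) a (fun _ => Classical.arbitrary _)
    (fun b z X _ _ => by simpa using h b z _)

/-- The assignment of `p` to the variable `2` and of `q` to the variable `3`. -/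
def env (p q : M.N) : ℕ → M.N := fun n => if n = 2 then p else if n = 3 then q else 0

theorem eq_induction (s t : NTerm) (p q : M.N) (hs : ¬ s.OccursS 0) (ht : ¬ t.OccursS 0)
    {P : M.N → Prop}
    (h : ∀ b z B, s.eval M (Function.update (Function.update (env p q) 1 b) 0 z) B =
      t.eval M (Function.update (Function.update (env p q) 1 b) 0 z) B ↔ P z)
    (h0 : P 0) (hP : ∀ z, P z → P (z + 1)) (z : M.N) : P z :=
  have := Def.of_eq s t (env p q) hs ht h
  Def.induction h0 hP z

/-! ### Peano arithmetic of the number sort by induction on equations. -/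

namespace Arith

local notation "v0" => NTerm.var 0
local notation "v2" => NTerm.var 2
local notation "v3" => NTerm.var 3

theorem zero_add' (x : M.N) : 0 + x = x := by
  obtain ⟨B1, B2, B3, B4, B5, B6, -⟩ := basic_axioms (M := M)
  exact eq_induction (P := fun z : M.N => 0 + z = z) (0 + v0) v0 0 0 (by simp [NTerm.OccursS])
    (by simp [NTerm.OccursS]) (by simp) (B3 _) (fun z h => by rw [B4, h]) x

theorem add_assoc' (x y z : M.N) : x + y + z = x + (y + z) := by
  obtain ⟨B1, B2, B3, B4, B5, B6, -⟩ := basic_axioms (M := M)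
  exact eq_induction (P := fun z : M.N => x + y + z = x + (y + z)) (v2 + v3 + v0)
    (v2 + (v3 + v0)) x y (by simp [NTerm.OccursS])
    (by simp [NTerm.OccursS]) (by simp [env]) (by rw [B3, B3]) (fun z h => by rw [B4, h, B4, B4]) z

theorem add_right_comm_one (x y : M.N) : x + 1 + y = x + y + 1 := by
  obtain ⟨B1, B2, B3, B4, B5, B6, -⟩ := basic_axioms (M := M)
  exact eq_induction (P := fun z : M.N => x + 1 + z = x + z + 1) (v2 + 1 + v0)
    (v2 + v0 + 1) x 0 (by simp [NTerm.OccursS])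
    (by simp [NTerm.OccursS]) (by simp [env]) (by rw [B3, B3]) (fun z h => by rw [B4, h, B4]) y

theorem add_comm' (x y : M.N) : x + y = y + x := by
  obtain ⟨B1, B2, B3, B4, B5, B6, -⟩ := basic_axioms (M := M)
  exact eq_induction (P := fun z : M.N => x + z = z + x) (v2 + v0)
    (v0 + v2) x 0 (by simp [NTerm.OccursS])
    (by simp [NTerm.OccursS]) (by simp [env]) (by rw [B3, zero_add'])
    (fun z h => by rw [B4, h, add_right_comm_one]) y

theorem zero_mul' (x : M.N) : 0 * x = 0 := by
  obtain ⟨B1, B2, B3, B4, B5, B6, -⟩ := basic_axioms (M := M)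
  exact eq_induction (P := fun z : M.N => 0 * z = 0) (0 * v0) 0 0 0 (by simp [NTerm.OccursS])
    (by simp [NTerm.OccursS]) (by simp) (B5 _) (fun z h => by rw [B6, h, B3]) x

theorem succ_mul' (x y : M.N) : (x + 1) * y = x * y + y := by
  obtain ⟨B1, B2, B3, B4, B5, B6, -⟩ := basic_axioms (M := M)
  exact eq_induction (P := fun z : M.N => (x + 1) * z = x * z + z) ((v2 + 1) * v0)
    (v2 * v0 + v0) x 0 (by simp [NTerm.OccursS])
    (by simp [NTerm.OccursS]) (by simp [env]) (by rw [B5, B5, B3]) (fun z h => by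
      rw [B6, h, B6, ← add_assoc', B4, add_assoc' _ z x, add_comm' z x, ← add_assoc']) y

theorem mul_comm_aux (x y : M.N) : x * y = y * x := by
  obtain ⟨B1, B2, B3, B4, B5, B6, -⟩ := basic_axioms (M := M)
  exact eq_induction (P := fun z : M.N => x * z = z * x) (v2 * v0)
    (v0 * v2) x 0 (by simp [NTerm.OccursS])
    (by simp [NTerm.OccursS]) (by simp [env]) (by rw [B5, zero_mul'])
    (fun z h => by rw [B6, h, succ_mul']) y

theorem mul_add' (x y z : M.N) : x * (y + z) = x * y + x * z := by
  obtain ⟨B1, B2, B3, B4, B5, B6, -⟩ := basic_axioms (M := M)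
  exact eq_induction (P := fun z : M.N => x * (y + z) = x * y + x * z) (v2 * (v3 + v0))
    (v2 * v3 + v2 * v0) x y (by simp [NTerm.OccursS])
    (by simp [NTerm.OccursS]) (by simp [env]) (by rw [B3, B5, B3])
    (fun z h => by rw [B4, B6, h, B6, add_assoc']) z

theorem mul_assoc' (x y z : M.N) : x * y * z = x * (y * z) := by
  obtain ⟨B1, B2, B3, B4, B5, B6, -⟩ := basic_axioms (M := M)
  exact eq_induction (P := fun z : M.N => x * y * z = x * (y * z)) (v2 * v3 * v0)
    (v2 * (v3 * v0)) x y (by simp [NTerm.OccursS])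
    (by simp [NTerm.OccursS]) (by simp [env]) (by rw [B5, B5, B5])
    (fun z h => by rw [B6, h, B6, mul_add']) z

/-- Induction on y. The witness is kept below y so that the induction formula has bounded
quantifiers only. -/
theorem exists_add {x y : M.N} (h : x ≤ y) : ∃ z, y = x + z := by
  obtain ⟨B1, B2, B3, B4, B5, B6, B7, B8, B9, B10, B11, B12, -⟩ := basic_axioms (M := M)
  have : Def (fun y : M.N => x ≤ y → ∃ z, z ≤ y ∧ y = x + z) :=
    Def.of_formula (φ := .imp (.le v2 v0) (.exN 3 (.and (.le v3 v0) (.eqN v0 (v2 + v3)))))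
      (.imp (.le _ _) (.exN (by simp [NTerm.Occurs]) (.eqN _ _)))
      (by simp [Formula.FreeS, NTerm.OccursS]) (env x 0)
      (fun _ => Classical.arbitrary _) (by intro b z X hz hz'; simp [env])
  obtain ⟨z, -, hz⟩ := Def.induction (P := fun y : M.N => x ≤ y → ∃ z, z ≤ y ∧ y = x + z)
    (fun h => ⟨0, B9 _, by rw [B7 _ _ h (B9 _), B3]⟩)
    (fun y ih h => by
      by_cases e : x = y + 1
      · exact ⟨0, B9 _, by rw [B3, e]⟩
      · obtain ⟨z, -, hz'⟩ := ih ((B11 _ _).2 ⟨h, e⟩)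
        refine ⟨z + 1, ?_, by rw [B4, ← hz']⟩
        rw [hz', ← B4, add_comm' x]
        exact B8 _ _) y h
  exact ⟨z, hz⟩

theorem add_right_cancel' (x y z : M.N) (h : x + z = y + z) : x = y := by
  obtain ⟨B1, B2, B3, B4, B5, B6, B7, B8, B9, B10, B11, B12, -⟩ := basic_axioms (M := M)
  have : Def (fun z : M.N => x + z = y + z → x = y) :=
    Def.of_formula (φ := .imp (.eqN (v2 + v0) (v3 + v0)) (.eqN v2 v3)) (.imp (.eqN _ _) (.eqN _ _))
      (by simp [Formula.FreeS, NTerm.OccursS]) (env x y)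
      (fun _ => Classical.arbitrary _) (by intro b z X hz hz'; simp [env])
  exact Def.induction (P := fun z : M.N => x + z = y + z → x = y) (by rw [B3, B3]; exact id)
    (fun z ih h => ih (B2 _ _ (by rw [← B4, h, B4]))) z h

end Arith

/-! ### The numbers of a model as an ordered commutative semiring, and extensionality of strings. -/

open Arith

instance : CommSemiring M.N where
  add_assoc := add_assoc'
  zero_add := zero_add'
  add_zero := (basic_axioms (M := M)).2.2.1
  add_comm := add_comm'
  mul_assoc := mul_assoc'
  one_mul x := by
    rw [mul_comm_aux, ← zero_add' (1 : M.N), (basic_axioms (M := M)).2.2.2.2.2.1,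
      (basic_axioms (M := M)).2.2.2.2.1, zero_add']
  mul_one x := by
    rw [← zero_add' (1 : M.N), (basic_axioms (M := M)).2.2.2.2.2.1,
      (basic_axioms (M := M)).2.2.2.2.1, zero_add']
  left_distrib := mul_add'
  right_distrib x y z := by rw [mul_comm_aux, mul_add', mul_comm_aux z, mul_comm_aux z]
  zero_mul := zero_mul'
  mul_zero := (basic_axioms (M := M)).2.2.2.2.1
  mul_comm := mul_comm_aux
  nsmul := nsmulRec
  npow n x := @npowRec _ ⟨1⟩ ⟨(· * ·)⟩ n x

noncomputable instance : LinearOrder M.N where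
  le_refl x := (basic_axioms (M := M)).2.2.2.2.2.2.2.2.2.1 x x |>.elim id id
  le_trans x y z h h' := by
    obtain ⟨u, rfl⟩ := exists_add h
    obtain ⟨w, rfl⟩ := exists_add h'
    rw [add_assoc']
    exact (basic_axioms (M := M)).2.2.2.2.2.2.2.1 _ _
  le_antisymm := (basic_axioms (M := M)).2.2.2.2.2.2.1
  le_total := (basic_axioms (M := M)).2.2.2.2.2.2.2.2.2.1
  toDecidableLE := Classical.decRel _

theorem lt_succ_iff {x y : M.N} : x < y + 1 ↔ x ≤ y := by
  rw [lt_iff_le_and_ne]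
  exact ((basic_axioms (M := M)).2.2.2.2.2.2.2.2.2.2.1 x y).symm

theorem succ_le_iff {x y : M.N} : x + 1 ≤ y ↔ x < y := by
  rw [← not_lt, lt_succ_iff, not_le]

instance : CanonicallyOrderedAdd M.N where
  exists_add_of_le := exists_add
  le_add_self x y := by rw [add_comm]; exact (basic_axioms (M := M)).2.2.2.2.2.2.2.1 _ _
  le_self_add := (basic_axioms (M := M)).2.2.2.2.2.2.2.1

instance : Nontrivial M.N := ⟨1, 0, by
  have := (basic_axioms (M := M)).1 0
  rwa [zero_add] at this⟩

instance : IsOrderedCancelAddMonoid M.N where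
  add_le_add_left x y h z := by
    obtain ⟨u, rfl⟩ := exists_add h
    rw [add_right_comm]; exact le_self_add
  le_of_add_le_add_left x y z h := by
    obtain ⟨u, hu⟩ := exists_add h
    rw [add_assoc, add_comm, add_comm x] at hu
    rw [add_right_cancel' _ _ _ hu]
    exact le_self_add

instance : IsStrictOrderedRing M.N where
  zero_le_one := zero_le
  mul_lt_mul_of_pos_left c hc a b h := by
    obtain ⟨u, rfl⟩ := exists_add (succ_le_iff.2 h)
    obtain ⟨w, rfl⟩ := exists_add (succ_le_iff.2 hc)
    refine succ_le_iff.1 ?_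
    have : (0 + 1 + w) * (a + 1 + u) = ((0 + 1 + w) * a + 1) + (w + (0 + 1 + w) * u) := by ring
    rw [this]; exact le_self_add
  mul_lt_mul_of_pos_right c hc a b h := by
    obtain ⟨u, rfl⟩ := exists_add (succ_le_iff.2 h)
    obtain ⟨w, rfl⟩ := exists_add (succ_le_iff.2 hc)
    refine succ_le_iff.1 ?_
    have : (a + 1 + u) * (0 + 1 + w) = (a * (0 + 1 + w) + 1) + (w + (0 + 1 + w) * u) := by ring
    rw [this]; exact le_self_add

theorem len_pos_of_mem {X : M.S} {i : M.N} (h : i ∈ X) : i < M.len X :=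
  lt_iff_le_and_ne.2 ((basic_axioms (M := M)).2.2.2.2.2.2.2.2.2.2.2.2.1 X i h)

theorem mem_of_succ_eq_len {X : M.S} {i : M.N} (h : i + 1 = M.len X) : i ∈ X :=
  (basic_axioms (M := M)).2.2.2.2.2.2.2.2.2.2.2.2.2.1 X i h

theorem exists_succ {x : M.N} (h : x ≠ 0) : ∃ y, x = y + 1 := by
  obtain ⟨u, hu⟩ := exists_add (succ_le_iff.2 (pos_iff_ne_zero.2 h))
  exact ⟨u, by rw [hu]; ring⟩

/-- The length of a nonempty string is its largest element plus one, so the elements determine the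
length and the axiom SE applies. -/
theorem string_ext {X Y : M.S} (h : ∀ i, i ∈ X ↔ i ∈ Y) : X = Y := by
  have key : ∀ X Y : M.S, (∀ i, i ∈ X ↔ i ∈ Y) → M.len X ≤ M.len Y := fun X Y h => by
    by_cases e : M.len X = 0
    · rw [e]; exact zero_le
    · obtain ⟨y, hy⟩ := exists_succ e
      rw [hy, succ_le_iff]
      exact len_pos_of_mem ((h y).1 (mem_of_succ_eq_len hy.symm))
  exact (basic_axioms (M := M)).2.2.2.2.2.2.2.2.2.2.2.2.2.2 X Y
    (le_antisymm (key X Y h) (key Y X fun i => (h i).symm)) fun i _ _ => h i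

/-- Bounded comprehension for a definable property. -/
theorem exists_string (P : M.N → Prop) [Def P] (b : M.N) :
    ∃ X : M.S, ∀ z, z ∈ X ↔ z < b ∧ P z := by
  obtain ⟨X, h, h'⟩ := exists_string_aux (P := P) b
  refine ⟨X, fun z => ⟨fun hz => ?_, fun hz => (h' z hz.1.le hz.1.ne).2 hz.2⟩⟩
  have : z < b := (len_pos_of_mem hz).trans_le h
  exact ⟨this, (h' z this.le this.ne).1 hz⟩

end Model

/-! ### Pairing, and closure properties of definable predicates and number functions. -/

section Definability

variable {M : TwoSorted.{u, v}}

/-- The pairing function. -/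
def pr (s t : M.N) : M.N := (s + t) * (s + t + 1) + (1 + 1) * t

@[simp] theorem eval_pair (a : ℕ → M.N) (B : ℕ → M.S) (s t : NTerm) :
    (pair s t).eval M a B = pr (s.eval M a B) (t.eval M a B) := rfl

variable [IsModel M]

/-- The codes on the diagonal s + t = n lie between n(n+1) and n(n+1) + 2n, which is less than
(n+1)(n+2). -/
theorem pr_lt_of_add_lt {s t s' t' : M.N} (h : s + t < s' + t') : pr s t < pr s' t' := by
  obtain ⟨u, hu⟩ := exists_add_of_le (succ_le_iff.2 h)
  rw [pr, pr, hu, ← succ_le_iff]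
  have : (s + t + 1 + u) * (s + t + 1 + u + 1) + (1 + 1) * t' =
    ((s + t) * (s + t + 1) + (1 + 1) * t + 1) + (s + s + 1 + (s + t + s + t + 1 + 1 + 1 + u) * u
      + (1 + 1) * t') := by ring
  rw [this]; exact le_self_add

theorem pr_inj {s t s' t' : M.N} : pr s t = pr s' t' ↔ s = s' ∧ t = t' := by
  refine ⟨fun h => ?_, fun ⟨h, h'⟩ => by rw [h, h']⟩
  rcases lt_trichotomy (s + t) (s' + t') with h1 | h1 | h1
  · exact absurd h (pr_lt_of_add_lt h1).ne
  · rw [pr, pr, h1] at h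
    have h2 := add_left_cancel h
    have h3 : t = t' := by
      rcases lt_trichotomy t t' with h4 | h4 | h4
      · exact absurd h2 (mul_lt_mul_of_pos_left h4 (by positivity)).ne
      · exact h4
      · exact absurd h2 (mul_lt_mul_of_pos_left h4 (by positivity)).ne'
    subst h3
    exact ⟨add_right_cancel h1, rfl⟩
  · exact absurd h (pr_lt_of_add_lt h1).ne'

theorem le_pr_left (s t : M.N) : s ≤ pr s t := by
  have : pr s t = s + (s * s + s * t + s * t + t * t + t + (1 + 1) * t) := by rw [pr]; ring
  rw [this]; exact le_self_add

theorem le_pr_right (s t : M.N) : t ≤ pr s t := by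
  have : pr s t = t + ((s + t) * (s + t + 1) + t) := by rw [pr]; ring
  rw [this]; exact le_self_add

theorem pr_lt_pr {s t b c : M.N} (h : s < b) (h' : t < c) : pr s t < pr b c :=
  pr_lt_of_add_lt (add_lt_add h h')

open scoped Classical in
/-- The first component of a pair. -/
noncomputable def fst (z : M.N) : M.N := if h : ∃ s t, z = pr s t then h.choose else 0

open scoped Classical in
/-- The second component of a pair. -/
noncomputable def snd (z : M.N) : M.N := if h : ∃ s t, z = pr s t then h.choose_spec.choose else 0

@[simp] theorem fst_pr (s t : M.N) : fst (pr s t) = s := by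
  have h : ∃ s' t', pr s t = pr s' t' := ⟨s, t, rfl⟩
  rw [fst, dif_pos h]
  exact (pr_inj.1 h.choose_spec.choose_spec).1.symm

@[simp] theorem snd_pr (s t : M.N) : snd (pr s t) = t := by
  have h : ∃ s' t', pr s t = pr s' t' := ⟨s, t, rfl⟩
  rw [snd, dif_pos h]
  exact (pr_inj.1 h.choose_spec.choose_spec).2.symm

theorem fst_le (z : M.N) : fst z ≤ z := by
  by_cases h : ∃ s t, z = pr s t
  · obtain ⟨s, t, rfl⟩ := h
    rw [fst_pr]; exact le_pr_left _ _
  · rw [fst, dif_neg h]; exact zero_le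

theorem snd_le (z : M.N) : snd z ≤ z := by
  by_cases h : ∃ s t, z = pr s t
  · obtain ⟨s, t, rfl⟩ := h
    rw [snd_pr]; exact le_pr_right _ _
  · rw [snd, dif_neg h]; exact zero_le

theorem Def.out_lt (P : M.N → Prop) [hP : Def P] (b : M.N) : ∃ X : M.S, ∀ z < b, (z ∈ X ↔ P z) := by
  obtain ⟨X, hX⟩ := hP.out b
  exact ⟨X, fun z hz => hX z hz.le hz.ne⟩

/-- Definability concerns initial segments only, so a definable substitute for each bound suffices.
In applications the substitute is a bounded formula whose string parameters code the given
predicates and functions below the bound. -/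
theorem Def.of_local {P : M.N → Prop}
    (h : ∀ b, ∃ Q : M.N → Prop, Def Q ∧ ∀ z < b, (Q z ↔ P z)) : Def P := ⟨fun b => by
  obtain ⟨Q, hQ, hQP⟩ := h b
  obtain ⟨X, hX⟩ := hQ.out b
  exact ⟨X, fun z hz hz' => (hX z hz hz').trans (hQP z (lt_of_le_of_ne hz hz'))⟩⟩

/-- The assignment of `X` to the string variable `1` and of `Y` to the others. -/
def senv (X Y : M.S) : ℕ → M.S := fun n => if n = 1 then X else Y

instance Def.mem (X : M.S) : Def (fun z => z ∈ X) :=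
  ⟨fun _ => ⟨X, fun _ _ _ => Iff.rfl⟩⟩

theorem Def.congr {P Q : M.N → Prop} (hP : Def P) (h : ∀ z, P z ↔ Q z) : Def Q := by
  obtain rfl : P = Q := funext fun z => propext (h z)
  exact hP

instance Def.const (p : Prop) : Def (fun _ : M.N => p) := by
  have : Def (fun _ : M.N => True) :=
    Def.of_formula (.eqN 0 0) (by simp [Formula.FreeS, NTerm.OccursS]) (env 0 0)
      (fun _ => Classical.arbitrary _) (by intros; simp)
  have h' : Def (fun _ : M.N => False) :=
    Def.of_formula (.not (.eqN 0 0)) (by simp [Formula.FreeS, NTerm.OccursS]) (env 0 0)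
      (fun _ => Classical.arbitrary _) (by intros; simp)
  by_cases h : p
  · simpa [h]
  · simpa [h]

instance Def.not (P : M.N → Prop) [Def P] : Def (fun z => ¬ P z) := Def.of_local fun b => by
  obtain ⟨X, hX⟩ := Def.out_lt P b
  exact ⟨fun z => ¬ z ∈ X, Def.of_formula (.not (.mem (.var 0) 1))
    (by simp [Formula.FreeS, NTerm.OccursS]) (env 0 0) (senv X X) (by intros; simp [senv]),
    fun z hz => not_congr (hX z hz)⟩

instance Def.and (P Q : M.N → Prop) [Def P] [Def Q] : Def (fun z => P z ∧ Q z) :=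
  Def.of_local fun b => by
  obtain ⟨X, hX⟩ := Def.out_lt P b
  obtain ⟨Y, hY⟩ := Def.out_lt Q b
  exact ⟨fun z => z ∈ X ∧ z ∈ Y, Def.of_formula (.and (.mem (.var 0) 1) (.mem (.var 0) 2))
    (by simp [Formula.FreeS, NTerm.OccursS]) (env 0 0) (senv X Y) (by intros; simp [senv]),
    fun z hz => and_congr (hX z hz) (hY z hz)⟩

instance Def.or (P Q : M.N → Prop) [Def P] [Def Q] : Def (fun z => P z ∨ Q z) :=
  (inferInstance : Def fun z => ¬ (¬ P z ∧ ¬ Q z)).congr fun z => by tauto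

instance Def.imp (P Q : M.N → Prop) [Def P] [Def Q] : Def (fun z => P z → Q z) :=
  (inferInstance : Def fun z => ¬ P z ∨ Q z).congr fun z => by tauto

instance Def.iff (P Q : M.N → Prop) [Def P] [Def Q] : Def (fun z => P z ↔ Q z) :=
  (inferInstance : Def fun z => (P z → Q z) ∧ (Q z → P z)).congr fun z => by tauto

/-- A number-valued function whose graph is coded by a string on every initial segment. -/
class NF (h : M.N → M.N) : Prop where
  out : ∀ b, ∃ (G : M.S) (b' : M.N), ∀ z < b, h z < b' ∧ ∀ y < b', (pr z y ∈ G ↔ h z = y)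

/-- The graph over an initial segment can be a string only if the values are bounded there; the
formula for the graph may vary with the segment. -/
theorem NF.of_def {h : M.N → M.N} (Q : M.N → M.N → Prop) (hQ : ∀ b, Def (Q b))
    (hb : ∀ b, ∃ b', ∀ z < b, h z < b' ∧ ∀ y < b', (Q b (pr z y) ↔ h z = y)) : NF h := ⟨fun b => by
  obtain ⟨b', hb'⟩ := hb b
  have := hQ b
  obtain ⟨X, hX⟩ := Def.out_lt (Q b) (pr b b')
  refine ⟨X, b', fun z hz => ⟨(hb' z hz).1, fun y hy => ?_⟩⟩
  rw [hX _ (pr_lt_pr hz hy), (hb' z hz).2 y hy]⟩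

section occurs
variable (x : ℕ) (s t : NTerm)
@[simp] theorem occurs_var (y : ℕ) : (NTerm.var y).Occurs x ↔ x = y := Iff.rfl
@[simp] theorem occursS_var (y : ℕ) : (NTerm.var y).OccursS x ↔ False := Iff.rfl
@[simp] theorem occursS_zero : (0 : NTerm).OccursS x ↔ False := Iff.rfl
@[simp] theorem occursS_one : (1 : NTerm).OccursS x ↔ False := Iff.rfl
@[simp] theorem occursS_add : (s + t).OccursS x ↔ s.OccursS x ∨ t.OccursS x := Iff.rfl
@[simp] theorem occursS_mul : (s * t).OccursS x ↔ s.OccursS x ∨ t.OccursS x := Iff.rfl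
@[simp] theorem occursS_pair : (pair s t).OccursS x ↔ s.OccursS x ∨ t.OccursS x := by
  simp [pair]
end occurs

local notation "v0" => NTerm.var 0
local notation "v2" => NTerm.var 2
local notation "v3" => NTerm.var 3
local notation "v4" => NTerm.var 4
local notation "v5" => NTerm.var 5
local notation "v6" => NTerm.var 6

instance NF.id : NF (fun z : M.N => z) := by
  refine NF.of_def (fun b w => ∃ z ≤ b, w = pr z z) (fun b => ?_)
    fun b => ⟨b, fun z hz => ⟨hz, fun y hy => ?_⟩⟩
  · exact Def.of_formula (φ := .exN 4 (.and (.le v4 v2) (.eqN v0 (pair v4 v4))))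
      (.exN (by simp) (.eqN _ _)) (by simp [Formula.FreeS]) (env b 0)
      (fun _ => Classical.arbitrary _) (by intros; simp [env])
  · simp only [pr_inj]
    exact ⟨fun ⟨u, _, h1, h2⟩ => h1.trans h2.symm, fun h => ⟨z, hz.le, rfl, h.symm⟩⟩

instance NF.const (c : M.N) : NF (fun _ : M.N => c) := by
  refine NF.of_def (fun b w => ∃ z ≤ b, w = pr z c) (fun b => ?_)
    fun b => ⟨c + 1, fun z hz => ⟨lt_succ_iff.2 le_rfl, fun y hy => ?_⟩⟩
  · exact Def.of_formula (φ := .exN 4 (.and (.le v4 v2) (.eqN v0 (pair v4 v3))))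
      (.exN (by simp) (.eqN _ _)) (by simp [Formula.FreeS]) (env b c)
      (fun _ => Classical.arbitrary _) (by intros; simp [env])
  · simp only [pr_inj]
    exact ⟨fun ⟨u, _, h1, h2⟩ => h2.symm, fun h => ⟨z, hz.le, rfl, h.symm⟩⟩

/-- The pairing function is not onto (its values are even), so the graph needs a second clause for
numbers that are not pairs, where the default value is 0. -/
theorem NF.fst_aux : NF (fun z : M.N => fst z) := by
  refine NF.of_def (fun b w => (∃ s ≤ b, ∃ t ≤ b, w = pr (pr s t) s) ∨
    ∃ z ≤ b, w = pr z 0 ∧ ¬ ∃ s ≤ z, ∃ t ≤ z, z = pr s t) (fun b => ?_)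
    fun b => ⟨b, fun z hz => ⟨(fst_le z).trans_lt hz, fun y hy => ?_⟩⟩
  · exact Def.of_formula (φ := .or
      (.exN 4 (.and (.le v4 v2) (.exN 5 (.and (.le v5 v2) (.eqN v0 (pair (pair v4 v5) v4))))))
      (.exN 4 (.and (.le v4 v2) (.and (.eqN v0 (pair v4 0))
        (.not (.exN 5 (.and (.le v5 v4) (.exN 6 (.and (.le v6 v4) (.eqN v4 (pair v5 v6)))))))))))
      (.or (.exN (by simp) (.exN (by simp) (.eqN _ _)))
        (.exN (by simp) (.and (.eqN _ _) (.not (.exN (by simp) (.exN (by simp) (.eqN _ _)))))))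
      (by simp [Formula.FreeS]) (env b 0)
      (fun _ => Classical.arbitrary _) (by intros; simp [env])
  · by_cases h : ∃ s t, z = pr s t
    · obtain ⟨s, t, rfl⟩ := h
      simp only [pr_inj, fst_pr]
      constructor
      · rintro (⟨s', _, t', _, ⟨rfl, rfl⟩, rfl⟩ | ⟨z', hz', ⟨rfl, rfl⟩, h2⟩)
        · rfl
        · exact absurd ⟨s, le_pr_left _ _, t, le_pr_right _ _, rfl⟩ h2
      · rintro rfl
        exact Or.inl ⟨s, (le_pr_left _ _).trans hz.le, t, (le_pr_right _ _).trans hz.le, ⟨rfl, rfl⟩, rfl⟩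
    · have h0 : fst z = 0 := by rw [fst, dif_neg h]
      rw [h0]
      constructor
      · rintro (⟨s', _, t', _, h1⟩ | ⟨z', hz', h1, h2⟩)
        · exact absurd ⟨_, _, (pr_inj.1 h1).1⟩ h
        · exact (pr_inj.1 h1).2.symm
      · rintro rfl
        exact Or.inr ⟨z, hz.le, rfl, fun ⟨s, _, t, _, h1⟩ => h ⟨s, t, h1⟩⟩

theorem NF.snd_aux : NF (fun z : M.N => snd z) := by
  refine NF.of_def (fun b w => (∃ s ≤ b, ∃ t ≤ b, w = pr (pr s t) t) ∨
    ∃ z ≤ b, w = pr z 0 ∧ ¬ ∃ s ≤ z, ∃ t ≤ z, z = pr s t) (fun b => ?_)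
    fun b => ⟨b, fun z hz => ⟨(snd_le z).trans_lt hz, fun y hy => ?_⟩⟩
  · exact Def.of_formula (φ := .or
      (.exN 4 (.and (.le v4 v2) (.exN 5 (.and (.le v5 v2) (.eqN v0 (pair (pair v4 v5) v5))))))
      (.exN 4 (.and (.le v4 v2) (.and (.eqN v0 (pair v4 0))
        (.not (.exN 5 (.and (.le v5 v4) (.exN 6 (.and (.le v6 v4) (.eqN v4 (pair v5 v6)))))))))))
      (.or (.exN (by simp) (.exN (by simp) (.eqN _ _)))
        (.exN (by simp) (.and (.eqN _ _) (.not (.exN (by simp) (.exN (by simp) (.eqN _ _)))))))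
      (by simp [Formula.FreeS]) (env b 0)
      (fun _ => Classical.arbitrary _) (by intros; simp [env])
  · by_cases h : ∃ s t, z = pr s t
    · obtain ⟨s, t, rfl⟩ := h
      simp only [pr_inj, snd_pr]
      constructor
      · rintro (⟨s', _, t', _, ⟨rfl, rfl⟩, rfl⟩ | ⟨z', hz', ⟨rfl, rfl⟩, h2⟩)
        · rfl
        · exact absurd ⟨s, le_pr_left _ _, t, le_pr_right _ _, rfl⟩ h2
      · rintro rfl
        exact Or.inl ⟨s, (le_pr_left _ _).trans hz.le, t, (le_pr_right _ _).trans hz.le, ⟨rfl, rfl⟩, rfl⟩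
    · have h0 : snd z = 0 := by rw [snd, dif_neg h]
      rw [h0]
      constructor
      · rintro (⟨s', _, t', _, h1⟩ | ⟨z', hz', h1, h2⟩)
        · exact absurd ⟨_, _, (pr_inj.1 h1).1⟩ h
        · exact (pr_inj.1 h1).2.symm
      · rintro rfl
        exact Or.inr ⟨z, hz.le, rfl, fun ⟨s, _, t, _, h1⟩ => h ⟨s, t, h1⟩⟩

/-- Intersecting the coding strings with the pairs whose second component is below the bound makes
them describe the graphs for all y, and a common bound serves both functions. -/
theorem env_bounds {f g : M.N → M.N} [hf : NF f] [hg : NF g] (b : M.N) :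
    ∃ (F G : M.S) (c : M.N), ∀ z < b, f z < c ∧ g z < c ∧ (∀ y, pr z y ∈ F ↔ f z = y) ∧
      ∀ y, pr z y ∈ G ↔ g z = y := by
  obtain ⟨F, c, h⟩ := hf.out b
  obtain ⟨G, d, h'⟩ := hg.out b
  have hF : Def (fun w : M.N => w ∈ F ∧ ∃ z ≤ b, ∃ y ≤ c, y ≠ c ∧ w = pr z y) :=
    Def.of_formula (φ := .and (.mem v0 1) (.exN 4 (.and (.le v4 v2) (.exN 5 (.and (.le v5 v3)
      (.and (.not (.eqN v5 v3)) (.eqN v0 (pair v4 v5))))))))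
      (.and (.mem _ _) (.exN (by simp) (.exN (by simp) (.and (.not (.eqN _ _)) (.eqN _ _)))))
      (by simp [Formula.FreeS]) (env b c) (senv F F) (by intros; simp [env, senv])
  have hG : Def (fun w : M.N => w ∈ G ∧ ∃ z ≤ b, ∃ y ≤ d, y ≠ d ∧ w = pr z y) :=
    Def.of_formula (φ := .and (.mem v0 1) (.exN 4 (.and (.le v4 v2) (.exN 5 (.and (.le v5 v3)
      (.and (.not (.eqN v5 v3)) (.eqN v0 (pair v4 v5))))))))
      (.and (.mem _ _) (.exN (by simp) (.exN (by simp) (.and (.not (.eqN _ _)) (.eqN _ _)))))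
      (by simp [Formula.FreeS]) (env b d) (senv G G) (by intros; simp [env, senv])
  obtain ⟨F', hF'⟩ := exists_string (fun w => w ∈ F ∧ ∃ z ≤ b, ∃ y ≤ c, y ≠ c ∧ w = pr z y) (pr b (c + d + 1))
  obtain ⟨G', hG'⟩ := exists_string (fun w => w ∈ G ∧ ∃ z ≤ b, ∃ y ≤ d, y ≠ d ∧ w = pr z y) (pr b (c + d + 1))
  have hlt : c + d < c + d + 1 := lt_succ_iff.2 le_rfl
  refine ⟨F', G', c + d, fun z hz => ⟨(h z hz).1.trans_le le_self_add,
    (h' z hz).1.trans_le le_add_self, fun y => ?_, fun y => ?_⟩⟩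
  · rw [hF']
    constructor
    · rintro ⟨_, h1, z', _, y', h2, h3, h4⟩
      obtain ⟨rfl, rfl⟩ := pr_inj.1 h4
      exact ((h z hz).2 y (lt_of_le_of_ne h2 h3)).1 h1
    · intro e
      have hy' : y < c := e ▸ (h z hz).1
      exact ⟨pr_lt_pr hz (hy'.trans_le (le_self_add.trans hlt.le)), ((h z hz).2 y hy').2 e, z, hz.le, y, hy'.le, hy'.ne, rfl⟩
  · rw [hG']
    constructor
    · rintro ⟨_, h1, z', _, y', h2, h3, h4⟩
      obtain ⟨rfl, rfl⟩ := pr_inj.1 h4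
      exact ((h' z hz).2 y (lt_of_le_of_ne h2 h3)).1 h1
    · intro e
      have hy' : y < d := e ▸ (h' z hz).1
      exact ⟨pr_lt_pr hz (hy'.trans_le (le_add_self.trans hlt.le)), ((h' z hz).2 y hy').2 e, z, hz.le, y, hy'.le, hy'.ne, rfl⟩

theorem NF.bound (f : M.N → M.N) [hf : NF f] (b : M.N) : ∃ c, ∀ z < b, f z < c := by
  obtain ⟨_, c, h⟩ := hf.out b
  exact ⟨c, fun z hz => (h z hz).1⟩

instance Def.eq (f g : M.N → M.N) [NF f] [NF g] : Def (fun z => f z = g z) := Def.of_local fun b => by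
  obtain ⟨F, G, c, h⟩ := env_bounds (f := f) (g := g) b
  refine ⟨fun z => ∃ u ≤ c, pr z u ∈ F ∧ pr z u ∈ G, Def.of_formula (φ := .exN 4 (.and (.le v4 v2)
    (.and (.mem (pair v0 v4) 1) (.mem (pair v0 v4) 2)))) (.exN (by simp) (.and (.mem _ _) (.mem _ _)))
    (by simp [Formula.FreeS]) (env c c) (senv F G) (by intros; simp [env, senv]), fun z hz => ?_⟩
  obtain ⟨h1, h2, h3, h4⟩ := h z hz
  constructor
  · rintro ⟨u, hu, h5, h6⟩
    rw [(h3 u).1 h5, (h4 u).1 h6]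
  · intro e
    exact ⟨f z, h1.le, (h3 _).2 rfl, (h4 _).2 e.symm⟩

instance Def.le (f g : M.N → M.N) [NF f] [NF g] : Def (fun z => f z ≤ g z) := Def.of_local fun b => by
  obtain ⟨F, G, c, h⟩ := env_bounds (f := f) (g := g) b
  refine ⟨fun z => ∃ u ≤ c, ∃ v ≤ c, pr z u ∈ F ∧ pr z v ∈ G ∧ u ≤ v,
    Def.of_formula (φ := .exN 4 (.and (.le v4 v2) (.exN 5 (.and (.le v5 v2)
    (.and (.mem (pair v0 v4) 1) (.and (.mem (pair v0 v5) 2) (.le v4 v5)))))))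
    (.exN (by simp) (.exN (by simp) (.and (.mem _ _) (.and (.mem _ _) (.le _ _)))))
    (by simp [Formula.FreeS]) (env c c) (senv F G) (by intros; simp [env, senv]), fun z hz => ?_⟩
  obtain ⟨h1, h2, h3, h4⟩ := h z hz
  constructor
  · rintro ⟨u, hu, v, hv, h5, h6, h7⟩
    rwa [(h3 u).1 h5, (h4 v).1 h6]
  · intro e
    exact ⟨f z, h1.le, g z, h2.le, (h3 _).2 rfl, (h4 _).2 rfl, e⟩

instance Def.lt (f g : M.N → M.N) [NF f] [NF g] : Def (fun z => f z < g z) :=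
  (inferInstance : Def fun z => ¬ g z ≤ f z).congr fun _ => not_le

/-- Below the bound, P (f z) says that some u has ⟨z, u⟩ in the graph string of f and lies in the
string for P. -/
instance (priority := 100) Def.comp (P : M.N → Prop) (f : M.N → M.N) [Def P] [NF f] : Def (fun z => P (f z)) :=
  Def.of_local fun b => by
  obtain ⟨F, _, c, h⟩ := env_bounds (f := f) (g := f) b
  obtain ⟨X, hX⟩ := Def.out_lt P c
  refine ⟨fun z => ∃ u ≤ c, pr z u ∈ F ∧ u ∈ X, Def.of_formula (φ := .exN 4 (.and (.le v4 v2)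
    (.and (.mem (pair v0 v4) 1) (.mem v4 2)))) (.exN (by simp) (.and (.mem _ _) (.mem _ _)))
    (by simp [Formula.FreeS]) (env c c) (senv F X) (by intros; simp [env, senv]), fun z hz => ?_⟩
  obtain ⟨h1, h2, h3, h4⟩ := h z hz
  constructor
  · rintro ⟨u, hu, h5, h6⟩
    have e := (h3 u).1 h5
    subst e
    exact (hX _ h1).1 h6
  · intro e
    exact ⟨f z, h1.le, (h3 _).2 rfl, (hX _ h1).2 e⟩

theorem NF.binary (f g : M.N → M.N) [NF f] [NF g] (op : M.N → M.N → M.N) (t : NTerm)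
    (ht : ¬ t.OccursS 0)
    (hop : ∀ (a : ℕ → M.N) (B : ℕ → M.S), t.eval M a B = op (a 5) (a 6))
    (hb : ∀ c, ∃ d, ∀ u < c, ∀ v < c, op u v < d) : NF (fun z => op (f z) (g z)) := by
  choose F G c hh using fun b : M.N => env_bounds (f := f) (g := g) b
  refine NF.of_def (fun b w => ∃ z ≤ b, ∃ u ≤ c b, ∃ v ≤ c b, w = pr z (op u v) ∧ pr z u ∈ F b ∧
    pr z v ∈ G b) (fun b => ?_) fun b => ?_
  · exact Def.of_formula (φ := .exN 4 (.and (.le v4 v2) (.exN 5 (.and (.le v5 v3)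
      (.exN 6 (.and (.le v6 v3) (.and (.eqN v0 (pair v4 t)) (.and (.mem (pair v4 v5) 1)
        (.mem (pair v4 v6) 2)))))))))
      (.exN (by simp) (.exN (by simp) (.exN (by simp) (.and (.eqN _ _) (.and (.mem _ _) (.mem _ _))))))
      (by simp [Formula.FreeS, ht]) (env b (c b))
      (senv (F b) (G b)) (by intros; simp [env, senv, hop])
  · obtain ⟨d, hd⟩ := hb (c b)
    refine ⟨d, fun z hz => ?_⟩
    obtain ⟨h1, h2, h3, h4⟩ := hh b z hz
    refine ⟨hd _ h1 _ h2, fun y hy => ⟨?_, ?_⟩⟩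
    · rintro ⟨z', _, u, hu, v, hv, e, h5, h6⟩
      obtain ⟨rfl, rfl⟩ := pr_inj.1 e
      rw [(h3 u).1 h5, (h4 v).1 h6]
    · rintro rfl
      exact ⟨z, hz.le, f z, h1.le, g z, h2.le, rfl, (h3 _).2 rfl, (h4 _).2 rfl⟩

instance NF.add (f g : M.N → M.N) [NF f] [NF g] : NF (fun z => f z + g z) :=
  NF.binary f g (· + ·) (v5 + v6) (by simp) (by intros; simp)
    fun c => ⟨c + c, fun u hu v hv => add_lt_add hu hv⟩

instance NF.mul (f g : M.N → M.N) [NF f] [NF g] : NF (fun z => f z * g z) :=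
  NF.binary f g (· * ·) (v5 * v6) (by simp) (by intros; simp)
    fun c => ⟨c * c, fun u hu v hv => mul_lt_mul'' hu hv zero_le zero_le⟩

instance NF.pr (f g : M.N → M.N) [NF f] [NF g] : NF (fun z => pr (f z) (g z)) := by
  unfold VSharpL.pr; infer_instance

instance (priority := 100) NF.comp (g f : M.N → M.N) [NF g] [NF f] : NF (fun z => g (f z)) := by
  choose F _ c h using fun b : M.N => env_bounds (f := f) (g := f) b
  choose G _ d h' using fun b : M.N => env_bounds (f := g) (g := g) b
  refine NF.of_def (fun b w => ∃ z ≤ b, ∃ u ≤ c b + d (c b), ∃ v ≤ c b + d (c b),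
    w = VSharpL.pr z v ∧ VSharpL.pr z u ∈ F b ∧ VSharpL.pr u v ∈ G (c b)) (fun b => ?_) fun b => ?_
  · exact Def.of_formula (φ := .exN 4 (.and (.le v4 v2) (.exN 5 (.and (.le v5 v3)
      (.exN 6 (.and (.le v6 v3) (.and (.eqN v0 (pair v4 v6)) (.and (.mem (pair v4 v5) 1)
        (.mem (pair v5 v6) 2)))))))))
      (.exN (by simp) (.exN (by simp) (.exN (by simp) (.and (.eqN _ _) (.and (.mem _ _) (.mem _ _))))))
      (by simp [Formula.FreeS]) (env b (c b + d (c b)))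
      (senv (F b) (G (c b))) (by intros; simp [env, senv])
  · refine ⟨d (c b), fun z hz => ?_⟩
    obtain ⟨h1, -, h3, -⟩ := h b z hz
    obtain ⟨h5, -, h7, -⟩ := h' (c b) _ h1
    refine ⟨h5, fun y hy => ⟨?_, ?_⟩⟩
    · rintro ⟨z', _, u, hu, v, hv, e, h8, h9⟩
      obtain ⟨rfl, rfl⟩ := pr_inj.1 e
      rw [h3] at h8
      subst h8
      exact (h7 _).1 h9
    · rintro rfl
      exact ⟨z, hz.le, f z, h1.le.trans le_self_add, g (f z), h5.le.trans le_add_self, rfl,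
        (h3 _).2 rfl, (h7 _).2 rfl⟩

instance : NF (M := M) VSharpL.fst := NF.fst_aux
instance : NF (M := M) VSharpL.snd := NF.snd_aux

instance NF.fst (f : M.N → M.N) [NF f] : NF (fun z => fst (f z)) :=
  have := NF.fst_aux (M := M)
  NF.comp VSharpL.fst f

instance NF.snd (f : M.N → M.N) [NF f] : NF (fun z => snd (f z)) :=
  have := NF.snd_aux (M := M)
  NF.comp VSharpL.snd f

theorem NF.of_graph (f : M.N → M.N) (h : Def (fun w => f (VSharpL.fst w) = VSharpL.snd w))
    (hb : ∀ b, ∃ c, ∀ z < b, f z < c) : NF f :=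
  NF.of_def (fun _ w => f (VSharpL.fst w) = VSharpL.snd w) (fun _ => h) fun b => by
    obtain ⟨c, hc⟩ := hb b
    exact ⟨c, fun z hz => ⟨hc z hz, fun y _ => by simp⟩⟩

theorem NF.congr {f g : M.N → M.N} (hf : NF f) (h : ∀ z, f z = g z) : NF g := by
  obtain rfl : f = g := funext h
  exact hf

/-- Composition for a function of two variables, given in uncurried form. -/
instance (priority := 100) NF.comp₂ (F : M.N → M.N → M.N)
    [NF fun w => F (VSharpL.fst w) (VSharpL.snd w)] (f g : M.N → M.N) [NF f] [NF g] : NF (fun z => F (f z) (g z)) :=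
  (NF.comp (fun w => F (VSharpL.fst w) (VSharpL.snd w)) fun z => VSharpL.pr (f z) (g z)).congr
    fun z => by simp

instance (priority := 100) Def.comp₂ (P : M.N → M.N → Prop)
    [Def fun w => P (VSharpL.fst w) (VSharpL.snd w)] (f g : M.N → M.N) [NF f] [NF g] : Def (fun z => P (f z) (g z)) :=
  (Def.comp (fun w => P (VSharpL.fst w) (VSharpL.snd w)) fun z => VSharpL.pr (f z) (g z)).congr
    fun z => by simp

instance (priority := 100) NF.curry (F : M.N → M.N → M.N)
    [h : NF fun w => F (VSharpL.fst w) (VSharpL.snd w)] (c : M.N) : NF (F c) :=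
  NF.comp₂ F (fun _ => c) fun z => z

instance (priority := 100) Def.curry (P : M.N → M.N → Prop)
    [h : Def fun w => P (VSharpL.fst w) (VSharpL.snd w)] (c : M.N) : Def (P c) :=
  Def.comp₂ P (fun _ => c) fun z => z

instance NF.ite (P : M.N → Prop) (f g : M.N → M.N) [∀ z, Decidable (P z)] [Def P] [NF f] [NF g] :
    NF (fun z => if P z then f z else g z) := by
  refine NF.of_graph _ ((inferInstance : Def fun w => (P (VSharpL.fst w) ∧ f (VSharpL.fst w) = VSharpL.snd w) ∨
    (¬ P (VSharpL.fst w) ∧ g (VSharpL.fst w) = VSharpL.snd w)).congr fun w => ?_) fun b => ?_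
  · by_cases h : P (VSharpL.fst w) <;> simp [h]
  · obtain ⟨c, hc⟩ := NF.bound f b
    obtain ⟨d, hd⟩ := NF.bound g b
    refine ⟨c + d, fun z hz => ?_⟩
    split_ifs
    · exact (hc z hz).trans_le le_self_add
    · exact (hd z hz).trans_le le_add_self

instance Def.exists_lt (f : M.N → M.N) (P : M.N → M.N → Prop) [NF f]
    [Def fun w => P (VSharpL.fst w) (VSharpL.snd w)] : Def (fun z => ∃ c < f z, P z c) := by
  refine Def.of_local fun b => ?_
  obtain ⟨b', hb'⟩ := NF.bound f b
  -- The relation in two variables is stored as one string of pairs, after which the quantifier is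
  -- bounded by a fixed number and the matrix is atomic.
  obtain ⟨X, hX⟩ := Def.out_lt (fun w => VSharpL.snd w < f (VSharpL.fst w) ∧
    P (VSharpL.fst w) (VSharpL.snd w)) (VSharpL.pr b (b' + 1))
  refine ⟨fun z => ∃ c ≤ b', VSharpL.pr z c ∈ X, Def.of_formula (φ := .exN 4 (.and (.le v4 v2)
    (.mem (pair v0 v4) 1))) (.exN (by simp) (.mem _ _))
    (by simp [Formula.FreeS]) (env b' 0) (senv X X) (by intros; simp [env, senv]), fun z hz => ?_⟩
  constructor
  · rintro ⟨c, hc, h⟩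
    rw [hX _ (pr_lt_pr hz (lt_succ_iff.2 hc))] at h
    simp only [fst_pr, snd_pr] at h
    exact ⟨c, h⟩
  · rintro ⟨c, hc, h⟩
    have hc' := hc.trans (hb' z hz)
    refine ⟨c, hc'.le, ?_⟩
    rw [hX _ (pr_lt_pr hz (lt_succ_iff.2 hc'.le))]
    simpa using ⟨hc, h⟩

instance Def.forall_lt (f : M.N → M.N) (P : M.N → M.N → Prop) [NF f]
    [Def fun w => P (VSharpL.fst w) (VSharpL.snd w)] : Def (fun z => ∀ c < f z, P z c) :=
  (inferInstance : Def fun z => ¬ ∃ c < f z, ¬ P z c).congr fun z => by push Not; rfl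

instance Def.mem_row (X : M.S) (f : M.N → M.N) [NF f] : Def (fun z => f z ∈ X) :=
  Def.comp (· ∈ X) f

end Definability

/-! ### String-valued functions, binary addition and shifts. -/

section Strings

variable {M : TwoSorted.{u, v}} [IsModel M]

/-- A string-valued function coded by a string on every initial segment. -/
class SF (F : M.N → M.S) : Prop where
  out : ∀ b, ∃ X : M.S, ∀ z < b, ∀ j, j ∈ F z ↔ pr z j ∈ X

theorem SF.bound (F : M.N → M.S) [hF : SF F] (b : M.N) : ∃ l, ∀ z < b, ∀ j ∈ F z, j < l := by
  obtain ⟨X, hX⟩ := hF.out b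
  exact ⟨M.len X, fun z hz j hj =>
    (le_pr_right z j).trans_lt (len_pos_of_mem ((hX z hz j).1 hj))⟩

instance Def.mem_sf (F : M.N → M.S) (g : M.N → M.N) [hF : SF F] [NF g] : Def (fun z => g z ∈ F z) :=
  Def.of_local fun b => by
  obtain ⟨X, hX⟩ := hF.out b
  exact ⟨fun z => pr z (g z) ∈ X, inferInstance, fun z hz => (hX z hz _).symm⟩

theorem SF.of_def (F : M.N → M.S) (h : Def fun w => snd w ∈ F (fst w))
    (hb : ∀ b, ∃ l, ∀ z < b, ∀ j ∈ F z, j < l) : SF F := ⟨fun b => by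
  obtain ⟨l, hl⟩ := hb b
  obtain ⟨X, hX⟩ := exists_string (fun w => snd w ∈ F (fst w)) (pr b l)
  obtain ⟨Y, hY⟩ := exists_string (fun w => w ∈ X ∧ pr (fst w) (snd w) = w) (pr b l)
  refine ⟨Y, fun z hz j => ?_⟩
  rw [hY, hX]
  simp only [fst_pr, snd_pr, and_true]
  exact ⟨fun h => ⟨pr_lt_pr hz (hl z hz j h), pr_lt_pr hz (hl z hz j h), h⟩, fun h => h.2.2⟩⟩

instance SF.const (X : M.S) : SF (fun _ => X) :=
  SF.of_def _ inferInstance fun _ => ⟨M.len X, fun _ _ _ hj => len_pos_of_mem hj⟩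

instance (priority := 100) SF.comp (F : M.N → M.S) (f : M.N → M.N) [SF F] [NF f] :
    SF (fun z => F (f z)) := by
  refine SF.of_def _ ?_ fun b => ?_
  · have : Def fun w => snd w ∈ F (fst w) := Def.of_local fun b => by
      obtain ⟨X, hX⟩ := SF.out (F := F) b
      exact ⟨fun w => pr (fst w) (snd w) ∈ X, inferInstance,
        fun w hw => (hX _ ((fst_le w).trans_lt hw) _).symm⟩
    exact Def.comp₂ (fun x y => y ∈ F x) (fun w => f (fst w)) (fun w => snd w)
  · obtain ⟨c, hc⟩ := NF.bound f b
    obtain ⟨l, hl⟩ := SF.bound F c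
    exact ⟨l, fun z hz j hj => hl _ (hc z hz) j hj⟩

instance Def.eq_sf (F G : M.N → M.S) [SF F] [SF G] : Def (fun z => F z = G z) :=
  Def.of_local fun b => by
  obtain ⟨l, hl⟩ := SF.bound F b
  obtain ⟨l', hl'⟩ := SF.bound G b
  refine ⟨fun z => ∀ j < l + l', (j ∈ F z ↔ j ∈ G z), inferInstance, fun z hz =>
    ⟨fun h => string_ext fun j => ⟨fun hj => ?_, fun hj => ?_⟩, fun h j _ => by rw [h]⟩⟩
  · exact (h j ((hl z hz j hj).trans_le le_self_add)).1 hj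
  · exact (h j ((hl' z hz j hj).trans_le le_add_self)).2 hj

open scoped Classical in
instance SF.ite (P : M.N → Prop) (F G : M.N → M.S) [∀ z, Decidable (P z)] [Def P] [SF F] [SF G] :
    SF (fun z => if P z then F z else G z) := by
  refine SF.of_def _ ((inferInstance : Def fun w => (P (fst w) ∧ snd w ∈ F (fst w)) ∨
    (¬ P (fst w) ∧ snd w ∈ G (fst w))).congr fun w => ?_) fun b => ?_
  · by_cases h : P (fst w) <;> simp [h]
  · obtain ⟨l, hl⟩ := SF.bound F b
    obtain ⟨l', hl'⟩ := SF.bound G b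
    refine ⟨l + l', fun z hz j => ?_⟩
    split_ifs
    · exact fun hj => (hl z hz j hj).trans_le le_self_add
    · exact fun hj => (hl' z hz j hj).trans_le le_add_self

open scoped Classical in
/-- The string `{z < b | P z}`, for a definable `P`. -/
noncomputable def mkS (P : M.N → Prop) (b : M.N) : M.S :=
  if h : ∃ X : M.S, ∀ z, z ∈ X ↔ z < b ∧ P z then h.choose else Classical.arbitrary _

@[simp] theorem mem_mkS (P : M.N → Prop) [Def P] (b z : M.N) : z ∈ mkS P b ↔ z < b ∧ P z := by
  have h := exists_string P b
  rw [mkS, dif_pos h]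
  exact h.choose_spec z

/-- The row `i` of the two-dimensional array `X`. -/
noncomputable def row (X : M.S) (i : M.N) : M.S := mkS (fun j => pr i j ∈ X) (M.len X)

@[simp] theorem mem_row (X : M.S) (i j : M.N) : j ∈ row X i ↔ pr i j ∈ X := by
  rw [row, mem_mkS]
  exact ⟨fun h => h.2, fun h => ⟨(le_pr_right i j).trans_lt (len_pos_of_mem h), h⟩⟩

instance sf_row (F : M.N → M.S) (f : M.N → M.N) [SF F] [NF f] : SF (fun z => row (F z) (f z)) := by
  refine SF.of_def _ ?_ fun b => ?_
  · simp only [mem_row]; infer_instance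
  · obtain ⟨l, hl⟩ := SF.bound F b
    exact ⟨l, fun z hz j hj => (le_pr_right _ j).trans_lt (hl z hz _ ((VSharpL.mem_row _ _ _).1 hj))⟩

/-- A string-valued function is given, up to a bound, by the rows of a string. -/
theorem SF.exists_row (F : M.N → M.S) [hF : SF F] (b : M.N) : ∃ X : M.S, ∀ z < b, row X z = F z := by
  obtain ⟨X, hX⟩ := hF.out b
  exact ⟨X, fun z hz => string_ext fun j => by rw [mem_row, hX z hz]⟩

/-! ### Addition of strings -/

/-- There is a carry into position `i` in the sum of `X` and `Y`. -/
def Carry (X Y : M.S) (i : M.N) : Prop :=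
  ∃ k < i, k ∈ X ∧ k ∈ Y ∧ ∀ j < i, k < j → (j ∈ X ∨ j ∈ Y)

instance Def.carry (F G : M.N → M.S) (f : M.N → M.N) [SF F] [SF G] [NF f] :
    Def (fun z => Carry (F z) (G z) (f z)) := by
  unfold Carry; infer_instance

instance (X Y : M.S) : Def (Carry X Y) := Def.carry (fun _ => X) (fun _ => Y) fun z => z

theorem not_carry_zero (X Y : M.S) : ¬ Carry X Y 0 := fun ⟨_, hk, _⟩ => not_lt.2 zero_le hk

/-- The explicit definition of the carry satisfies the ripple recursion of the adder; all later
facts on sums use only this recursion. -/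
theorem carry_succ (X Y : M.S) (i : M.N) :
    Carry X Y (i + 1) ↔ (i ∈ X ∧ i ∈ Y) ∨ (Carry X Y i ∧ (i ∈ X ∨ i ∈ Y)) := by
  constructor
  · rintro ⟨k, hk, h1, h2, h3⟩
    rcases (lt_succ_iff.1 hk).eq_or_lt with rfl | h
    · exact Or.inl ⟨h1, h2⟩
    · exact Or.inr ⟨⟨k, h, h1, h2, fun j hj => h3 j (hj.trans (lt_succ_iff.2 le_rfl))⟩,
        h3 i (lt_succ_iff.2 le_rfl) h⟩
  · rintro (⟨h1, h2⟩ | ⟨⟨k, hk, h1, h2, h3⟩, h⟩)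
    · exact ⟨i, lt_succ_iff.2 le_rfl, h1, h2, fun j hj hj' =>
        absurd hj' (not_lt.2 (lt_succ_iff.1 hj))⟩
    · refine ⟨k, hk.trans (lt_succ_iff.2 le_rfl), h1, h2, fun j hj hj' => ?_⟩
      rcases (lt_succ_iff.1 hj).eq_or_lt with rfl | h'
      · exact h
      · exact h3 j h' hj'

theorem carry_comm (X Y : M.S) (i : M.N) : Carry X Y i ↔ Carry Y X i := by
  unfold Carry
  constructor
  all_goals
    rintro ⟨k, hk, h1, h2, h3⟩
    exact ⟨k, hk, h2, h1, fun j hj hj' => (h3 j hj hj').symm⟩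

theorem not_carry_of_lt {X Y : M.S} {l i : M.N} (hX : ∀ j ∈ X, j < l) (hY : ∀ j ∈ Y, j < l)
    (hi : l < i) : ¬ Carry X Y i := by
  obtain ⟨k, rfl⟩ := exists_succ (pos_iff_ne_zero.1 (zero_le.trans_lt hi))
  rw [carry_succ]
  have hi' := lt_succ_iff.1 hi
  have h1 : k ∉ X := fun h => not_lt.2 hi' (hX k h)
  have h2 : k ∉ Y := fun h => not_lt.2 hi' (hY k h)
  tauto

/-- The bits of the sum of `X` and `Y`. -/
def SumBit (X Y : M.S) (i : M.N) : Prop := i ∈ X ↔ (i ∈ Y ↔ Carry X Y i)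

instance Def.sumBit (F G : M.N → M.S) (f : M.N → M.N) [SF F] [SF G] [NF f] :
    Def (fun z => SumBit (F z) (G z) (f z)) := by
  unfold SumBit; infer_instance

instance (X Y : M.S) : Def (SumBit X Y) := Def.sumBit (fun _ => X) (fun _ => Y) fun z => z

noncomputable instance : Zero M.S := ⟨mkS (fun _ => False) 0⟩

theorem not_mem_zero (i : M.N) : i ∉ (0 : M.S) := fun h => ((mem_mkS _ _ _).1 h).2

noncomputable instance : Add M.S := ⟨fun X Y => mkS (SumBit X Y) (M.len X + M.len Y + 1)⟩

theorem sumBit_bound {X Y : M.S} {l i : M.N} (hX : ∀ j ∈ X, j < l) (hY : ∀ j ∈ Y, j < l)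
    (h : SumBit X Y i) : i < l + 1 := by
  by_contra hi
  have hi' := succ_le_iff.1 (not_lt.1 hi)
  have h0 := not_carry_of_lt hX hY hi'
  have h1 : i ∉ X := fun h => (hX i h).not_gt hi'
  have h2 : i ∉ Y := fun h => (hY i h).not_gt hi'
  unfold SumBit at h
  tauto

theorem mem_add {X Y : M.S} {i : M.N} : i ∈ X + Y ↔ (i ∈ X ↔ (i ∈ Y ↔ Carry X Y i)) := by
  change i ∈ mkS _ _ ↔ SumBit X Y i
  rw [mem_mkS]
  exact ⟨fun h => h.2, fun h => ⟨sumBit_bound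
    (fun j hj => (len_pos_of_mem hj).trans_le le_self_add)
    (fun j hj => (len_pos_of_mem hj).trans_le le_add_self) h, h⟩⟩

instance SF.add (F G : M.N → M.S) [SF F] [SF G] : SF (fun z => F z + G z) := by
  refine SF.of_def _ ?_ fun b => ?_
  · simp only [mem_add]; infer_instance
  · obtain ⟨l, hl⟩ := SF.bound F b
    obtain ⟨l', hl'⟩ := SF.bound G b
    exact ⟨l + l' + 1, fun z hz j hj => sumBit_bound
      (fun j hj => (hl z hz j hj).trans_le le_self_add)
      (fun j hj => (hl' z hz j hj).trans_le le_add_self) (mem_add.1 hj)⟩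

namespace Str

theorem add_comm' (X Y : M.S) : X + Y = Y + X := string_ext fun i => by
  rw [mem_add, mem_add, carry_comm Y X]; tauto

theorem not_carry_of_disjoint {X Y : M.S} (h : ∀ i, ¬ (i ∈ X ∧ i ∈ Y)) (i : M.N) : ¬ Carry X Y i :=
  fun ⟨k, _, h1, h2, _⟩ => h k ⟨h1, h2⟩

theorem mem_add_of_disjoint {X Y : M.S} (h : ∀ i, ¬ (i ∈ X ∧ i ∈ Y)) {i : M.N} :
    i ∈ X + Y ↔ i ∈ X ∨ i ∈ Y := by
  have := h i
  have := not_carry_of_disjoint h i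
  rw [mem_add]; tauto

theorem zero_add' (X : M.S) : 0 + X = X := string_ext fun i => by
  rw [mem_add_of_disjoint fun i h => not_mem_zero i h.1]
  exact ⟨fun h => h.resolve_left (not_mem_zero i), Or.inr⟩

theorem add_assoc' (X Y Z : M.S) : X + Y + Z = X + (Y + Z) := by
  -- The two ways of adding three strings need not produce the same carries one by one, but at each
  -- position they produce the same number of carries: equal conjunction and equal disjunction of
  -- the two carry bits say exactly this.
  have key := Def.induction (P := fun i =>
    ((Carry X Y i ∧ Carry (X + Y) Z i) ↔ (Carry Y Z i ∧ Carry X (Y + Z) i)) ∧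
    ((Carry X Y i ∨ Carry (X + Y) Z i) ↔ (Carry Y Z i ∨ Carry X (Y + Z) i)))
    (by simp [not_carry_zero]) (fun i ih => by
      simp only [carry_succ, mem_add]
      generalize Carry X Y i = c1 at *
      generalize Carry (X + Y) Z i = c2 at *
      generalize Carry Y Z i = c3 at *
      generalize Carry X (Y + Z) i = c4 at *
      generalize (i ∈ X) = x
      generalize (i ∈ Y) = y
      generalize (i ∈ Z) = z
      by_cases c1 <;> by_cases c2 <;> by_cases c3 <;> by_cases c4 <;> by_cases x <;> by_cases y <;>
        by_cases z <;> simp_all)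
  refine string_ext fun i => ?_
  have ih := key i
  simp only [mem_add]
  generalize Carry X Y i = c1 at *
  generalize Carry (X + Y) Z i = c2 at *
  generalize Carry Y Z i = c3 at *
  generalize Carry X (Y + Z) i = c4 at *
  generalize (i ∈ X) = x
  generalize (i ∈ Y) = y
  generalize (i ∈ Z) = z
  by_cases c1 <;> by_cases c2 <;> by_cases c3 <;> by_cases c4 <;> by_cases x <;> by_cases y <;>
    by_cases z <;> simp_all

/-- Equal sum bits and equal carries into position i force equal bits of X and Y at i, hence equal
carries into i + 1. -/
theorem add_right_cancel' (X Y Z : M.S) (h : X + Z = Y + Z) : X = Y := by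
  have hm : ∀ i, i ∈ X + Z ↔ i ∈ Y + Z := fun i => by rw [h]
  simp only [mem_add] at hm
  have key := Def.induction (P := fun i => Carry X Z i ↔ Carry Y Z i)
    (by simp [not_carry_zero]) (fun i ih => by
      have := hm i
      simp only [carry_succ]
      tauto)
  refine string_ext fun i => ?_
  have := hm i
  have := key i
  tauto

end Str

noncomputable instance : AddCommMonoid M.S where
  add_assoc := Str.add_assoc'
  zero_add := Str.zero_add'
  add_zero X := by rw [Str.add_comm', Str.zero_add']
  add_comm := Str.add_comm'
  nsmul := nsmulRec

instance : IsCancelAdd M.S :=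
  have h : IsRightCancelAdd M.S := ⟨fun a b c h => Str.add_right_cancel' b c a h⟩
  AddCommMagma.IsRightCancelAdd.toIsCancelAdd M.S

/-! ### Shifts -/

/-- The string `2 ^ i · Y`. -/
noncomputable def shift (i : M.N) (Y : M.S) : M.S :=
  mkS (fun j => ∃ k < M.len Y, j = i + k ∧ k ∈ Y) (i + M.len Y)

theorem mem_shift {i j : M.N} {Y : M.S} : j ∈ shift i Y ↔ ∃ k, j = i + k ∧ k ∈ Y := by
  rw [shift, mem_mkS]
  constructor
  · rintro ⟨_, k, _, h1, h2⟩
    exact ⟨k, h1, h2⟩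
  · rintro ⟨k, rfl, h2⟩
    exact ⟨by gcongr; exact len_pos_of_mem h2, k, len_pos_of_mem h2, rfl, h2⟩

@[simp] theorem add_mem_shift {i j : M.N} {Y : M.S} : i + j ∈ shift i Y ↔ j ∈ Y := by
  rw [mem_shift]
  exact ⟨fun ⟨k, h, hk⟩ => (add_left_cancel h) ▸ hk, fun h => ⟨j, rfl, h⟩⟩

theorem not_mem_shift {i j : M.N} {Y : M.S} (h : j < i) : j ∉ shift i Y := fun h' => by
  obtain ⟨k, rfl, _⟩ := mem_shift.1 h'
  exact not_lt.2 le_self_add h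

instance SF.shift (f : M.N → M.N) (F : M.N → M.S) [NF f] [SF F] :
    SF (fun z => shift (f z) (F z)) := by
  refine SF.of_def _ ?_ fun b => ?_
  · refine (inferInstance : Def fun w => ∃ k < snd w + 1, snd w = f (fst w) + k ∧ k ∈ F (fst w)).congr
      fun w => ?_
    rw [mem_shift]
    exact ⟨fun ⟨k, _, h⟩ => ⟨k, h⟩, fun ⟨k, h⟩ => ⟨k, lt_succ_iff.2 (h.1 ▸ le_add_self), h⟩⟩
  · obtain ⟨l, hl⟩ := SF.bound F b
    obtain ⟨c, hc⟩ := NF.bound f b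
    refine ⟨c + l, fun z hz j hj => ?_⟩
    obtain ⟨k, rfl, hk⟩ := mem_shift.1 hj
    exact add_lt_add (hc z hz) (hl z hz k hk)

theorem string_ext_shift {i : M.N} {X Y : M.S} (h : ∀ j < i, j ∈ X ↔ j ∈ Y)
    (h' : ∀ k, i + k ∈ X ↔ i + k ∈ Y) : X = Y := string_ext fun j => by
  rcases lt_or_ge j i with hj | hj
  · exact h j hj
  · obtain ⟨k, rfl⟩ := exists_add_of_le hj
    exact h' k

@[simp] theorem shift_zero_left (Y : M.S) : shift 0 Y = Y := string_ext fun j => by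
  rw [← add_mem_shift (i := 0) (Y := Y), zero_add]

@[simp] theorem shift_zero (i : M.N) : shift i (0 : M.S) = 0 := string_ext fun j =>
  ⟨fun h => by obtain ⟨k, _, hk⟩ := mem_shift.1 h; exact absurd hk (not_mem_zero k),
    fun h => absurd h (not_mem_zero j)⟩

theorem shift_shift (i j : M.N) (Y : M.S) : shift i (shift j Y) = shift (i + j) Y := by
  refine string_ext fun k => ?_
  simp only [mem_shift]
  constructor
  · rintro ⟨_, rfl, l, rfl, h⟩
    exact ⟨l, by rw [add_assoc], h⟩
  · rintro ⟨l, rfl, h⟩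
    exact ⟨j + l, by rw [add_assoc], l, rfl, h⟩

theorem not_carry_shift {i j : M.N} {X Y : M.S} (h : j ≤ i) : ¬ Carry (shift i X) (shift i Y) j :=
  fun ⟨_, hk, h1, _⟩ => not_mem_shift (hk.trans_le h) h1

theorem carry_shift (i k : M.N) (X Y : M.S) :
    Carry (shift i X) (shift i Y) (i + k) ↔ Carry X Y k := by
  refine Def.induction (P := fun k => Carry (shift i X) (shift i Y) (i + k) ↔ Carry X Y k)
    ?_ (fun k ih => ?_) k
  · simp [not_carry_zero, not_carry_shift]
  · rw [← add_assoc, carry_succ, carry_succ, ih, add_mem_shift, add_mem_shift]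

theorem shift_add (i : M.N) (X Y : M.S) : shift i (X + Y) = shift i X + shift i Y := by
  refine string_ext_shift (i := i) (fun j hj => ?_) fun k => ?_
  · have h1 := not_mem_shift (Y := X) hj
    have h2 := not_mem_shift (Y := Y) hj
    have h3 := not_mem_shift (Y := X + Y) hj
    have h4 := not_carry_shift (X := X) (Y := Y) hj.le
    rw [mem_add]; tauto
  · rw [add_mem_shift, mem_add, mem_add, carry_shift, add_mem_shift, add_mem_shift]

/-- Doubling shifts by one place because the carry into j + 1 in Y + Y is the bit j of Y. -/
theorem shift_one (Y : M.S) : shift 1 Y = Y + Y := by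
  have key : ∀ j, Carry Y Y (j + 1) ↔ j ∈ Y := fun j => by rw [carry_succ]; tauto
  refine string_ext_shift (i := 1) (fun j hj => ?_) fun k => ?_
  · have h1 := not_mem_shift (Y := Y) hj
    obtain rfl : j = 0 := le_antisymm (lt_succ_iff.1 (by simpa using hj)) zero_le
    have := not_carry_zero Y Y
    rw [mem_add]; tauto
  · rw [add_mem_shift, mem_add, add_comm 1 k, key]; tauto

theorem shift_succ (i : M.N) (Y : M.S) : shift (i + 1) Y = shift i Y + shift i Y := by
  rw [← shift_shift, shift_one, shift_add]

end Strings

section Worlds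

/-! ### Evaluation of formulas with parameters

A world is a model with an assignment to the variables named below some number; the assignment
of the remaining variables is irrelevant, as a later world may change it. -/

/-- An assignment together with a number `d` such that the variables `d, d + 1, …` are unused. -/
structure World (M : TwoSorted.{u, v}) where
  d : ℕ
  a : ℕ → M.N
  B : ℕ → M.S

variable {M : TwoSorted.{u, v}}

instance : Preorder (World M) where
  le w w' := w.d ≤ w'.d ∧ (∀ i < w.d, w'.a i = w.a i) ∧ ∀ i < w.d, w'.B i = w.B i
  le_refl w := ⟨le_rfl, fun _ _ => rfl, fun _ _ => rfl⟩
  le_trans w w' w'' h h' := ⟨h.1.trans h'.1,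
    fun i hi => (h'.2.1 i (hi.trans_le h.1)).trans (h.2.1 i hi),
    fun i hi => (h'.2.2 i (hi.trans_le h.1)).trans (h.2.2 i hi)⟩

/-- The term `t` has the value `n` in all later worlds. -/
def NumD (w : World M) (t : NTerm) (n : M.N) : Prop := ∀ w' ≥ w, t.eval M w'.a w'.B = n

/-- The string variable `X` has the value `C`. -/
def StrD (w : World M) (X : ℕ) (C : M.S) : Prop := X < w.d ∧ w.B X = C

/-- In all later worlds, the formula `φ` expresses `P`. -/
def FmD (w : World M) (φ : Fm) (P : Prop) : Prop :=
  ∀ w' ≥ w, (φ w'.d).Realize M w'.a w'.B ↔ P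

/-- The pair of variables `x` has the value `c`. -/
def PairD (w : World M) (x : PairVar) (c : M.S × M.S) : Prop := StrD w x.pos c.1 ∧ StrD w x.neg c.2

theorem NumD.mono {w w' : World M} (h : w ≤ w') {t : NTerm} {n : M.N} (ht : NumD w t n) :
    NumD w' t n := fun w'' h' => ht w'' (h.trans h')

theorem StrD.mono {w w' : World M} (h : w ≤ w') {X : ℕ} {C : M.S} (hX : StrD w X C) :
    StrD w' X C := ⟨hX.1.trans_le h.1, (h.2.2 X hX.1).trans hX.2⟩

theorem FmD.mono {w w' : World M} (h : w ≤ w') {φ : Fm} {P : Prop} (hφ : FmD w φ P) :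
    FmD w' φ P := fun w'' h' => hφ w'' (h.trans h')

theorem PairD.mono {w w' : World M} (h : w ≤ w') {x : PairVar} {c : M.S × M.S} (hx : PairD w x c) :
    PairD w' x c := ⟨hx.1.mono h, hx.2.mono h⟩

variable {w : World M}

theorem NumD.zero : NumD w 0 0 := fun _ _ => rfl
theorem NumD.one : NumD w 1 1 := fun _ _ => rfl
theorem NumD.add {s t : NTerm} {m n : M.N} (hs : NumD w s m) (ht : NumD w t n) :
    NumD w (s + t) (m + n) := fun w' h => by rw [eval_add, hs w' h, ht w' h]
theorem NumD.mul {s t : NTerm} {m n : M.N} (hs : NumD w s m) (ht : NumD w t n) :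
    NumD w (s * t) (m * n) := fun w' h => by rw [eval_mul, hs w' h, ht w' h]
theorem NumD.pair {s t : NTerm} {m n : M.N} (hs : NumD w s m) (ht : NumD w t n) :
    NumD w (pair s t) (pr m n) := fun w' h => by rw [eval_pair, hs w' h, ht w' h]
theorem NumD.len {X : ℕ} {C : M.S} (hX : StrD w X C) : NumD w (.len X) (M.len C) := fun w' h => by
  rw [eval_len, (hX.mono h).2]

theorem FmD.congr {φ : Fm} {P Q : Prop} (h : FmD w φ P) (hPQ : P ↔ Q) : FmD w φ Q :=
  fun w' h' => (h w' h').trans hPQ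

theorem FmD.eqNum {s t : NTerm} {m n : M.N} (hs : NumD w s m) (ht : NumD w t n) :
    FmD w (eqNum s t) (m = n) := fun w' h => by
  change s.eval M _ _ = t.eval M _ _ ↔ _
  rw [hs w' h, ht w' h]

theorem FmD.leNum {s t : NTerm} {m n : M.N} (hs : NumD w s m) (ht : NumD w t n) :
    FmD w (leNum s t) (m ≤ n) := fun w' h => by
  change s.eval M _ _ ≤ t.eval M _ _ ↔ _
  rw [hs w' h, ht w' h]

theorem FmD.memStr {t : NTerm} {n : M.N} {X : ℕ} {C : M.S} (ht : NumD w t n) (hX : StrD w X C) :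
    FmD w (memStr t X) (n ∈ C) := fun w' h => by
  change t.eval M _ _ ∈ w'.B X ↔ _
  rw [ht w' h, (hX.mono h).2]

theorem FmD.eqStr {X Y : ℕ} {C D : M.S} (hX : StrD w X C) (hY : StrD w Y D) :
    FmD w (eqStr X Y) (C = D) := fun w' h => by
  change w'.B X = w'.B Y ↔ _
  rw [(hX.mono h).2, (hY.mono h).2]

theorem FmD.neg {φ : Fm} {P : Prop} (h : FmD w φ P) : FmD w (neg φ) (¬ P) :=
  fun w' h' => not_congr (h w' h')

/-- The second conjunct has to be evaluated only when the first holds. This makes bounds on indices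
and case conditions available for expressions that have a known value only under them. -/
theorem FmD.conj {φ ψ : Fm} {P Q : Prop} (h : FmD w φ P) (h' : P → FmD w ψ Q) :
    FmD w (φ ⋏ ψ) (P ∧ Q) := fun w' hw => by
  change (φ w'.d).Realize M _ _ ∧ (ψ w'.d).Realize M _ _ ↔ _
  rw [h w' hw]
  exact and_congr_right fun hP => h' hP w' hw

theorem FmD.impl {φ ψ : Fm} {P Q : Prop} (h : FmD w φ P) (h' : P → FmD w ψ Q) :
    FmD w (φ ⟹ ψ) (P → Q) := fun w' hw => by
  change ((φ w'.d).Realize M _ _ → (ψ w'.d).Realize M _ _) ↔ _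
  rw [h w' hw]
  exact forall_congr' fun hP => h' hP w' hw

theorem FmD.disj {φ ψ : Fm} {P Q : Prop} (h : FmD w φ P) (h' : FmD w ψ Q) :
    FmD w (φ ⋎ ψ) (P ∨ Q) := fun w' hw => or_congr (h w' hw) (h' w' hw)

theorem FmD.equi {φ ψ : Fm} {P Q : Prop} (h : FmD w φ P) (h' : FmD w ψ Q) :
    FmD w (φ ⟺ ψ) (P ↔ Q) :=
  ((h.impl fun _ => h').conj fun _ => h'.impl fun _ => h).congr iff_iff_implies_and_implies.symm

/-- Binding the first unused variable to c leads to a later world, and no world after that one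
changes the value. -/
theorem FmD.allNum {f : NTerm → Fm} {P : M.N → Prop}
    (h : ∀ w' ≥ w, ∀ x c, NumD w' x c → FmD w' (f x) (P c)) : FmD w (allNum f) (∀ c, P c) :=
  fun w' hw => by
  refine forall_congr' fun c => ?_
  have hw' : w' ≤ ⟨w'.d + 1, Function.update w'.a w'.d c, w'.B⟩ :=
    ⟨Nat.le_succ _, fun i hi => Function.update_of_ne hi.ne _ _, fun _ _ => rfl⟩
  exact h _ (hw.trans hw') (.var w'.d) c
    (fun w'' h'' => (h''.2.1 _ (Nat.lt_succ_self _)).trans (Function.update_self _ _ _)) _ le_rfl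

theorem FmD.allStr {f : ℕ → Fm} {P : M.S → Prop}
    (h : ∀ w' ≥ w, ∀ x c, StrD w' x c → FmD w' (f x) (P c)) : FmD w (allStr f) (∀ c, P c) :=
  fun w' hw => by
  refine forall_congr' fun c => ?_
  have hw' : w' ≤ ⟨w'.d + 1, w'.a, Function.update w'.B w'.d c⟩ :=
    ⟨Nat.le_succ _, fun _ _ => rfl, fun i hi => Function.update_of_ne hi.ne _ _⟩
  exact h _ (hw.trans hw') w'.d c ⟨Nat.lt_succ_self _, Function.update_self _ _ _⟩ _ le_rfl

theorem FmD.exNum {f : NTerm → Fm} {P : M.N → Prop}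
    (h : ∀ w' ≥ w, ∀ x c, NumD w' x c → FmD w' (f x) (P c)) : FmD w (exNum f) (∃ c, P c) :=
  fun w' hw => by
  have := (FmD.allNum (f := fun x => VSharpL.neg (f x)) (P := fun c => ¬ P c)
    fun w' hw x c hx => (h w' hw x c hx).neg) w' hw
  rw [← not_forall_not, ← this]
  exact not_forall_not.symm

theorem FmD.exStr {f : ℕ → Fm} {P : M.S → Prop}
    (h : ∀ w' ≥ w, ∀ x c, StrD w' x c → FmD w' (f x) (P c)) : FmD w (exStr f) (∃ c, P c) :=
  fun w' hw => by
  have := (FmD.allStr (f := fun x => VSharpL.neg (f x)) (P := fun c => ¬ P c)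
    fun w' hw x c hx => (h w' hw x c hx).neg) w' hw
  rw [← not_forall_not, ← this]
  exact not_forall_not.symm

theorem FmD.allPair {f : PairVar → Fm} {P : M.S × M.S → Prop}
    (h : ∀ w' ≥ w, ∀ x c, PairD w' x c → FmD w' (f x) (P c)) : FmD w (allPair f) (∀ c, P c) :=
  (FmD.allStr (P := fun p => ∀ n, P (p, n)) fun _ hw x _ hp =>
    FmD.allStr fun w'' hw' y _ hn => h w'' (hw.trans hw') ⟨x, y⟩ _ ⟨hp.mono hw', hn⟩).congr
    Prod.forall.symm

theorem FmD.exPair {f : PairVar → Fm} {P : M.S × M.S → Prop}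
    (h : ∀ w' ≥ w, ∀ x c, PairD w' x c → FmD w' (f x) (P c)) : FmD w (exPair f) (∃ c, P c) :=
  (FmD.exStr (P := fun p => ∃ n, P (p, n)) fun _ hw x _ hp =>
    FmD.exStr fun w'' hw' y _ hn => h w'' (hw.trans hw') ⟨x, y⟩ _ ⟨hp.mono hw', hn⟩).congr
    Prod.exists.symm

variable [IsModel M]

theorem FmD.ltNum {s t : NTerm} {m n : M.N} (hs : NumD w s m) (ht : NumD w t n) :
    FmD w (ltNum s t) (m < n) :=
  ((FmD.leNum hs ht).conj fun _ => (FmD.eqNum hs ht).neg).congr lt_iff_le_and_ne.symm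

theorem FmD.allLt {t : NTerm} {n : M.N} {f : NTerm → Fm} {P : M.N → Prop} (ht : NumD w t n)
    (h : ∀ w' ≥ w, ∀ x c, NumD w' x c → c < n → FmD w' (f x) (P c)) :
    FmD w (allLt t f) (∀ c < n, P c) :=
  FmD.allNum fun w' hw x c hx => (FmD.ltNum hx (ht.mono hw)).impl fun hc => h w' hw x c hx hc

theorem FmD.isRow {Z X : ℕ} {C D : M.S} {t : NTerm} {n : M.N} (hZ : StrD w Z C) (ht : NumD w t n)
    (hX : StrD w X D) : FmD w (isRow Z t X) (D = row C n) := by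
  refine (FmD.allNum (P := fun j => j ∈ D ↔ pr n j ∈ C) fun w' hw x c hx =>
    (FmD.memStr hx (hX.mono hw)).equi
      (FmD.memStr (NumD.pair (ht.mono hw) hx) (hZ.mono hw))).congr ?_
  exact ⟨fun h => string_ext fun j => by rw [h, mem_row], fun h j => by rw [h, mem_row]⟩

theorem FmD.carry {X Y : ℕ} {C D : M.S} {t : NTerm} {n : M.N} (hX : StrD w X C) (hY : StrD w Y D)
    (ht : NumD w t n) : FmD w (carry X Y t) (Carry C D n) :=
  FmD.exNum fun _ hw _ _ hk => (FmD.ltNum hk (ht.mono hw)).conj fun _ =>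
    (FmD.memStr hk (hX.mono hw)).conj fun _ => (FmD.memStr hk (hY.mono hw)).conj fun _ =>
      FmD.allLt (ht.mono hw) fun _ hw' _ _ hj _ => (FmD.ltNum (hk.mono hw') hj).impl fun _ =>
        (FmD.memStr hj (hX.mono (hw.trans hw'))).disj (FmD.memStr hj (hY.mono (hw.trans hw')))

theorem FmD.isSum {X Y Z : ℕ} {A B C : M.S} (hX : StrD w X A) (hY : StrD w Y B)
    (hZ : StrD w Z C) : FmD w (isSum X Y Z) (C = A + B) :=
  (FmD.allNum fun _ hw _ _ hi => (FmD.memStr hi (hZ.mono hw)).equi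
    ((FmD.memStr hi (hX.mono hw)).equi ((FmD.memStr hi (hY.mono hw)).equi
      (FmD.carry (hX.mono hw) (hY.mono hw) hi)))).congr
    ⟨fun h => string_ext fun i => by rw [h, mem_add], fun h i => by rw [h, mem_add]⟩

theorem FmD.isShift {Y Z : ℕ} {B C : M.S} {t : NTerm} {n : M.N} (ht : NumD w t n)
    (hY : StrD w Y B) (hZ : StrD w Z C) : FmD w (isShift t Y Z) (C = shift n B) :=
  (FmD.allNum fun _ hw _ _ hj => (FmD.memStr hj (hZ.mono hw)).equi
    (FmD.exNum fun _ hw' _ _ hk => (FmD.eqNum (hj.mono hw') ((ht.mono (hw.trans hw')).add hk)).conj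
      fun _ => FmD.memStr hk (hY.mono (hw.trans hw')))).congr
    ⟨fun h => string_ext fun i => by rw [h, mem_shift], fun h i => by rw [h, mem_shift]⟩

open scoped Classical in
/-- `Z` is the product of `X` and `Y`, with the table `W` of partial products. -/
def IsProd (X Y Z : M.S) : Prop := ∃ W, row W 0 = 0 ∧
  (∀ i < M.len X, row W (i + 1) = row W i + if i ∈ X then shift i Y else 0) ∧ Z = row W (M.len X)

theorem eq_zero_of_len_eq_zero {X : M.S} : M.len X = 0 ↔ X = 0 := by
  constructor
  · intro h
    refine string_ext fun i => ⟨fun hi => ?_, fun hi => absurd hi (not_mem_zero i)⟩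
    exact absurd (len_pos_of_mem hi) (by rw [h]; exact not_lt.2 zero_le)
  · rintro rfl
    by_contra h
    obtain ⟨y, hy⟩ := exists_succ h
    exact not_mem_zero y (mem_of_succ_eq_len hy.symm)

theorem FmD.isProd {X Y Z : ℕ} {A B C : M.S} (hX : StrD w X A) (hY : StrD w Y B)
    (hZ : StrD w Z C) : FmD w (isProd X Y Z) (IsProd A B C) := by
  refine FmD.exStr fun w1 hw1 W D hW => ?_
  replace hX := hX.mono hw1
  replace hY := hY.mono hw1
  replace hZ := hZ.mono hw1
  refine FmD.conj ((FmD.exStr fun w2 hw2 U E hU => (FmD.isRow (hW.mono hw2) NumD.zero hU).conj fun _ =>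
    FmD.eqNum (NumD.len hU) NumD.zero).congr ?_) fun _ => FmD.conj ?_ fun _ =>
      FmD.isRow hW (NumD.len hX) hZ
  · simp [eq_zero_of_len_eq_zero]
  · refine FmD.allLt (NumD.len hX) fun w2 hw2 i n hi hn => ?_
    replace hX := hX.mono hw2
    replace hY := hY.mono hw2
    replace hW := hW.mono hw2
    refine (FmD.exStr fun w3 hw3 U E hU => FmD.exStr fun w4 hw4 V F hV =>
      (FmD.isRow ((hW.mono hw3).mono hw4) ((hi.mono hw3).mono hw4) (hU.mono hw4)).conj fun _ =>
      (FmD.isRow ((hW.mono hw3).mono hw4) (((hi.mono hw3).mono hw4).add NumD.one) hV).conj fun _ =>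
      (((FmD.memStr ((hi.mono hw3).mono hw4) ((hX.mono hw3).mono hw4)).conj fun _ =>
        FmD.exStr fun w5 hw5 T G hT =>
        (FmD.isShift (((hi.mono hw3).mono hw4).mono hw5) (((hY.mono hw3).mono hw4).mono hw5) hT).conj
        fun _ => FmD.isSum ((hU.mono hw4).mono hw5) hT (hV.mono hw5)).disj
      ((FmD.memStr ((hi.mono hw3).mono hw4) ((hX.mono hw3).mono hw4)).neg.conj fun _ =>
        FmD.eqStr (hU.mono hw4) hV))).congr ?_
    by_cases h : n ∈ A <;> simp [h, eq_comm]

/-- A closed formula in a model. -/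
theorem FmD.satisfies {φ : Fm} {P : Prop} (h : ∀ w : World M, FmD w φ P) (hP : P) :
    M.Satisfies (φ 0) := fun a B => (h ⟨0, a, B⟩ _ le_rfl).2 hP

theorem FmD.of_satisfies {φ : Fm} {P : Prop} (h : ∀ w : World M, FmD w φ P)
    (hφ : M.Satisfies (φ 0)) : P :=
  (h ⟨0, fun _ => 0, fun _ => Classical.arbitrary _⟩ _ le_rfl).1 (hφ _ _)

theorem exists_isProd (X Y : M.S) : ∃ Z, IsProd X Y Z :=
  FmD.of_satisfies (M := M) (φ := VSharpL.allStr fun X => VSharpL.allStr fun Y =>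
      VSharpL.exStr fun Z => VSharpL.isProd X Y Z)
    (P := ∀ X Y : M.S, ∃ Z, IsProd X Y Z)
    (fun w => FmD.allStr fun _ _ _ _ hX => FmD.allStr fun _ hw' _ _ hY => FmD.exStr
      fun _ hw'' _ _ hZ => FmD.isProd ((hX.mono hw').mono hw'') (hY.mono hw'') hZ)
    (IsModel.sat _ (Or.inr (Or.inl rfl))) X Y

end Worlds

section Product

/-! ### Multiplication of strings -/

variable {M : TwoSorted.{u, v}} [IsModel M]

instance (X : M.S) : SF (row X) := sf_row (fun _ => X) fun z => z

noncomputable instance : Mul M.S := ⟨fun X Y => (exists_isProd X Y).choose⟩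

open scoped Classical in
-- The table of partial products is continued as a constant beyond |X|. The recursion then holds at
-- every index, and tables for factors of different lengths can be compared at a common index.
theorem mul_table (X Y : M.S) : ∃ V : M.N → M.S, SF V ∧ V 0 = 0 ∧
    (∀ i, V (i + 1) = V i + if i ∈ X then shift i Y else 0) ∧
    ∀ i, (∀ j ∈ X, j < i) → V i = X * Y := by
  obtain ⟨W, h0, hs, hZ⟩ := (exists_isProd X Y).choose_spec
  have hl : ∀ i, (∀ j ∈ X, j < i) → M.len X ≤ i := fun i hi => by
    by_cases e : M.len X = 0
    · rw [e]; exact zero_le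
    · obtain ⟨y, hy⟩ := exists_succ e
      rw [hy, succ_le_iff]
      exact hi y (mem_of_succ_eq_len hy.symm)
  refine ⟨fun i => if i < M.len X then row W i else row W (M.len X), inferInstance, ?_,
    fun i => ?_, fun i hi => ?_⟩
  · dsimp only
    split_ifs with h
    · exact h0
    · rw [le_antisymm (not_lt.1 h) zero_le, h0]
  · dsimp only
    by_cases h : i < M.len X
    · rw [if_pos h, ← hs i h]
      split_ifs with h'
      · rfl
      · rw [le_antisymm (succ_le_iff.2 h) (not_lt.1 h')]
    · have h' : ¬ i + 1 < M.len X := fun h' => h ((lt_succ_iff.2 le_rfl).trans h')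
      rw [if_neg h, if_neg h', if_neg (fun h'' => h (len_pos_of_mem h'')), add_zero]
  · dsimp only
    rw [if_neg (not_lt.2 (hl i hi))]
    exact hZ.symm

namespace Str

theorem exists_bound₃ (X Y Z : M.S) :
    ∃ l, (∀ j ∈ X, j < l) ∧ (∀ j ∈ Y, j < l) ∧ ∀ j ∈ Z, j < l :=
  ⟨M.len X + M.len Y + M.len Z,
    fun _ hj => (len_pos_of_mem hj).trans_le (by rw [add_assoc]; exact le_self_add),
    fun _ hj => (len_pos_of_mem hj).trans_le (le_add_self.trans le_self_add),
    fun _ hj => (len_pos_of_mem hj).trans_le le_add_self⟩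

theorem mul_add' (X Y Z : M.S) : X * (Y + Z) = X * Y + X * Z := by
  obtain ⟨U, hU, hU0, hUs, hUe⟩ := mul_table X (Y + Z)
  obtain ⟨V, hV, hV0, hVs, hVe⟩ := mul_table X Y
  obtain ⟨W, hW, hW0, hWs, hWe⟩ := mul_table X Z
  have key := Def.induction (P := fun i => U i = V i + W i) (by rw [hU0, hV0, hW0, add_zero])
    (fun i ih => by
      rw [hUs, hVs, hWs, ih]
      split_ifs
      · rw [shift_add]; abel
      · abel)
  obtain ⟨l, h, -⟩ := exists_bound₃ X X X
  rw [← hUe l h, ← hVe l h, ← hWe l h, key]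

theorem mul_zero' (X : M.S) : X * 0 = 0 := by
  have h := mul_add' X 0 0
  rw [add_zero] at h
  exact (left_eq_add.1 h)

theorem zero_mul' (X : M.S) : 0 * X = 0 := by
  obtain ⟨U, hU, hU0, hUs, hUe⟩ := mul_table 0 X
  rw [← hUe 0 fun j hj => absurd hj (not_mem_zero j), hU0]

open scoped Classical in
theorem add_mul' (X Y Z : M.S) : (X + Y) * Z = X * Z + Y * Z := by
  obtain ⟨U, hU, hU0, hUs, hUe⟩ := mul_table (X + Y) Z
  obtain ⟨V, hV, hV0, hVs, hVe⟩ := mul_table X Z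
  obtain ⟨W, hW, hW0, hWs, hWe⟩ := mul_table Y Z
  have key := Def.induction
    -- The table for X + Y lags behind the sum of the two tables by 2^i · Z exactly when a carry
    -- into position i is pending.
    (P := fun i => (U i + if Carry X Y i then shift i Z else 0) = V i + W i)
    (by rw [hU0, hV0, hW0, if_neg (not_carry_zero X Y)])
    (fun i ih => by
      have e : U i + (if Carry X Y i then shift i Z else 0) + ((if i ∈ X then shift i Z else 0) +
        if i ∈ Y then shift i Z else 0) = V (i + 1) + W (i + 1) := by
        rw [hVs, hWs, ih]; abel
      rw [← e, hUs, shift_succ]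
      simp only [carry_succ, mem_add]
      by_cases h1 : i ∈ X <;> by_cases h2 : i ∈ Y <;> by_cases h3 : Carry X Y i <;>
        simp [h1, h2, h3] <;> abel)
  obtain ⟨l, h1, h2, h3⟩ := exists_bound₃ X Y (X + Y)
  have hc : ¬ Carry X Y (l + 1) := not_carry_of_lt h1 h2 (lt_succ_iff.2 le_rfl)
  have hl : l < l + 1 := lt_succ_iff.2 le_rfl
  have := key (l + 1)
  rw [if_neg hc, add_zero] at this
  rw [← hUe (l + 1) fun j hj => (h3 j hj).trans hl, ← hVe (l + 1) fun j hj => (h1 j hj).trans hl,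
    ← hWe (l + 1) fun j hj => (h2 j hj).trans hl, this]

end Str

noncomputable instance : One M.S := ⟨mkS (fun z => z = 0) 1⟩

theorem mem_one {i : M.N} : i ∈ (1 : M.S) ↔ i = 0 := by
  change i ∈ mkS _ _ ↔ _
  rw [mem_mkS]
  exact ⟨fun h => h.2, fun h => ⟨h ▸ zero_lt_one, h⟩⟩

theorem mem_shift_one {i j : M.N} : j ∈ shift i (1 : M.S) ↔ j = i := by
  rw [mem_shift]
  simp [mem_one]

open scoped Classical in
-- Here `mkS (· ∈ X) i` is X reduced modulo 2^i. The recursion supports induction along the bits of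
-- X.
theorem mkS_succ (X : M.S) (i : M.N) :
    mkS (· ∈ X) (i + 1) = mkS (· ∈ X) i + if i ∈ X then shift i 1 else 0 := by
  have hd : ∀ j, ¬ (j ∈ mkS (· ∈ X) i ∧ j ∈ if i ∈ X then shift i (1 : M.S) else 0) := by
    rintro j ⟨h1, h2⟩
    rw [mem_mkS] at h1
    split_ifs at h2
    · rw [mem_shift_one] at h2
      exact h1.1.ne h2
    · exact not_mem_zero j h2
  refine string_ext fun j => ?_
  rw [Str.mem_add_of_disjoint hd, mem_mkS, mem_mkS, lt_succ_iff, le_iff_lt_or_eq]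
  split_ifs with h
  · rw [mem_shift_one]
    constructor
    · rintro ⟨h1 | h1, h2⟩
      · exact Or.inl ⟨h1, h2⟩
      · exact Or.inr h1
    · rintro (h1 | rfl)
      · exact ⟨Or.inl h1.1, h1.2⟩
      · exact ⟨Or.inr rfl, h⟩
  · constructor
    · rintro ⟨h1 | rfl, h2⟩
      · exact Or.inl ⟨h1, h2⟩
      · exact absurd h2 h
    · rintro (h1 | h1)
      · exact ⟨Or.inl h1.1, h1.2⟩
      · exact absurd h1 (not_mem_zero j)

theorem mkS_mem_eq {X : M.S} {i : M.N} (h : ∀ j ∈ X, j < i) : mkS (· ∈ X) i = X :=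
  string_ext fun j => by rw [mem_mkS]; exact ⟨fun h => h.2, fun hj => ⟨h j hj, hj⟩⟩

theorem mkS_zero (P : M.N → Prop) [Def P] : mkS P 0 = 0 := string_ext fun j => by
  rw [mem_mkS]
  exact ⟨fun h => absurd h.1 (not_lt.2 zero_le), fun h => absurd h (not_mem_zero j)⟩

instance SF.mkS (P : M.N → M.N → Prop) [Def fun w => P (fst w) (snd w)] (f : M.N → M.N) [NF f] :
    SF (fun z => mkS (P z) (f z)) := by
  refine SF.of_def _ ?_ fun b => ?_
  · simp only [mem_mkS]; infer_instance
  · obtain ⟨c, hc⟩ := NF.bound f b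
    refine ⟨c, fun z hz j hj => ?_⟩
    rw [mem_mkS] at hj
    exact hj.1.trans (hc z hz)

instance (P : M.N → Prop) [Def P] : SF (VSharpL.mkS P) := SF.mkS (fun _ j => P j) fun z => z

namespace Str

theorem one_mul' (X : M.S) : 1 * X = X := by
  obtain ⟨U, hU, hU0, hUs, hUe⟩ := mul_table 1 X
  rw [← hUe (0 + 1) fun j hj => by rw [mem_one.1 hj, zero_add]; exact zero_lt_one, hUs, hU0,
    if_pos (mem_one.2 rfl), shift_zero_left, zero_add]

/-- The partial products of X and 1 are the truncations of X. -/
theorem mul_one' (X : M.S) : X * 1 = X := by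
  obtain ⟨U, hU, hU0, hUs, hUe⟩ := mul_table X 1
  have key := Def.induction (P := fun i => U i = mkS (· ∈ X) i) (by rw [hU0, mkS_zero])
    (fun i ih => by rw [hUs, ih, mkS_succ])
  obtain ⟨l, h, -⟩ := exists_bound₃ X X X
  rw [← hUe l h, key, mkS_mem_eq h]

theorem shift_one_mul (i : M.N) (X : M.S) : shift i 1 * X = shift i X := by
  obtain ⟨U, hU, hU0, hUs, hUe⟩ := mul_table (shift i 1) X
  have h0 := Def.induction (P := fun j => j ≤ i → U j = 0) (fun _ => hU0) (fun j ih hj => by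
    have hj' := succ_le_iff.1 hj
    rw [hUs, ih hj'.le, if_neg (fun h => hj'.ne (mem_shift_one.1 h)), add_zero])
  rw [← hUe (i + 1) fun j hj => by rw [mem_shift_one.1 hj]; exact lt_succ_iff.2 le_rfl, hUs, h0 i le_rfl,
    if_pos (mem_shift_one.2 rfl), zero_add]

theorem mul_shift (X Y : M.S) (i : M.N) : X * shift i Y = shift i (X * Y) := by
  obtain ⟨U, hU, hU0, hUs, hUe⟩ := mul_table X (shift i Y)
  obtain ⟨V, hV, hV0, hVs, hVe⟩ := mul_table X Y
  have key := Def.induction (P := fun j => U j = shift i (V j)) (by rw [hU0, hV0, shift_zero])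
    (fun j ih => by
      rw [hUs, hVs, ih, shift_add]
      split_ifs
      · rw [shift_shift, shift_shift, add_comm i j]
      · rw [shift_zero])
  obtain ⟨l, h, -⟩ := exists_bound₃ X X X
  rw [← hUe l h, ← hVe l h, key]

theorem mul_shift_one (X : M.S) (i : M.N) : X * shift i 1 = shift i X := by
  rw [mul_shift, mul_one']

end Str

/-! ### The ring of integers of a model -/

variable (M) in
/-- Pairs of strings, up to equality of their differences. -/
def intSetoid : Setoid (M.S × M.S) where
  r x y := x.1 + y.2 = y.1 + x.2
  iseqv := ⟨fun _ => rfl, fun h => h.symm, fun {x y z} h h' => by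
    have : x.1 + z.2 + (y.1 + y.2) = z.1 + x.2 + (y.1 + y.2) := by
      calc x.1 + z.2 + (y.1 + y.2) = (x.1 + y.2) + (y.1 + z.2) := by abel
        _ = (y.1 + x.2) + (z.1 + y.2) := by rw [h, h']
        _ = _ := by abel
    exact add_right_cancel this⟩

variable (M) in
/-- The integers of the model `M`. -/
def ZInt : Type v := Quotient (intSetoid M)

/-- The difference of a pair of strings. -/
def val (c : M.S × M.S) : ZInt M := Quotient.mk (intSetoid M) c

theorem val_eq {x y : M.S × M.S} : val x = val y ↔ x.1 + y.2 = y.1 + x.2 := Quotient.eq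

theorem exists_val (r : ZInt M) : ∃ c, val c = r := Quotient.exists_rep r

noncomputable instance : Zero (ZInt M) := ⟨val (0, 0)⟩
noncomputable instance : One (ZInt M) := ⟨val (1, 0)⟩

noncomputable instance : Neg (ZInt M) :=
  ⟨Quotient.map (fun c => (c.2, c.1)) fun x y (h : x.1 + y.2 = y.1 + x.2) => by
    change x.2 + y.1 = y.2 + x.1
    rw [add_comm, ← h, add_comm]⟩

noncomputable instance : Add (ZInt M) :=
  ⟨Quotient.map₂ (fun c d => (c.1 + d.1, c.2 + d.2)) fun x y (h : x.1 + y.2 = y.1 + x.2) x' y'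
    (h' : x'.1 + y'.2 = y'.1 + x'.2) => by
    change x.1 + x'.1 + (y.2 + y'.2) = y.1 + y'.1 + (x.2 + x'.2)
    calc _ = (x.1 + y.2) + (x'.1 + y'.2) := by abel
      _ = _ := by rw [h, h']; abel⟩

noncomputable instance : Mul (ZInt M) :=
  ⟨Quotient.map₂ (fun c d => (c.1 * d.1 + c.2 * d.2, c.1 * d.2 + c.2 * d.1))
    fun x y (h : x.1 + y.2 = y.1 + x.2) x' y' (h' : x'.1 + y'.2 = y'.1 + x'.2) => by
    -- Only the two distributive laws are known for strings, so representatives are changed in one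
    -- factor at a time.
    have h1 : val (x.1 * x'.1 + x.2 * x'.2, x.1 * x'.2 + x.2 * x'.1) =
        val (y.1 * x'.1 + y.2 * x'.2, y.1 * x'.2 + y.2 * x'.1) := by
      rw [val_eq]
      dsimp only
      calc _ = (x.1 + y.2) * x'.1 + (y.1 + x.2) * x'.2 := by rw [Str.add_mul', Str.add_mul']; abel
        _ = (y.1 + x.2) * x'.1 + (x.1 + y.2) * x'.2 := by rw [h]
        _ = _ := by rw [Str.add_mul', Str.add_mul']; abel
    have h2 : val (y.1 * x'.1 + y.2 * x'.2, y.1 * x'.2 + y.2 * x'.1) =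
        val (y.1 * y'.1 + y.2 * y'.2, y.1 * y'.2 + y.2 * y'.1) := by
      rw [val_eq]
      dsimp only
      calc _ = y.1 * (x'.1 + y'.2) + y.2 * (y'.1 + x'.2) := by rw [Str.mul_add', Str.mul_add']; abel
        _ = y.1 * (y'.1 + x'.2) + y.2 * (x'.1 + y'.2) := by rw [h']
        _ = _ := by rw [Str.mul_add', Str.mul_add']; abel
    exact val_eq.1 (h1.trans h2)⟩

theorem val_zero : val ((0, 0) : M.S × M.S) = 0 := rfl
theorem val_one : val ((1, 0) : M.S × M.S) = 1 := rfl
theorem val_neg (c : M.S × M.S) : -val c = val (c.2, c.1) := rfl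
theorem val_add (c d : M.S × M.S) : val c + val d = val (c.1 + d.1, c.2 + d.2) := rfl
theorem val_mul (c d : M.S × M.S) :
    val c * val d = val (c.1 * d.1 + c.2 * d.2, c.1 * d.2 + c.2 * d.1) := rfl

noncomputable instance : AddCommGroup (ZInt M) where
  add_assoc x y z := by
    obtain ⟨x, rfl⟩ := exists_val x
    obtain ⟨y, rfl⟩ := exists_val y
    obtain ⟨z, rfl⟩ := exists_val z
    simp only [val_add, add_assoc]
  zero_add x := by
    obtain ⟨x, rfl⟩ := exists_val x
    simp only [← val_zero, val_add, zero_add]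
  add_zero x := by
    obtain ⟨x, rfl⟩ := exists_val x
    simp only [← val_zero, val_add, add_zero]
  add_comm x y := by
    obtain ⟨x, rfl⟩ := exists_val x
    obtain ⟨y, rfl⟩ := exists_val y
    simp only [val_add]
    rw [add_comm x.1, add_comm x.2]
  neg_add_cancel x := by
    obtain ⟨x, rfl⟩ := exists_val x
    rw [val_neg, val_add, ← val_zero, val_eq]
    simp [add_comm]
  nsmul := nsmulRec
  zsmul := zsmulRec

/-- Commutativity and associativity have to wait: their proof by induction on bits needs products of
internal functions to be internal, which is derived from matrix powering later. -/
noncomputable instance : NonAssocRing (ZInt M) where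
  left_distrib x y z := by
    obtain ⟨x, rfl⟩ := exists_val x
    obtain ⟨y, rfl⟩ := exists_val y
    obtain ⟨z, rfl⟩ := exists_val z
    simp only [val_add, val_mul, Str.mul_add']
    congr 2 <;> abel
  right_distrib x y z := by
    obtain ⟨x, rfl⟩ := exists_val x
    obtain ⟨y, rfl⟩ := exists_val y
    obtain ⟨z, rfl⟩ := exists_val z
    simp only [val_add, val_mul, Str.add_mul']
    congr 2 <;> abel
  zero_mul x := by
    obtain ⟨x, rfl⟩ := exists_val x
    simp only [← val_zero, val_mul, Str.zero_mul', add_zero]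
  mul_zero x := by
    obtain ⟨x, rfl⟩ := exists_val x
    simp only [← val_zero, val_mul, Str.mul_zero', add_zero]
  one_mul x := by
    obtain ⟨x, rfl⟩ := exists_val x
    simp only [← val_one, val_mul, Str.zero_mul', Str.one_mul', add_zero]
  mul_one x := by
    obtain ⟨x, rfl⟩ := exists_val x
    simp only [← val_one, val_mul, Str.mul_zero', Str.mul_one', add_zero, zero_add]

theorem val_eq_sub (c : M.S × M.S) : val c = val (c.1, 0) - val (c.2, 0) := by
  rw [sub_eq_add_neg, val_neg, val_add]
  simp

/-- A function with integer values given on every initial segment by two strings. -/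
class Inl (f : M.N → ZInt M) : Prop where
  out : ∀ b, ∃ X Y : M.S, ∀ z < b, f z = val (row X z, row Y z)

theorem Inl.of_sf {f : M.N → ZInt M} (h : ∀ b, ∃ F G, SF F ∧ SF G ∧ ∀ z < b, f z = val (F z, G z)) :
    Inl f := ⟨fun b => by
  obtain ⟨F, G, hF, hG, hf⟩ := h b
  obtain ⟨X, hX⟩ := SF.exists_row F b
  obtain ⟨Y, hY⟩ := SF.exists_row G b
  exact ⟨X, Y, fun z hz => by rw [hX z hz, hY z hz, hf z hz]⟩⟩

theorem Inl.congr {f g : M.N → ZInt M} (hf : Inl f) (h : ∀ z, f z = g z) : Inl g := by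
  obtain rfl : f = g := funext h
  exact hf

theorem Inl.of_local {f : M.N → ZInt M} (h : ∀ b, ∃ g, Inl g ∧ ∀ z < b, f z = g z) : Inl f :=
  ⟨fun b => by
  obtain ⟨g, hg, hfg⟩ := h b
  obtain ⟨X, Y, hX⟩ := hg.out b
  exact ⟨X, Y, fun z hz => by rw [hfg z hz, hX z hz]⟩⟩

instance Inl.val_sf (F G : M.N → M.S) [SF F] [SF G] : Inl (fun z => val (F z, G z)) :=
  Inl.of_sf fun _ => ⟨F, G, inferInstance, inferInstance, fun _ _ => rfl⟩

instance Inl.const (r : ZInt M) : Inl (fun _ => r) := by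
  obtain ⟨c, rfl⟩ := exists_val r
  exact Inl.val_sf (fun _ => c.1) fun _ => c.2

instance Inl.neg (f : M.N → ZInt M) [hf : Inl f] : Inl (fun z => - f z) := Inl.of_sf fun b => by
  obtain ⟨X, Y, h⟩ := hf.out b
  exact ⟨fun z => row Y z, fun z => row X z, inferInstance, inferInstance,
    fun z hz => by rw [h z hz, val_neg]⟩

instance Inl.add (f g : M.N → ZInt M) [hf : Inl f] [hg : Inl g] : Inl (fun z => f z + g z) :=
  Inl.of_sf fun b => by
  obtain ⟨X, Y, h⟩ := hf.out b
  obtain ⟨X', Y', h'⟩ := hg.out b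
  exact ⟨fun z => row X z + row X' z, fun z => row Y z + row Y' z, inferInstance, inferInstance,
    fun z hz => by rw [h z hz, h' z hz, val_add]⟩

instance Inl.ite (P : M.N → Prop) (f g : M.N → ZInt M) [∀ z, Decidable (P z)] [Def P]
    [hf : Inl f] [hg : Inl g] : Inl (fun z => if P z then f z else g z) := Inl.of_sf fun b => by
  obtain ⟨X, Y, h⟩ := hf.out b
  obtain ⟨X', Y', h'⟩ := hg.out b
  refine ⟨fun z => if P z then row X z else row X' z, fun z => if P z then row Y z else row Y' z,
    inferInstance, inferInstance, fun z hz => ?_⟩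
  by_cases e : P z
  · simp only [if_pos e, h z hz]
  · simp only [if_neg e, h' z hz]

instance (priority := 100) Inl.comp (f : M.N → ZInt M) (h : M.N → M.N) [hf : Inl f] [NF h] :
    Inl (fun z => f (h z)) := Inl.of_sf fun b => by
  obtain ⟨c, hc⟩ := NF.bound h b
  obtain ⟨X, Y, hX⟩ := hf.out c
  exact ⟨fun z => row X (h z), fun z => row Y (h z), inferInstance, inferInstance,
    fun z hz => hX _ (hc z hz)⟩

instance (priority := 100) Inl.comp₂ (F : M.N → M.N → ZInt M) [Inl fun w => F (fst w) (snd w)]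
    (f g : M.N → M.N) [NF f] [NF g] : Inl (fun z => F (f z) (g z)) :=
  (Inl.comp (fun w => F (fst w) (snd w)) fun z => pr (f z) (g z)).congr fun z => by simp

instance (priority := 100) Inl.curry (F : M.N → M.N → ZInt M)
    [Inl fun w => F (fst w) (snd w)] (c : M.N) : Inl (F c) :=
  Inl.comp₂ F (fun _ => c) fun z => z

instance (priority := 90) Inl.comp₃ (F : M.N → M.N → M.N → ZInt M)
    [Inl fun w => F (fst w) (fst (snd w)) (snd (snd w))]
    (f g h : M.N → M.N) [NF f] [NF g] [NF h] : Inl (fun z => F (f z) (g z) (h z)) :=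
  (Inl.comp (fun w => F (fst w) (fst (snd w)) (snd (snd w)))
    fun z => pr (f z) (pr (g z) (h z))).congr fun z => by simp

/-- Equality of differences is equality of cross sums of strings. This instance admits induction for
every identity between internal integer functions. -/
instance Def.eq_inl (f g : M.N → ZInt M) [hf : Inl f] [hg : Inl g] : Def (fun z => f z = g z) :=
  Def.of_local fun b => by
  obtain ⟨X, Y, h⟩ := hf.out b
  obtain ⟨X', Y', h'⟩ := hg.out b
  exact ⟨fun z => row X z + row Y' z = row X' z + row Y z, inferInstance, fun z hz => by
    rw [h z hz, h' z hz, val_eq]⟩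

end Product

section IntExpressions

/-! ### Evaluation of integer-valued expressions -/

variable {M : TwoSorted.{u, v}} [IsModel M] {w : World M}

/-- The possible values of the expression `e` are those with the property `Q`. -/
def ZRel (w : World M) (e : ZExp) (Q : ZInt M → Prop) : Prop :=
  ∀ w' ≥ w, ∀ z c, PairD w' z c → FmD w' (e z) (Q (val c))

/-- The expression `e` has the value `r`, and no other. -/
def ZD (w : World M) (e : ZExp) (r : ZInt M) : Prop := ZRel w e (· = r)

theorem ZRel.mono {w w' : World M} (h : w ≤ w') {e : ZExp} {Q : ZInt M → Prop} (he : ZRel w e Q) :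
    ZRel w' e Q := fun w'' h' => he w'' (h.trans h')

theorem ZD.mono {w w' : World M} (h : w ≤ w') {e : ZExp} {r : ZInt M} (he : ZD w e r) :
    ZD w' e r := ZRel.mono h he

theorem ZRel.congr {e : ZExp} {Q Q' : ZInt M → Prop} (he : ZRel w e Q) (h : ∀ r, Q r ↔ Q' r) :
    ZRel w e Q' := fun w' hw z c hz => (he w' hw z c hz).congr (h _)

theorem FmD.eqZ_rel {e f : ZExp} {Q Q' : ZInt M → Prop} (he : ZRel w e Q) (hf : ZRel w f Q') :
    FmD w (e ≐ f) (∃ r, Q r ∧ Q' r) :=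
  (FmD.exPair fun w' hw z c hz => (he w' hw z c hz).conj fun _ => hf w' hw z c hz).congr
    ⟨fun ⟨c, h⟩ => ⟨val c, h⟩, fun ⟨r, h⟩ => by
      obtain ⟨c, rfl⟩ := exists_val r
      exact ⟨c, h⟩⟩

theorem FmD.eqZ {e f : ZExp} {r s : ZInt M} (he : ZD w e r) (hf : ZD w f s) :
    FmD w (e ≐ f) (r = s) :=
  (FmD.eqZ_rel he hf).congr ⟨fun ⟨_, h, h'⟩ => h.symm.trans h', fun h => ⟨r, rfl, h⟩⟩

theorem FmD.eqInt {x y : PairVar} {c d : M.S × M.S} (hx : PairD w x c) (hy : PairD w y d) :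
    FmD w (eqInt x y) (val c = val d) :=
  (FmD.exStr fun w' hw U E hU =>
    (FmD.isSum (hx.1.mono hw) (hy.2.mono hw) hU).conj fun _ =>
      FmD.isSum (hy.1.mono hw) (hx.2.mono hw) hU).congr (by rw [val_eq]; simp)

theorem ZD.intVar {x : PairVar} {c : M.S × M.S} (hx : PairD w x c) : ZD w (intVar x) (val c) :=
  fun w' hw z d hz => (FmD.eqInt (hx.mono hw) hz).congr eq_comm

theorem ZD.zero : ZD w 0 0 := fun w' hw z d hz => (FmD.eqStr hz.1 hz.2).congr (by
  dsimp only; rw [← val_zero, val_eq]; simp)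

theorem ZD.one : ZD w 1 1 := fun w' hw z d hz =>
  (FmD.exStr fun w'' hw' U E hU => (FmD.allNum (P := fun i => i ∈ E ↔ i = 0) fun w3 hw3 i n hi =>
    (FmD.memStr hi (hU.mono hw3)).equi (FmD.eqNum hi NumD.zero)).conj fun _ =>
      FmD.isSum (hz.2.mono hw') hU (hz.1.mono hw')).congr (by
    dsimp only
    rw [← val_one, val_eq]
    constructor
    · rintro ⟨E, h1, h2⟩
      obtain rfl : E = 1 := string_ext fun i => by rw [h1, mem_one]
      rw [h2, add_zero, add_comm]
    · intro h
      exact ⟨1, fun i => mem_one, by rw [add_zero] at h; rw [h, add_comm]⟩)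

theorem ZD.neg {e : ZExp} {r : ZInt M} (he : ZD w e r) : ZD w (-e) (-r) := fun w' hw z c hz =>
  (he w' hw ⟨z.neg, z.pos⟩ (c.2, c.1) ⟨hz.2, hz.1⟩).congr (by
    dsimp only
    rw [← val_neg (c := c), neg_eq_iff_eq_neg])

theorem ZD.add {e f : ZExp} {r s : ZInt M} (he : ZD w e r) (hf : ZD w f s) : ZD w (e + f) (r + s) :=
  fun w1 h1 z c hz =>
  (FmD.exPair fun w2 h2 x d hx => FmD.exPair fun w3 h3 y d' hy =>
    (he w3 ((h1.trans h2).trans h3) x d (hx.mono h3)).conj fun _ =>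
    (hf w3 ((h1.trans h2).trans h3) y d' hy).conj fun _ =>
    FmD.exPair fun w4 h4 u g hu =>
      (FmD.isSum ((hx.mono h3).mono h4).1 (hy.mono h4).1 hu.1).conj fun _ =>
      (FmD.isSum ((hx.mono h3).mono h4).2 (hy.mono h4).2 hu.2).conj fun _ =>
      FmD.eqInt hu (((hz.mono h2).mono h3).mono h4)).congr (by
    constructor
    · rintro ⟨d, d', rfl, rfl, g, h1, h2, h3⟩
      rw [val_add, ← h1, ← h2, ← h3]
    · intro h
      obtain ⟨d, hd⟩ := exists_val r
      obtain ⟨d', hd'⟩ := exists_val s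
      exact ⟨d, d', hd, hd', (d.1 + d'.1, d.2 + d'.2), rfl, rfl, by rw [h, ← hd, ← hd', val_add]⟩)

/-- Two tables of partial products agree by induction, so the chosen product is the only one. -/
theorem isProd_iff {X Y Z : M.S} : IsProd X Y Z ↔ Z = X * Y := by
  constructor
  · rintro ⟨W, h0, hs, rfl⟩
    obtain ⟨W', h0', hs', hZ'⟩ := (exists_isProd X Y).choose_spec
    change _ = (exists_isProd X Y).choose
    rw [hZ']
    have key := Def.induction (P := fun i => i ≤ M.len X → row W i = row W' i)
      (fun _ => by rw [h0, h0']) (fun i ih hi => by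
        have := succ_le_iff.1 hi
        rw [hs i this, hs' i this, ih this.le])
    exact key _ le_rfl
  · rintro rfl
    exact (exists_isProd X Y).choose_spec

theorem FmD.isProd' {X Y Z : ℕ} {A B C : M.S} (hX : StrD w X A) (hY : StrD w Y B)
    (hZ : StrD w Z C) : FmD w (VSharpL.isProd X Y Z) (C = A * B) := (FmD.isProd hX hY hZ).congr isProd_iff

theorem ZD.mul {e f : ZExp} {r s : ZInt M} (he : ZD w e r) (hf : ZD w f s) : ZD w (e * f) (r * s) :=
  fun w1 h1 z c hz =>
  (FmD.exPair fun w2 h2 x d hx => FmD.exPair fun w3 h3 y d' hy =>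
    (he w3 ((h1.trans h2).trans h3) x d (hx.mono h3)).conj fun _ =>
    (hf w3 ((h1.trans h2).trans h3) y d' hy).conj fun _ =>
    FmD.exPair fun w4 h4 p k hp => FmD.exPair fun w5 h5 q l hq => FmD.exPair fun w6 h6 u g hu =>
      (FmD.isProd' (((hx.mono h3).mono h4).mono (h5.trans h6)).1 ((hy.mono h4).mono (h5.trans h6)).1
        (hp.mono (h5.trans h6)).1).conj fun _ =>
      (FmD.isProd' (((hx.mono h3).mono h4).mono (h5.trans h6)).2 ((hy.mono h4).mono (h5.trans h6)).2
        (hp.mono (h5.trans h6)).2).conj fun _ =>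
      (FmD.isProd' (((hx.mono h3).mono h4).mono (h5.trans h6)).1 ((hy.mono h4).mono (h5.trans h6)).2
        (hq.mono h6).1).conj fun _ =>
      (FmD.isProd' (((hx.mono h3).mono h4).mono (h5.trans h6)).2 ((hy.mono h4).mono (h5.trans h6)).1
        (hq.mono h6).2).conj fun _ =>
      (FmD.isSum (hp.mono (h5.trans h6)).1 (hp.mono (h5.trans h6)).2 hu.1).conj fun _ =>
      (FmD.isSum (hq.mono h6).1 (hq.mono h6).2 hu.2).conj fun _ =>
      FmD.eqInt hu ((((hz.mono h2).mono h3).mono h4).mono (h5.trans h6))).congr (by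
    constructor
    · rintro ⟨d, d', rfl, rfl, k, l, g, h1, h2, h3, h4, h5, h6, h7⟩
      rw [val_mul, ← h1, ← h2, ← h3, ← h4, ← h5, ← h6, ← h7]
    · intro h
      obtain ⟨d, hd⟩ := exists_val r
      obtain ⟨d', hd'⟩ := exists_val s
      exact ⟨d, d', hd, hd', (d.1 * d'.1, d.2 * d'.2), (d.1 * d'.2, d.2 * d'.1),
        (d.1 * d'.1 + d.2 * d'.2, d.1 * d'.2 + d.2 * d'.1), rfl, rfl, rfl, rfl, rfl, rfl, by
        rw [h, ← hd, ← hd', val_mul]⟩)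

theorem ZRel.when {e : ZExp} {φ : Fm} {P : Prop} {Q : ZInt M → Prop} (hφ : FmD w φ P)
    (he : P → ZRel w e Q) : ZRel w (e.when φ) fun r => P ∧ Q r :=
  fun w' hw z c hz => (hφ.mono hw).conj fun hP => he hP w' hw z c hz

theorem ZRel.orElse {e f : ZExp} {Q Q' : ZInt M → Prop} (he : ZRel w e Q) (hf : ZRel w f Q') :
    ZRel w (e ∥ f) fun r => Q r ∨ Q' r :=
  fun w' hw z c hz => (he w' hw z c hz).disj (hf w' hw z c hz)

/-- The entry `k` of a sequence of integers given by a pair of strings. -/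
noncomputable def ent (c : M.S × M.S) (k : M.N) : ZInt M := val (row c.1 k, row c.2 k)

instance (c : M.S × M.S) : Inl (ent c) := Inl.val_sf (row c.1) (row c.2)

theorem exists_ent (f : M.N → ZInt M) [hf : Inl f] (b : M.N) : ∃ c, ∀ z < b, ent c z = f z := by
  obtain ⟨X, Y, h⟩ := hf.out b
  exact ⟨(X, Y), fun z hz => (h z hz).symm⟩

theorem ZD.entry {A : PairVar} {c : M.S × M.S} {t : NTerm} {n : M.N} (hA : PairD w A c)
    (ht : NumD w t n) : ZD w (entry A t) (ent c n) := fun w1 h1 z d hz =>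
  (FmD.exPair fun w2 h2 x g hx =>
    (FmD.isRow ((hA.mono h1).mono h2).1 ((ht.mono h1).mono h2) hx.1).conj fun _ =>
    (FmD.isRow ((hA.mono h1).mono h2).2 ((ht.mono h1).mono h2) hx.2).conj fun _ =>
    FmD.eqInt hx (hz.mono h2)).congr (by
    constructor
    · rintro ⟨g, h1, h2, h3⟩
      rw [← h3, ent, ← h1, ← h2]
    · intro h
      exact ⟨(row c.1 n, row c.2 n), rfl, rfl, h.symm⟩)

/-- `r` is the sum of the values `f k` for `k < n`. -/
def IsSum (n : M.N) (f : M.N → ZInt M) (r : ZInt M) : Prop :=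
  ∃ T : M.N → ZInt M, Inl T ∧ T 0 = 0 ∧ (∀ k < n, T (k + 1) = T k + f k) ∧ T n = r

theorem isSum_iff {n : M.N} {f : M.N → ZInt M} {r : ZInt M} : IsSum n f r ↔
    ∃ c, ent c 0 = 0 ∧ (∀ k < n, ent c (k + 1) = ent c k + f k) ∧ ent c n = r := by
  constructor
  · rintro ⟨T, hT, h1, h2, h3⟩
    obtain ⟨c, hc⟩ := exists_ent T (n + 1)
    refine ⟨c, ?_, fun k hk => ?_, ?_⟩
    · rw [hc _ (lt_succ_iff.2 zero_le), h1]
    · rw [hc _ (lt_succ_iff.2 hk.le), hc _ (lt_succ_iff.2 (succ_le_iff.2 hk)), h2 k hk]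
    · rw [hc _ (lt_succ_iff.2 le_rfl), h3]
  · rintro ⟨c, h⟩
    exact ⟨ent c, inferInstance, h⟩

theorem ZRel.sumLt {m : NTerm} {n : M.N} {e : NTerm → ZExp} {f : M.N → ZInt M} (hm : NumD w m n)
    (he : ∀ w' ≥ w, ∀ x k, NumD w' x k → k < n → ZD w' (e x) (f k)) :
    ZRel w (sumLt m e) (IsSum n f) := fun w1 h1 z d hz =>
  (FmD.exPair fun _ h2 _ _ hT => (FmD.eqZ (ZD.entry hT NumD.zero) ZD.zero).conj fun _ =>
    (FmD.allLt ((hm.mono h1).mono h2) fun w3 h3 _ _ hk hkn =>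
      FmD.eqZ (ZD.entry (hT.mono h3) (hk.add NumD.one))
        ((ZD.entry (hT.mono h3) hk).add (he w3 ((h1.trans h2).trans h3) _ _ hk hkn))).conj fun _ =>
      ZD.entry hT ((hm.mono h1).mono h2) _ le_rfl z _ (hz.mono h2)).congr (by
    rw [isSum_iff]
    simp only [eq_comm (a := val d)])

/-- The values of the entries of an `n × n` matrix. -/
def MatD (w : World M) (n : M.N) (A : Mat) (F : M.N → M.N → ZInt M) : Prop :=
  ∀ w' ≥ w, ∀ x y i j, NumD w' x i → NumD w' y j → i < n → j < n → ZD w' (A x y) (F i j)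

theorem MatD.mono {w w' : World M} (h : w ≤ w') {n : M.N} {A : Mat} {F : M.N → M.N → ZInt M}
    (hA : MatD w n A F) : MatD w' n A F := fun w'' h' => hA w'' (h.trans h')

theorem MatD.matVar {A : PairVar} {c : M.S × M.S} (hA : PairD w A c) (n : M.N) :
    MatD w n (matVar A) fun i j => ent c (pr i j) := fun _ hw _ _ _ _ hi hj _ _ =>
  ZD.entry (hA.mono hw) (hi.pair hj)

theorem MatD.seqMat {A : PairVar} {c : M.S × M.S} {t : NTerm} {k : M.N} (hA : PairD w A c)
    (ht : NumD w t k) (n : M.N) :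
    MatD w n (seqMat A t) fun i j => ent c (pr k (pr i j)) := fun _ hw _ _ _ _ hi hj _ _ =>
  ZD.entry (hA.mono hw) ((ht.mono hw).pair (hi.pair hj))

open scoped Classical in
theorem MatD.idMat (n : M.N) : MatD w n idMat fun i j => if i = j then 1 else 0 :=
  fun _ _ _ _ i j hi hj _ _ =>
  ((ZRel.when (FmD.eqNum hi hj) fun _ => ZD.one).orElse
    (ZRel.when (FmD.eqNum hi hj).neg fun _ => ZD.zero)).congr fun r => by
      by_cases h : i = j <;> simp [h]

theorem FmD.eqMat {m : NTerm} {n : M.N} {A B : Mat} {F G : M.N → M.N → ZInt M} (hm : NumD w m n)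
    (hA : MatD w n A F) (hB : MatD w n B G) :
    FmD w (eqMat m A B) (∀ i < n, ∀ j < n, F i j = G i j) :=
  FmD.allLt hm fun w1 h1 _ _ hx hi => FmD.allLt (hm.mono h1) fun w2 h2 _ _ hy hj =>
    FmD.eqZ (hA w2 (h1.trans h2) _ _ _ _ (hx.mono h2) hy hi hj)
      (hB w2 (h1.trans h2) _ _ _ _ (hx.mono h2) hy hi hj)

open scoped Classical in
/-- `q` lists the powers of the `m × m` matrix `F` with exponents up to `n`. -/
def IsPowSeq (m n : M.N) (F : M.N → M.N → ZInt M) (q : M.N → M.N → M.N → ZInt M) : Prop :=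
  (∀ i < m, ∀ j < m, q 0 i j = if i = j then 1 else 0) ∧
  ∀ t < n, ∀ i < m, ∀ j < m, IsSum m (fun k => q t i k * F k j) (q (t + 1) i j)

theorem FmD.isPow {m n : NTerm} {k l : M.N} {A B : Mat} {F G : M.N → M.N → ZInt M}
    (hm : NumD w m k) (hn : NumD w n l) (hA : MatD w k A F) (hB : MatD w k B G) :
    FmD w (isPow m A n B) (∃ c : M.S × M.S, IsPowSeq k l F (fun t i j => ent c (pr t (pr i j))) ∧
      ∀ i < k, ∀ j < k, G i j = ent c (pr l (pr i j))) := by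
  refine (FmD.exPair fun w1 h1 Q c hQ => (FmD.eqMat (hm.mono h1) (MatD.seqMat hQ NumD.zero k)
    (MatD.idMat k)).conj fun _ => (FmD.allLt (P := fun t => ∀ i < k, ∀ j < k,
      IsSum k (fun x => ent c (pr t (pr i x)) * F x j) (ent c (pr (t + 1) (pr i j))))
      (hn.mono h1) fun w2 h2 t x ht _ => ?_).conj fun _ =>
    FmD.eqMat (hm.mono h1) (hB.mono h1) (MatD.seqMat hQ (hn.mono h1) k)).congr ?_
  · refine FmD.allLt ((hm.mono h1).mono h2) fun w3 h3 i i' hi hi' =>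
      FmD.allLt (((hm.mono h1).mono h2).mono h3) fun w4 h4 j j' hj hj' => ?_
    have hQ' := ((hQ.mono h2).mono h3).mono h4
    have ht' := (ht.mono h3).mono h4
    refine (FmD.eqZ_rel (MatD.seqMat hQ' (ht'.add NumD.one) k _ le_rfl _ _ _ _ (hi.mono h4) hj hi' hj')
      (ZRel.sumLt (((hm.mono h1).mono (h2.trans h3)).mono h4) fun w5 h5 y y' hy hy' =>
        (MatD.seqMat hQ' ht' k _ h5 _ _ _ _ ((hi.mono h4).mono h5) hy hi' hy').mul
        (hA _ (((h1.trans h2).trans (h3.trans h4)).trans h5) _ _ _ _ hy (hj.mono h5) hy' hj'))).congr ?_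
    simp
  · simp only [IsPowSeq, and_assoc]

/-- Every power of an internal matrix exists. -/
theorem exists_isPowSeq (m n : M.N) (F : M.N → M.N → ZInt M) [Inl fun w => F (fst w) (snd w)] :
    ∃ q : M.N → ZInt M, Inl q ∧ IsPowSeq m n F fun t i j => q (pr t (pr i j)) := by
  have ax : ∀ (m n : M.N) (a : M.S × M.S), ∃ (b : M.S × M.S) (c : M.S × M.S),
      IsPowSeq m n (fun i j => ent a (pr i j)) (fun t i j => ent c (pr t (pr i j))) ∧
      ∀ i < m, ∀ j < m, ent b (pr i j) = ent c (pr n (pr i j)) := by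
    refine FmD.of_satisfies (M := M) (φ := VSharpL.allNum fun m => VSharpL.allNum fun n =>
      VSharpL.allPair fun A => VSharpL.exPair fun B =>
        VSharpL.isPow m (VSharpL.matVar A) n (VSharpL.matVar B))
      (fun w => FmD.allNum fun _ _ _ m hm => FmD.allNum fun _ h2 _ n hn => FmD.allPair fun _ h3 _ a hA =>
        FmD.exPair fun _ h4 _ b hB => ?_) (IsModel.sat _ (Or.inr (Or.inr rfl)))
    exact FmD.isPow (((hm.mono h2).mono h3).mono h4) ((hn.mono h3).mono h4)
      (MatD.matVar (hA.mono h4) m) (MatD.matVar hB m)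
  -- The axiom speaks of matrices coded by strings; only the entries below m matter, and these have
  -- a code.
  obtain ⟨a, ha⟩ := exists_ent (fun w => F (fst w) (snd w)) (pr m m)
  obtain ⟨b, c, ⟨h1, h2⟩, -⟩ := ax m n a
  refine ⟨ent c, inferInstance, h1, fun t ht i hi j hj => ?_⟩
  obtain ⟨T, hT, hT0, hTs, hTe⟩ := h2 t ht i hi j hj
  refine ⟨T, hT, hT0, fun k hk => ?_, hTe⟩
  rw [hTs k hk]
  dsimp only
  rw [ha _ (pr_lt_pr hk hj), fst_pr, snd_pr]

end IntExpressions

section Sums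

/-! ### Sums and products of internal functions -/

variable {M : TwoSorted.{u, v}} [IsModel M]

instance NF.pr_left (p : M.N) : NF (VSharpL.pr p) := NF.pr (fun _ => p) (fun z => z)

instance NF.add_left (p : M.N) : NF (HAdd.hAdd p) := NF.add (fun _ => p) (fun z => z)

theorem lt_add_one' (x : M.N) : x < x + 1 := lt_succ_iff.2 le_rfl

theorem IsSum.unique {n : M.N} {f : M.N → ZInt M} {r s : ZInt M} (h : IsSum n f r)
    (h' : IsSum n f s) : r = s := by
  obtain ⟨T, hT, h1, h2, rfl⟩ := h
  obtain ⟨T', hT', h1', h2', rfl⟩ := h'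
  refine Def.induction (P := fun k => k ≤ n → T k = T' k) (fun _ => by rw [h1, h1'])
    (fun k ih hk => ?_) n le_rfl
  have := succ_le_iff.1 hk
  rw [h2 k this, h2' k this, ih this.le]

theorem IsSum.congr {n : M.N} {f g : M.N → ZInt M} {r : ZInt M} (h : IsSum n f r)
    (hfg : ∀ k < n, f k = g k) : IsSum n g r := by
  obtain ⟨T, hT, h1, h2, h3⟩ := h
  exact ⟨T, hT, h1, fun k hk => by rw [h2 k hk, hfg k hk], h3⟩

/-- A sum whose summands vanish outside the range of an increasing function. -/
theorem IsSum.sparse {n l : M.N} {f : M.N → ZInt M} {r : ZInt M} (h : IsSum n f r) (g : M.N → M.N)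
    [NF g] (hg : ∀ k < l, g k < n) (hm : ∀ k k', k < k' → k' < l → g k < g k')
    (hf : ∀ x < n, (∀ k < l, x ≠ g k) → f x = 0) : IsSum l (fun k => f (g k)) r := by
  classical
  obtain ⟨T, hT, h1, h2, rfl⟩ := h
  have hc : ∀ a b, a ≤ b → b ≤ n → (∀ x, a ≤ x → x < b → ∀ k < l, x ≠ g k) → T b = T a := by
    intro a b hab hb hx
    refine Def.induction (P := fun c => a ≤ c → c ≤ b → T c = T a) (fun h _ => ?_)
      (fun c ih hac hcb => ?_) b hab le_rfl
    · rw [le_antisymm h zero_le]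
    · rcases hac.eq_or_lt with rfl | hac
      · rfl
      · have hcb' := succ_le_iff.1 hcb
        have hac' := lt_succ_iff.1 hac
        rw [h2 c (hcb'.trans_le hb), ih hac' hcb'.le,
          hf c (hcb'.trans_le hb) (hx c hac' hcb'), add_zero]
  -- The new partial sum at k < l is the old one just before the summand f (g k) is added; at k = l
  -- it is the total.
  refine ⟨fun k => if k < l then T (g k) else T n, inferInstance, ?_, fun k hk => ?_, by simp⟩
  · dsimp only
    split_ifs with h0
    · rw [hc 0 _ zero_le (hg 0 h0).le, h1]
      rintro x - hx k hk rfl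
      rcases (zero_le (a := k)).eq_or_lt with rfl | hk0
      · exact lt_irrefl _ hx
      · exact lt_asymm hx (hm 0 k hk0 hk)
    · rw [hc 0 n zero_le le_rfl, h1]
      intro x _ _ k hk
      exact absurd (zero_le.trans_lt hk) h0
  · dsimp only
    rw [if_pos hk, ← h2 _ (hg k hk)]
    split_ifs with hk'
    · refine hc _ _ (succ_le_iff.2 (hm _ _ (lt_add_one' k) hk')) (hg _ hk').le ?_
      rintro x hx hx' j hj rfl
      rcases lt_or_ge k j with h | h
      · rcases (succ_le_iff.2 h).eq_or_lt with rfl | h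
        · exact lt_irrefl _ hx'
        · exact lt_asymm hx' (hm _ _ h hj)
      · rcases h.eq_or_lt with rfl | h
        · exact lt_irrefl _ (succ_le_iff.1 hx)
        · exact lt_asymm (succ_le_iff.1 hx) (hm _ _ h hk)
    · refine hc _ _ (succ_le_iff.2 (hg k hk)) le_rfl ?_
      rintro x hx hx' j hj rfl
      have hjk : j ≤ k := lt_succ_iff.1 (hj.trans_le (not_lt.1 hk'))
      rcases hjk.eq_or_lt with rfl | h
      · exact lt_irrefl _ (succ_le_iff.1 hx)
      · exact lt_asymm (succ_le_iff.1 hx) (hm _ _ h hk)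

theorem IsSum.three {f : M.N → ZInt M} {r : ZInt M} (h : IsSum (1 + 1 + 1) f r) :
    r = f 0 + f 1 + f (1 + 1) := by
  obtain ⟨T, hT, h1, h2, rfl⟩ := h
  have h0 : (0 : M.N) < 1 := zero_lt_one
  have e1 : (1 : M.N) < 1 + 1 := lt_add_one' 1
  have e2 : (1 + 1 : M.N) < 1 + 1 + 1 := lt_add_one' _
  rw [h2 _ e2, h2 _ (e1.trans e2)]
  have := h2 0 (h0.trans (e1.trans e2))
  rw [zero_add, h1, zero_add] at this
  rw [this]

/-- The powers of all matrices of an internal family. -/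
theorem exists_powers (A : M.N → M.N → M.N → ZInt M)
    [Inl fun w => A (fst w) (fst (snd w)) (snd (snd w))] (m : M.N → M.N) [NF m] (b n : M.N) :
    ∃ q : M.N → ZInt M, Inl q ∧
      ∀ p < b, IsPowSeq (m p) n (A p) fun t i j => q (pr p (pr t (pr i j))) := by
  classical
  obtain ⟨c, hc⟩ := NF.bound m b
  -- The block diagonal matrix with blocks A p, its rows and columns being indexed by codes of pairs
  -- (p, i). In its powers, only the terms of block p contribute to the entries of block p.
  let F : M.N → M.N → ZInt M := fun x y =>
    if x = pr (fst x) (snd x) ∧ fst x = fst y ∧ snd x < m (fst x) then A (fst x) (snd x) (snd y) else 0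
  obtain ⟨Q, hQ, h0, hs⟩ := exists_isPowSeq (pr b c) n F
  dsimp only at h0 hs
  refine ⟨fun z => Q (pr (fst (snd z)) (pr (pr (fst z) (fst (snd (snd z))))
    (pr (fst z) (snd (snd (snd z)))))), inferInstance, fun p hp => ⟨fun i hi j hj => ?_,
    fun t ht i hi j hj => ?_⟩⟩
  · simp only [fst_pr, snd_pr]
    rw [h0 _ (pr_lt_pr hp (hi.trans (hc p hp))) _ (pr_lt_pr hp (hj.trans (hc p hp)))]
    simp [pr_inj]
  · simp only [fst_pr, snd_pr]
    have := hs t ht _ (pr_lt_pr hp (hi.trans (hc p hp))) _ (pr_lt_pr hp (hj.trans (hc p hp)))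
    refine ((this.sparse (l := m p) (fun k => pr p k) (fun k hk => pr_lt_pr hp (hk.trans (hc p hp)))
      (fun k k' hk _ => pr_lt_of_add_lt (add_lt_add_right hk p)) fun x _ hx => ?_).congr fun k hk => ?_)
    · have : F x (pr p j) = 0 := by
        refine if_neg ?_
        rintro ⟨h1, h2, h3⟩
        rw [fst_pr] at h2
        rw [h2] at h1 h3
        exact hx _ h3 h1
      simp only [this, mul_zero]
    · have : F (pr p k) (pr p j) = A p k j := by simp [F, hk]
      rw [this]

theorem three_pos : (0 : M.N) < 1 + 1 + 1 ∧ (1 : M.N) < 1 + 1 + 1 ∧ (1 + 1 : M.N) < 1 + 1 + 1 :=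
  have e1 : (1 : M.N) < 1 + 1 := lt_add_one' 1
  have e2 : (1 + 1 : M.N) < 1 + 1 + 1 := lt_add_one' _
  ⟨(zero_lt_one.trans e1).trans e2, e1.trans e2, e2⟩

/-- String multiplication yields one product at a time; matrix powering yields all products below a
bound at once. The 3 × 3 matrix with entries f p at (0, 1) and g p at (1, 2), and 0 elsewhere, has f
p · g p at (0, 2) in its square. -/
instance Inl.mul (f g : M.N → ZInt M) [Inl f] [Inl g] : Inl (fun z => f z * g z) := by
  classical
  refine Inl.of_local fun b => ?_
  let A : M.N → M.N → M.N → ZInt M := fun p i j =>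
    if i = 0 ∧ j = 1 then f p else if i = 1 ∧ j = 1 + 1 then g p else 0
  obtain ⟨q, hq, h⟩ := exists_powers A (fun _ => 1 + 1 + 1) b (1 + 1)
  refine ⟨fun z => q (pr z (pr (1 + 1) (pr 0 (1 + 1)))),
    Inl.comp q fun z => pr z (pr (1 + 1) (pr 0 (1 + 1))), fun p hp => ?_⟩
  obtain ⟨h0, hs⟩ := h p hp
  dsimp only at h0 hs ⊢
  obtain ⟨e0, e1, e2⟩ := three_pos (M := M)
  have n1 : (1 : M.N) ≠ 0 := one_ne_zero
  have n2 : (1 + 1 : M.N) ≠ 1 := (lt_add_one' 1).ne'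
  have n3 : (1 + 1 : M.N) ≠ 0 := (zero_le.trans_lt (lt_add_one' 1)).ne'
  have a1 := (hs 0 (zero_le.trans_lt (lt_add_one' 1)) 0 e0 1 e1).three
  have a2 := (hs 1 (lt_add_one' 1) 0 e0 (1 + 1) e2).three
  rw [zero_add] at a1
  rw [a2, a1, h0 0 e0 0 e0, h0 0 e0 1 e1, h0 0 e0 _ e2]
  simp [A, n1, n2, n3, n1.symm, n2.symm, n3.symm]

/-- Additive maps that agree on all powers of 2 agree on X, by induction on the truncations of X.
The instance hypotheses make the two sides internal along these truncations, as induction requires.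
-/
theorem additive_ext (φ ψ : M.S → ZInt M) (hφ : ∀ X Y, φ (X + Y) = φ X + φ Y)
    (hψ : ∀ X Y, ψ (X + Y) = ψ X + ψ Y) (X : M.S) [Inl fun i => φ (mkS (· ∈ X) i)]
    [Inl fun i => ψ (mkS (· ∈ X) i)] (h : ∀ i, φ (shift i 1) = ψ (shift i 1)) : φ X = ψ X := by
  have h0 : ∀ φ : M.S → ZInt M, (∀ X Y, φ (X + Y) = φ X + φ Y) → φ 0 = 0 := fun φ hφ => by
    have := hφ 0 0
    rw [add_zero] at this
    exact left_eq_add.1 this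
  have key := Def.induction (P := fun i => φ (mkS (· ∈ X) i) = ψ (mkS (· ∈ X) i))
    (by rw [mkS_zero, h0 φ hφ, h0 ψ hψ]) (fun i ih => by
      rw [mkS_succ, hφ, hψ, ih]
      split_ifs
      · rw [h]
      · rw [h0 φ hφ, h0 ψ hψ])
  have := key (M.len X)
  rwa [mkS_mem_eq fun j hj => len_pos_of_mem hj] at this

/-- The natural number given by a string, as an integer. -/
noncomputable def ofS (X : M.S) : ZInt M := val (X, 0)

theorem ofS_add (X Y : M.S) : ofS (X + Y) = ofS X + ofS Y := by
  rw [ofS, ofS, ofS, val_add, add_zero]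

theorem ofS_mul (X Y : M.S) : ofS (X * Y) = ofS X * ofS Y := by
  rw [ofS, ofS, ofS, val_mul, Str.mul_zero', Str.zero_mul', Str.mul_zero', add_zero, add_zero]

instance (F : M.N → M.S) [SF F] : Inl fun z => ofS (F z) := Inl.val_sf F fun _ => 0

theorem exists_ofS (r : ZInt M) : ∃ X Y, r = ofS X - ofS Y := by
  obtain ⟨c, rfl⟩ := exists_val r
  exact ⟨c.1, c.2, val_eq_sub c⟩

theorem ofS_mul_comm (X Y : M.S) : ofS X * ofS Y = ofS Y * ofS X :=
  additive_ext (fun X => ofS X * ofS Y) (fun X => ofS Y * ofS X)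
    (fun _ _ => by rw [ofS_add, add_mul]) (fun _ _ => by rw [ofS_add, mul_add]) X
    fun i => by rw [← ofS_mul, ← ofS_mul, Str.shift_one_mul, Str.mul_shift_one]

theorem ofS_mul_assoc (X Y Z : M.S) : ofS X * ofS Y * ofS Z = ofS X * (ofS Y * ofS Z) :=
  additive_ext (fun Z => ofS X * ofS Y * ofS Z) (fun Z => ofS X * (ofS Y * ofS Z))
    (fun _ _ => by rw [ofS_add, mul_add]) (fun _ _ => by rw [ofS_add, mul_add, mul_add]) Z
    fun i => by
      rw [← ofS_mul, ← ofS_mul, ← ofS_mul, ← ofS_mul, Str.mul_shift_one, Str.mul_shift_one,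
        Str.mul_shift]

/-- Integers are differences of naturals; for naturals both laws are additive in one factor and
reduce to a power of 2, where multiplication is a shift. -/
noncomputable instance : CommRing (ZInt M) :=
  { (inferInstance : NonAssocRing (ZInt M)) with
    mul_comm := fun x y => by
      obtain ⟨a, b, rfl⟩ := exists_ofS x
      obtain ⟨c, d, rfl⟩ := exists_ofS y
      simp only [sub_mul, mul_sub, ofS_mul_comm a, ofS_mul_comm b]
      abel
    mul_assoc := fun x y z => by
      obtain ⟨a, b, rfl⟩ := exists_ofS x
      obtain ⟨c, d, rfl⟩ := exists_ofS y
      obtain ⟨e, f, rfl⟩ := exists_ofS z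
      simp only [sub_mul, mul_sub, ofS_mul_assoc] }

end Sums

section Operators

/-! ### Linear recursion and the summation operator -/

variable {M : TwoSorted.{u, v}} [IsModel M]

instance (priority := 80) Inl.comp₄ (F : M.N → M.N → M.N → M.N → ZInt M)
    [Inl fun w => F (fst w) (fst (snd w)) (fst (snd (snd w))) (snd (snd (snd w)))]
    (f g h k : M.N → M.N) [NF f] [NF g] [NF h] [NF k] : Inl (fun z => F (f z) (g z) (h z) (k z)) :=
  (Inl.comp (fun w => F (fst w) (fst (snd w)) (fst (snd (snd w))) (snd (snd (snd w))))
    fun z => pr (f z) (pr (g z) (pr (h z) (k z)))).congr fun z => by simp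

/-- The solutions of all linear recursions of an internal family. -/
theorem exists_recursion (L : M.N → M.N → M.N → M.N → ZInt M)
    [Inl fun w => L (fst w) (fst (snd w)) (fst (snd (snd w))) (snd (snd (snd w)))]
    (m : M.N → M.N → M.N) [NF fun w => m (fst w) (snd w)] (b n R : M.N) :
    ∃ D : M.N → M.N → M.N → ZInt M, (Inl fun w => D (fst w) (fst (snd w)) (snd (snd w))) ∧
      ∀ p < b, (∀ r < R, D p 0 r = if r = 0 then 1 else 0) ∧
        ∀ t < n, ∀ r < R, IsSum (m p t) (fun c => D p t c * L p t r c) (D p (t + 1) r) := by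
  classical
  obtain ⟨c, hc⟩ := NF.bound (fun w => m (fst w) (snd w)) (pr b n)
  -- A layered matrix: its indices are pairs (t, c), and its nonzero entries lead from layer t to
  -- layer t + 1, with weights L p t r c from c to r.
  let A : M.N → M.N → M.N → ZInt M := fun p x y =>
    if x = pr (fst x) (snd x) ∧ fst y = fst x + 1 ∧ snd x < m p (fst x)
    then L p (fst x) (snd y) (snd x) else 0
  have hR : R ≤ c + R := le_add_self
  obtain ⟨q, hq, h⟩ := exists_powers A (fun _ => pr (n + 1) (c + R)) b n
  -- The entry of the t-th power from (0, 0) to (t, r) is the sum over all paths, that is, the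
  -- solution at time t that starts from the unit vector with index 0.
  refine ⟨fun p t r => q (pr p (pr t (pr (pr 0 0) (pr t r)))),
    Inl.comp q fun w => pr (fst w) (pr (fst (snd w)) (pr (pr 0 0) (pr (fst (snd w)) (snd (snd w))))),
    fun p hp => ⟨fun r hr => ?_, fun t ht r hr => ?_⟩⟩
  · have h0 := (h p hp).1
    have hn : (0 : M.N) < n + 1 := lt_succ_iff.2 zero_le
    have := h0 _ (pr_lt_pr hn (zero_le.trans_lt (hr.trans_le hR))) _ (pr_lt_pr hn (hr.trans_le hR))
    dsimp only at this ⊢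
    rw [this]
    simp [pr_inj, eq_comm]
  · have hs := (h p hp).2 t ht
    have hn : (0 : M.N) < n + 1 := lt_succ_iff.2 zero_le
    have hn' : t + 1 < n + 1 := add_lt_add_left ht 1
    have ht' : t < n + 1 := ht.trans (lt_add_one' n)
    have hm : ∀ k, k < m p t → k < c + R := fun k hk => by
      have := hc _ (pr_lt_pr hp ht)
      simp only [fst_pr, snd_pr] at this
      exact (hk.trans this).trans_le le_self_add
    have := hs _ (pr_lt_pr hn (zero_le.trans_lt (hr.trans_le hR))) _ (pr_lt_pr hn' (hr.trans_le hR))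
    dsimp only at this ⊢
    refine ((this.sparse (l := m p t) (fun k => pr t k) (fun k hk => pr_lt_pr ht' (hm k hk))
      (fun k k' hk _ => pr_lt_of_add_lt (add_lt_add_right hk t)) fun x _ hx => ?_).congr fun k hk => ?_)
    · have : A p x (pr (t + 1) r) = 0 := by
        refine if_neg ?_
        rintro ⟨h1, h2, h3⟩
        rw [fst_pr] at h2
        have h2 := add_right_cancel h2
        rw [← h2] at h1 h3
        exact hx _ h3 h1
      simp only [this, mul_zero]
    · have : A p (pr t k) (pr (t + 1) r) = L p t r k := by simp [A, hk]
      rw [this]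

theorem IsSum.two {f : M.N → ZInt M} {r : ZInt M} (h : IsSum (1 + 1) f r) : r = f 0 + f 1 := by
  obtain ⟨T, hT, h1, h2, rfl⟩ := h
  have h0 : (0 : M.N) < 1 := zero_lt_one
  have e1 : (1 : M.N) < 1 + 1 := lt_add_one' 1
  have := h2 0 (h0.trans e1)
  rw [zero_add, h1, zero_add] at this
  rw [h2 _ e1, this]

theorem exists_isSum (f : M.N → M.N → ZInt M) [Inl fun w => f (fst w) (snd w)] (b n : M.N) :
    ∃ T : M.N → M.N → ZInt M, (Inl fun w => T (fst w) (snd w)) ∧ ∀ p < b, ∀ k ≤ n,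
      IsSum k (f p) (T p k) := by
  classical
  -- Summation as a linear recursion on vectors of length 2: component 0 stays 1 and component 1
  -- accumulates the summands.
  let L : M.N → M.N → M.N → M.N → ZInt M := fun p t r c =>
    if r = 0 then (if c = 0 then 1 else 0) else (if c = 0 then f p t else 1)
  obtain ⟨D, hD, h⟩ := exists_recursion L (fun _ _ => 1 + 1) b n (1 + 1)
  have e0 : (0 : M.N) < 1 + 1 := zero_le.trans_lt (lt_add_one' 1)
  have e1 : (1 : M.N) < 1 + 1 := lt_add_one' 1
  have hD' := Inl.comp₃ D (fun z => fst z) (fun z => snd z) fun _ => 1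
  refine ⟨fun p k => D p k 1, hD', fun p hp k hk => ?_⟩
  obtain ⟨h0, hs⟩ := h p hp
  have hone : ∀ t, t ≤ n → D p t 0 = 1 := by
    have i1 := Inl.comp₃ D (fun _ => p) (fun z => z) fun _ => 0
    refine Def.induction (P := fun t => t ≤ n → D p t 0 = 1) (fun _ => ?_) fun t ih ht => ?_
    · rw [h0 0 e0, if_pos rfl]
    · have ht := succ_le_iff.1 ht
      have := (hs t ht 0 e0).two
      rw [this, ih ht.le]
      simp [L]
  have i2 := Inl.comp₃ D (fun _ => p) (fun z => z) fun _ => 1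
  refine ⟨fun k => D p k 1, i2, ?_, fun t ht => ?_, rfl⟩
  · dsimp only
    rw [h0 1 e1, if_neg one_ne_zero]
  · have ht := ht.trans_le hk
    dsimp only
    rw [(hs t ht 1 e1).two, hone t ht.le]
    simp [L, add_comm]

open scoped Classical in
/-- The sum `∑_{k < n} f k`. -/
noncomputable def S (n : M.N) (f : M.N → ZInt M) : ZInt M :=
  if h : ∃ r, IsSum n f r then h.choose else 0

theorem IsSum.eq_S {n : M.N} {f : M.N → ZInt M} {r : ZInt M} (h : IsSum n f r) : r = S n f := by
  have h' : ∃ r, IsSum n f r := ⟨r, h⟩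
  rw [S, dif_pos h']
  exact h.unique h'.choose_spec

theorem isSum_S (n : M.N) (f : M.N → ZInt M) [Inl f] : IsSum n f (S n f) := by
  obtain ⟨T, -, h⟩ := exists_isSum (fun _ => f) 1 n
  have := h 0 zero_lt_one n le_rfl
  rwa [← this.eq_S]

theorem isSum_iff_eq {n : M.N} {f : M.N → ZInt M} [Inl f] {r : ZInt M} :
    IsSum n f r ↔ r = S n f :=
  ⟨fun h => h.eq_S, fun h => h ▸ isSum_S n f⟩

/-- The partial sums of a whole family exist as one internal function, so a sum depends internally
on the parameters of its summands and on its length. -/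
instance Inl.sum (f : M.N → M.N → ZInt M) [Inl fun w => f (fst w) (snd w)] (n : M.N → M.N) [NF n] :
    Inl fun z => S (n z) (f z) := Inl.of_local fun b => by
  obtain ⟨c, hc⟩ := NF.bound n b
  obtain ⟨T, hT, h⟩ := exists_isSum f b c
  exact ⟨fun z => T z (n z), inferInstance, fun z hz => (h z hz _ (hc z hz).le).eq_S.symm⟩

/-- The values below n determine the predicate `IsSum n f`, hence also the chosen value or the
default. No internality is needed, so the lemma can rewrite under sums freely. -/
theorem S_congr {n : M.N} {f g : M.N → ZInt M} (h : ∀ k < n, f k = g k) : S n f = S n g := by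
  have : IsSum n f = IsSum n g :=
    funext fun r => propext ⟨fun h' => h'.congr h, fun h' => h'.congr fun k hk => (h k hk).symm⟩
  have key : ∀ P Q : ZInt M → Prop, P = Q → ∀ (h : ∃ r, P r) (h' : ∃ r, Q r),
      h.choose = h'.choose := by
    rintro P _ rfl _ _; rfl
  by_cases hf : ∃ r, IsSum n f r
  · have hg := hf
    rw [this] at hg
    rw [S, S, dif_pos hf, dif_pos hg]
    exact key _ _ this _ _
  · have hg := hf
    rw [this] at hg
    rw [S, S, dif_neg hf, dif_neg hg]

@[simp] theorem S_zero (f : M.N → ZInt M) : S 0 f = 0 :=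
  Eq.symm <| IsSum.eq_S ⟨fun _ => 0, inferInstance, rfl, fun _ hk => absurd hk zero_le.not_gt, rfl⟩

theorem S_succ (n : M.N) (f : M.N → ZInt M) [Inl f] : S (n + 1) f = S n f + f n := by
  obtain ⟨T, hT, h1, h2, h3⟩ := isSum_S (n + 1) f
  have : IsSum n f (T n) := ⟨T, hT, h1, fun k hk => h2 k (hk.trans (lt_add_one' n)), rfl⟩
  rw [← h3, h2 n (lt_add_one' n), this.eq_S]

theorem S_eq_zero {n : M.N} {f : M.N → ZInt M} (h : ∀ k < n, f k = 0) : S n f = 0 := by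
  rw [S_congr h]
  exact Def.induction (P := fun n => S n (fun _ => (0 : ZInt M)) = 0) (S_zero _)
    (fun n ih => by rw [S_succ, ih, add_zero]) n

theorem S_add (n : M.N) (f g : M.N → ZInt M) [Inl f] [Inl g] :
    S n (fun k => f k + g k) = S n f + S n g :=
  Def.induction (P := fun n => S n (fun k => f k + g k) = S n f + S n g) (by simp)
    (fun n ih => by rw [S_succ, S_succ, S_succ, ih]; ring) n

theorem S_mul_left (n : M.N) (r : ZInt M) (f : M.N → ZInt M) [Inl f] :
    S n (fun k => r * f k) = r * S n f :=
  Def.induction (P := fun n => S n (fun k => r * f k) = r * S n f) (by simp)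
    (fun n ih => by rw [S_succ, S_succ, ih]; ring) n

theorem S_mul_right (n : M.N) (r : ZInt M) (f : M.N → ZInt M) [Inl f] :
    S n (fun k => f k * r) = S n f * r := by
  rw [mul_comm, ← S_mul_left]
  exact S_congr fun k _ => mul_comm _ _

theorem S_neg (n : M.N) (f : M.N → ZInt M) [Inl f] : S n (fun k => - f k) = - S n f := by
  rw [neg_eq_neg_one_mul, ← S_mul_left]
  exact S_congr fun k _ => neg_eq_neg_one_mul _

theorem S_comm (n m : M.N) (f : M.N → M.N → ZInt M) [Inl fun w => f (fst w) (snd w)] :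
    S n (fun i => S m (fun j => f i j)) = S m (fun j => S n (fun i => f i j)) :=
  Def.induction (P := fun n => S n (fun i => S m (fun j => f i j)) = S m (fun j => S n (fun i => f i j)))
    (by rw [S_zero, S_eq_zero]; intros; rw [S_zero])
    (fun n ih => by
      rw [S_succ, ih, ← S_add m (fun j => S n fun i => f i j) (f n)]
      exact S_congr fun j _ => (S_succ _ _).symm) n

theorem S_succ_left (n : M.N) (f : M.N → ZInt M) [Inl f] :
    S (n + 1) f = f 0 + S n (fun k => f (k + 1)) :=
  Def.induction (P := fun n => S (n + 1) f = f 0 + S n (fun k => f (k + 1)))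
    (by rw [S_succ, S_zero, S_zero, add_comm])
    (fun n ih => by rw [S_succ, ih, S_succ n]; ring) n

open scoped Classical in
/-- The increasing function that omits the value `i`. -/
noncomputable def sk (i r : M.N) : M.N := if r < i then r else r + 1

instance : NF (M := M) fun w => sk (fst w) (snd w) := by unfold sk; infer_instance

/-- Separates one summand; `sk i` renumbers the others. In this form the expansion sums pass to
minors. -/
theorem S_remove (n i : M.N) (hi : i < n + 1) (f : M.N → ZInt M) [Inl f] :
    S (n + 1) f = f i + S n (fun c => f (sk i c)) := by
  refine Def.induction (P := fun n => i < n + 1 → S (n + 1) f = f i + S n (fun c => f (sk i c)))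
    (fun hi => ?_) (fun n ih hi => ?_) n hi
  · rw [zero_add, ← zero_add (1 : M.N), lt_succ_iff] at hi
    obtain rfl := le_antisymm hi zero_le
    rw [S_succ, S_zero, S_zero, add_comm]
  · rw [S_succ]
    rcases (lt_succ_iff.1 hi).eq_or_lt with rfl | hi
    · rw [add_comm]
      congr 1
      refine S_congr fun k hk => ?_
      rw [sk, if_pos hk]
    · rw [ih hi, S_succ n, add_assoc, sk, if_neg (not_lt.2 (lt_succ_iff.1 hi))]

open scoped Classical in
/-- Truncated subtraction. -/
noncomputable def tsub (a b : M.N) : M.N := if h : ∃ c, b + c = a then h.choose else 0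

theorem tsub_eq {a b c : M.N} (h : b + c = a) : tsub a b = c := by
  have h' : ∃ c, b + c = a := ⟨c, h⟩
  rw [tsub, dif_pos h']
  exact add_left_cancel (h'.choose_spec.trans h.symm)

theorem tsub_eq_zero {a b : M.N} (h : a < b) : tsub a b = 0 := by
  rw [tsub, dif_neg]
  rintro ⟨c, rfl⟩
  exact h.not_ge le_self_add

theorem tsub_le (a b : M.N) : tsub a b ≤ a := by
  rcases lt_or_ge a b with h | h
  · rw [tsub_eq_zero h]; exact zero_le
  · obtain ⟨c, rfl⟩ := exists_add_of_le h
    rw [tsub_eq rfl]; exact le_add_self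

instance : NF (M := M) fun w => tsub (fst w) (snd w) := by
  refine NF.of_graph _ ((inferInstance : Def fun w : M.N =>
    (snd (fst w) + snd w = fst (fst w)) ∨ (fst (fst w) < snd (fst w) ∧ snd w = 0)).congr fun w => ?_)
    fun b => ⟨b, fun z hz => ((tsub_le _ _).trans (fst_le z)).trans_lt hz⟩
  constructor
  · rintro (h | ⟨h, h'⟩)
    · exact tsub_eq h
    · rw [tsub_eq_zero h, h']
  · intro h
    rcases lt_or_ge (fst (fst w)) (snd (fst w)) with h' | h'
    · rw [tsub_eq_zero h'] at h
      exact Or.inr ⟨h', h.symm⟩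
    · obtain ⟨c, hc⟩ := exists_add_of_le h'
      rw [tsub_eq hc.symm] at h
      exact Or.inl (by rw [← h, hc])

/-! ### Powers of matrices -/

open scoped Classical in
/-- The entry `(i, j)` of the power `A ^ t` of the `m × m` matrix `A`, and `0` if `i` or `j` is out
of range. -/
noncomputable def Pow (m : M.N) (A : M.N → M.N → ZInt M) (t i j : M.N) : ZInt M :=
  if h : (i < m ∧ j < m) ∧ ∃ q : M.N → ZInt M, Inl q ∧ IsPowSeq m t A fun t i j => q (pr t (pr i j))
  then h.2.choose (pr t (pr i j)) else 0

theorem IsPowSeq.unique {m n : M.N} {A : M.N → M.N → ZInt M} {q q' : M.N → ZInt M} [Inl q] [Inl q']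
    (h : IsPowSeq m n A fun t i j => q (pr t (pr i j)))
    (h' : IsPowSeq m n A fun t i j => q' (pr t (pr i j))) {i j : M.N} (hi : i < m) (hj : j < m) :
    q (pr n (pr i j)) = q' (pr n (pr i j)) := by
  refine Def.induction (P := fun t => t ≤ n → ∀ j < m, q (pr t (pr i j)) = q' (pr t (pr i j)))
    (fun _ j hj => ?_) (fun t ih ht j hj => ?_) n le_rfl j hj
  · have a := h.1 i hi j hj
    have b := h'.1 i hi j hj
    exact a.trans b.symm
  · have ht := succ_le_iff.1 ht
    have a := h.2 t ht i hi j hj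
    have b := h'.2 t ht i hi j hj
    exact (a.congr fun k hk => by dsimp only; rw [ih ht.le k hk]).unique b

theorem IsPowSeq.eq_Pow {m n : M.N} {A : M.N → M.N → ZInt M} {q : M.N → ZInt M} [hq : Inl q]
    (h : IsPowSeq m n A fun t i j => q (pr t (pr i j))) {t i j : M.N} (ht : t ≤ n) (hi : i < m)
    (hj : j < m) : q (pr t (pr i j)) = Pow m A t i j := by
  have h1 : IsPowSeq m t A fun t i j => q (pr t (pr i j)) := ⟨h.1, fun s hs => h.2 s (hs.trans_le ht)⟩
  have h' : ∃ q : M.N → ZInt M, Inl q ∧ IsPowSeq m t A fun t i j => q (pr t (pr i j)) := ⟨q, hq, h1⟩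
  rw [Pow, dif_pos ⟨⟨hi, hj⟩, h'⟩]
  have := h'.choose_spec.1
  exact h1.unique h'.choose_spec.2 hi hj

instance Inl.pow (A : M.N → M.N → M.N → ZInt M)
    [Inl fun w => A (fst w) (fst (snd w)) (snd (snd w))] (m t i j : M.N → M.N) [NF m] [NF t] [NF i]
    [NF j] : Inl fun z => Pow (m z) (A z) (t z) (i z) (j z) := Inl.of_local fun b => by
  classical
  obtain ⟨n, hn⟩ := NF.bound t b
  obtain ⟨q, hq, h⟩ := exists_powers A m b n
  refine ⟨fun z => if i z < m z ∧ j z < m z then q (pr z (pr (t z) (pr (i z) (j z)))) else 0,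
    inferInstance, fun z hz => ?_⟩
  have := Inl.comp q (pr z)
  dsimp only
  split_ifs with hij
  · exact (IsPowSeq.eq_Pow (q := fun x => q (pr z x)) (h z hz) (hn z hz).le hij.1 hij.2).symm
  · rw [Pow, dif_neg fun h => hij h.1]

end Operators

section Pfaffian

/-! ### The Pfaffian of an internal matrix -/

variable {M : TwoSorted.{u, v}} [IsModel M]

theorem Pow_congr {m t i j : M.N} {A B : M.N → M.N → ZInt M} (h : ∀ i < m, ∀ j < m, A i j = B i j) :
    Pow m A t i j = Pow m B t i j := by
  have key : ∀ A B : M.N → M.N → ZInt M, (∀ i < m, ∀ j < m, A i j = B i j) → ∀ q,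
      IsPowSeq m t A q → IsPowSeq m t B q := fun A B h q hq =>
    ⟨hq.1, fun s hs i hi j hj => (hq.2 s hs i hi j hj).congr fun k hk => by rw [h k hk j hj]⟩
  have e : IsPowSeq m t A = IsPowSeq m t B := funext fun q => propext
    ⟨key A B h q, key B A (fun i hi j hj => (h i hi j hj).symm) q⟩
  have gen : ∀ P Q : (M.N → M.N → M.N → ZInt M) → Prop, P = Q →
      ∀ (h : ∃ q : M.N → ZInt M, Inl q ∧ P fun t i j => q (pr t (pr i j)))
        (h' : ∃ q : M.N → ZInt M, Inl q ∧ Q fun t i j => q (pr t (pr i j))),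
        h.choose = h'.choose := by rintro P _ rfl _ _; rfl
  by_cases hA : (i < m ∧ j < m) ∧ ∃ q : M.N → ZInt M,
      Inl q ∧ IsPowSeq m t A fun t i j => q (pr t (pr i j))
  · have hB := hA
    rw [e] at hB
    rw [Pow, Pow, dif_pos hA, dif_pos hB, gen _ _ e hA.2 hB.2]
  · have hB := hA
    rw [e] at hB
    rw [Pow, Pow, dif_neg hA, dif_neg hB]

/-- `t` is even. -/
def Ev (t : M.N) : Prop := ∃ k < t + 1, t = k + k

instance : Def (M := M) Ev := (inferInstance : Def fun t : M.N => ∃ k < t + 1, t = k + k)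

open scoped Classical in
/-- The block diagonal matrix `J`. -/
noncomputable def Jm (i j : M.N) : ZInt M :=
  if Ev i ∧ j = i + 1 then 1 else if Ev j ∧ i = j + 1 then -1 else 0

instance : Inl fun w : M.N => Jm (fst w) (snd w) := by unfold Jm; infer_instance

/-- The column `(M J) ^ s S`. -/
noncomputable def powCol (p : M.N) (A : M.N → M.N → ZInt M) (s i : M.N) : ZInt M :=
  S (p + p) fun j => Pow (p + p) (fun a b => S (p + p) fun k => A (a + (1 + 1)) (k + (1 + 1)) * Jm k b)
    s i j * A (j + (1 + 1)) 1

/-- The number `R J (M J) ^ s S`. -/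
noncomputable def blk (p : M.N) (A : M.N → M.N → ZInt M) (s : M.N) : ZInt M :=
  S (p + p) fun i => (S (p + p) fun l => A 0 (l + (1 + 1)) * Jm l i) * powCol p A s i

open scoped Classical in
/-- The Toeplitz matrix `P_A`. -/
noncomputable def toep (p : M.N) (A : M.N → M.N → ZInt M) (r c : M.N) : ZInt M :=
  if r < c then 0 else if r = c then 1 else if r = c + 1 then A 0 1
  else blk p A (tsub r (c + (1 + 1)))

section

variable (A : M.N → M.N → M.N → ZInt M) [Inl fun w => A (fst w) (fst (snd w)) (snd (snd w))]

instance (p s i : M.N → M.N) [NF p] [NF s] [NF i] : Inl fun z => powCol (p z) (A z) (s z) (i z) := by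
  unfold powCol; infer_instance

instance (p s : M.N → M.N) [NF p] [NF s] : Inl fun z => blk (p z) (A z) (s z) := by
  unfold blk; infer_instance

instance (p r c : M.N → M.N) [NF p] [NF r] [NF c] : Inl fun z => toep (p z) (A z) (r z) (c z) := by
  unfold toep; infer_instance

end

theorem add_two_lt {a p : M.N} (h : a < p + p) : a + (1 + 1) < p + 1 + (p + 1) := by
  have := add_lt_add_left h (1 + 1)
  rwa [add_add_add_comm] at this

theorem zero_lt_two_succ (p : M.N) : 0 < p + 1 + (p + 1) :=
  zero_le.trans_lt ((lt_add_one' p).trans_le le_self_add)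

theorem one_lt_two_succ (p : M.N) : 1 < p + 1 + (p + 1) := by
  rw [add_add_add_comm]
  exact (lt_add_one' 1).trans_le le_add_self

theorem powCol_congr {p s i : M.N} {A B : M.N → M.N → ZInt M}
    (h : ∀ i < p + 1 + (p + 1), ∀ j < p + 1 + (p + 1), i ≠ 0 → j ≠ 0 → A i j = B i j) :
    powCol p A s i = powCol p B s i := by
  have e : ∀ a : M.N, a + (1 + 1) ≠ 0 := fun a =>
    (zero_le.trans_lt ((lt_add_one' 1).trans_le le_add_self)).ne'
  refine S_congr fun j hj => ?_
  rw [h _ (add_two_lt hj) _ (one_lt_two_succ p) (e j) one_ne_zero]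
  congr 1
  refine Pow_congr fun a ha b hb => S_congr fun k hk => ?_
  rw [h _ (add_two_lt ha) _ (add_two_lt hk) (e a) (e k)]

theorem toep_congr {p r c : M.N} {A B : M.N → M.N → ZInt M}
    (h : ∀ i < p + 1 + (p + 1), ∀ j < p + 1 + (p + 1), A i j = B i j) :
    toep p A r c = toep p B r c := by
  have hb : ∀ s, blk p A s = blk p B s := fun s => by
    refine S_congr fun i _ => ?_
    rw [powCol_congr fun i hi j hj _ _ => h i hi j hj]
    congr 1
    exact S_congr fun l hl => by rw [h _ (zero_lt_two_succ p) _ (add_two_lt hl)]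
  rw [toep, toep, hb, h 0 (zero_lt_two_succ p) 1 (one_lt_two_succ p)]

/-- Row `k` of `C` lists the Pfaffian coefficients of `A` without its first `2k` rows and columns. -/
def IsPf (n : M.N) (A : M.N → M.N → ZInt M) (C : M.N → M.N → ZInt M) : Prop :=
  C n 0 = 1 ∧ ∀ k p, k + p + 1 = n → ∀ r < p + (1 + 1),
    C k r = S (p + 1) fun c => toep p (fun i j => A (k + k + i) (k + k + j)) r c * C (k + 1) c

theorem exists_isPf (A : M.N → M.N → M.N → ZInt M)
    [Inl fun w => A (fst w) (fst (snd w)) (snd (snd w))] (n : M.N → M.N) [NF n] (b : M.N) :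
    ∃ C : M.N → M.N → M.N → ZInt M, (Inl fun w => C (fst w) (fst (snd w)) (snd (snd w))) ∧
      ∀ z < b, IsPf (n z) (A z) (C z) := by
  classical
  obtain ⟨N, hN⟩ := NF.bound n b
  -- The coefficients are computed from the empty matrix upwards: step t multiplies by the Toeplitz
  -- matrix of the trailing block of size 2(t + 1), which starts at k = n - (t + 1).
  let L : M.N → M.N → M.N → M.N → ZInt M := fun z t r c =>
    toep t (fun i j => A z (tsub (n z) (t + 1) + tsub (n z) (t + 1) + i)
      (tsub (n z) (t + 1) + tsub (n z) (t + 1) + j)) r c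
  obtain ⟨D, hD, h⟩ := exists_recursion L (fun _ t => t + 1) b N (N + 1)
  refine ⟨fun z k r => D z (tsub (n z) k) r, inferInstance, fun z hz => ⟨?_, fun k p hk r hr => ?_⟩⟩
  · dsimp only
    rw [tsub_eq (add_zero (n z)), (h z hz).1 0 (lt_succ_iff.2 zero_le), if_pos rfl]
  · have e1 : tsub (n z) k = p + 1 := tsub_eq (by rw [← hk, add_assoc])
    have e2 : tsub (n z) (k + 1) = p := tsub_eq (by rw [← hk, add_right_comm])
    have e3 : tsub (n z) (p + 1) = k := tsub_eq (by rw [← hk]; ring)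
    have hp : p + 1 ≤ n z := by rw [← hk, add_assoc]; exact le_add_self
    have hpN : p + 1 < N := hp.trans_lt (hN z hz)
    have := ((h z hz).2 p ((lt_add_one' p).trans hpN) r (by
      refine hr.trans ?_
      rw [← add_assoc]
      exact add_lt_add_left hpN 1)).eq_S
    dsimp only
    rw [e1, e2, this]
    refine S_congr fun c _ => ?_
    simp only [L, e3]
    exact mul_comm _ _

/-- Induction on t = n - k, from the empty trailing block upwards. Stating it for two matrices that
agree within range also gives the congruence of the Pfaffian. -/
theorem IsPf.unique {n : M.N} {A B C D : M.N → M.N → ZInt M} [Inl fun w => C (fst w) (snd w)]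
    [Inl fun w => D (fst w) (snd w)] (hC : IsPf n A C) (hD : IsPf n B D)
    (h : ∀ i < n + n, ∀ j < n + n, A i j = B i j) {k t r : M.N}
    (hk : k + t = n) (hr : r < t + 1) : C k r = D k r := by
  have key : t ≤ n → ∀ r < t + 1, C (tsub n t) r = D (tsub n t) r := by
    refine Def.induction (P := fun t => t ≤ n → ∀ r < t + 1, C (tsub n t) r = D (tsub n t) r)
      (fun _ r hr => ?_) (fun t ih ht r hr => ?_) t
    · obtain rfl : r = 0 := le_antisymm (lt_succ_iff.1 hr) zero_le
      rw [tsub_eq (zero_add n), hC.1, hD.1]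
    · obtain ⟨k, hk⟩ := exists_add_of_le ht
      have e1 : tsub n (t + 1) = k := tsub_eq hk.symm
      have e2 : tsub n t = k + 1 := tsub_eq (by rw [hk]; ring)
      have e3 : k + t + 1 = n := by rw [hk]; ring
      have ht := succ_le_iff.1 ht
      rw [add_assoc] at hr
      rw [e1, hC.2 k t e3 r hr, hD.2 k t e3 r hr]
      refine S_congr fun c hc => ?_
      rw [← e2, ih ht.le c hc]
      congr 1
      have e4 : ∀ i, i < t + 1 + (t + 1) → k + k + i < n + n := fun i hi => by
        have : n + n = k + k + (t + 1 + (t + 1)) := by rw [hk]; ring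
        rw [this]
        exact add_lt_add_right hi _
      exact toep_congr fun i hi j hj => h _ (e4 i hi) _ (e4 j hj)
  have := key (by rw [← hk]; exact le_add_self) r hr
  rwa [tsub_eq (by rw [add_comm, hk])] at this

/-- The recursion for the trailing block is part of that for the whole matrix, so row 1 of the table
depends on the trailing block only. -/
theorem IsPf.tail {p : M.N} {A C : M.N → M.N → ZInt M} (h : IsPf (p + 1) A C) :
    IsPf p (fun i j => A (i + (1 + 1)) (j + (1 + 1))) fun k r => C (k + 1) r := by
  refine ⟨h.1, fun k q hk r hr => (h.2 (k + 1) q (by rw [← hk]; ring) r hr).trans ?_⟩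
  refine S_congr fun c _ => ?_
  congr 2
  funext i j
  congr 1 <;> ring

open scoped Classical in
/-- The Pfaffian of the `2n × 2n` matrix `A`. -/
noncomputable def pf (n : M.N) (A : M.N → M.N → ZInt M) : ZInt M :=
  if h : ∃ C : M.N → M.N → ZInt M, (Inl fun w => C (fst w) (snd w)) ∧ IsPf n A C
  then h.choose 0 n else 0

theorem IsPf.eq_pf {n : M.N} {A C : M.N → M.N → ZInt M} [hC : Inl fun w => C (fst w) (snd w)]
    (h : IsPf n A C) : C 0 n = pf n A := by
  have h' : ∃ C : M.N → M.N → ZInt M, (Inl fun w => C (fst w) (snd w)) ∧ IsPf n A C := ⟨C, hC, h⟩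
  rw [pf, dif_pos h']
  have := h'.choose_spec.1
  exact h.unique h'.choose_spec.2 (fun _ _ _ _ => rfl) (zero_add n) (lt_add_one' n)

instance Inl.pf (A : M.N → M.N → M.N → ZInt M)
    [Inl fun w => A (fst w) (fst (snd w)) (snd (snd w))] (n : M.N → M.N) [NF n] :
    Inl fun z => pf (n z) (A z) := Inl.of_local fun b => by
  obtain ⟨C, hC, h⟩ := exists_isPf A n b
  refine ⟨fun z => C z 0 (n z), inferInstance, fun z hz => ?_⟩
  have := Inl.comp₃ C (fun _ => z) (fun w => fst w) fun w => snd w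
  exact (h z hz).eq_pf.symm

theorem exists_isPf_single (n : M.N) (A : M.N → M.N → ZInt M) [Inl fun w => A (fst w) (snd w)] :
    ∃ C : M.N → M.N → ZInt M, (Inl fun w => C (fst w) (snd w)) ∧ IsPf n A C := by
  obtain ⟨C, hC, h⟩ := exists_isPf (fun _ => A) (fun _ => n) 1
  exact ⟨C 0, Inl.comp₃ C (fun _ => 0) (fun w => fst w) fun w => snd w, h 0 zero_lt_one⟩

theorem pf_congr {n : M.N} {A B : M.N → M.N → ZInt M} [Inl fun w => A (fst w) (snd w)]
    [Inl fun w => B (fst w) (snd w)] (h : ∀ i < n + n, ∀ j < n + n, A i j = B i j) :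
    pf n A = pf n B := by
  obtain ⟨C, hC, h1⟩ := exists_isPf_single n A
  obtain ⟨D, hD, h2⟩ := exists_isPf_single n B
  rw [← h1.eq_pf, ← h2.eq_pf]
  exact h1.unique h2 h (zero_add n) (lt_add_one' n)

theorem pf_zero (A : M.N → M.N → ZInt M) [Inl fun w => A (fst w) (snd w)] : pf 0 A = 1 := by
  obtain ⟨C, hC, h⟩ := exists_isPf_single 0 A
  rw [← h.eq_pf, h.1]

/-- Exchanging the sums collects the coefficient of each entry R l of the first row. -/
theorem S_rearrange (n m : M.N) (R D : M.N → ZInt M) (J X : M.N → M.N → ZInt M) [Inl R] [Inl D]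
    [Inl fun w => J (fst w) (snd w)] [Inl fun w => X (fst w) (snd w)] :
    (S n fun c => (S m fun i => (S m fun l => R l * J l i) * X c i) * D c) =
      S m fun l => R l * S m fun i => J l i * S n fun c => X c i * D c := by
  have e1 : ∀ l, (R l * S m fun i => J l i * S n fun c => X c i * D c) =
      S m fun i => S n fun c => R l * J l i * X c i * D c := fun l => by
    rw [← S_mul_left]
    refine S_congr fun i _ => ?_
    rw [← S_mul_left, ← S_mul_left]
    exact S_congr fun c _ => by ring
  have e2 : ∀ c, (S m fun i => (S m fun l => R l * J l i) * X c i) * D c =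
      S m fun i => S m fun l => R l * J l i * X c i * D c := fun c => by
    rw [← S_mul_right]
    refine S_congr fun i _ => ?_
    rw [← S_mul_right, ← S_mul_right]
  simp only [e1, e2]
  rw [S_comm n m fun c i => S m fun l => R l * J l i * X c i * D c,
    S_comm m m fun l i => S n fun c => R l * J l i * X c i * D c]
  refine S_congr fun i _ => ?_
  exact S_comm n m fun c l => R l * J l i * X c i * D c

/-- The Pfaffian is linear in the first row, with coefficients that depend on the rest only. -/
theorem exists_pf_succ (p : M.N) (A : M.N → M.N → ZInt M) [Inl fun w => A (fst w) (snd w)] :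
    ∃ V : M.N → ZInt M, Inl V ∧ ∀ (B : M.N → M.N → ZInt M) [Inl fun w => B (fst w) (snd w)],
      (∀ i < p + 1 + (p + 1), ∀ j < p + 1 + (p + 1), i ≠ 0 → j ≠ 0 → B i j = A i j) →
      pf (p + 1) B = B 0 1 * pf p (fun i j => A (i + (1 + 1)) (j + (1 + 1))) +
        S (p + p) fun j => B 0 (j + (1 + 1)) * V j := by
  obtain ⟨C, hC, h⟩ := exists_isPf_single (p + 1) A
  -- In the last row p + 1 of the Toeplitz matrix, the column c < p lies on the subdiagonal s + 2
  -- with s = (p + 1) - (c + 2).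
  let X : M.N → M.N → ZInt M := fun c i => powCol p A (tsub (p + 1) (c + (1 + 1))) i
  refine ⟨fun l => S (p + p) fun i => Jm l i * S p fun c => X c i * C 1 c, inferInstance,
    fun B hB hBA => ?_⟩
  obtain ⟨D, hD, h'⟩ := exists_isPf_single (p + 1) B
  have hCD : ∀ c < p + 1, D 1 c = C 1 c := fun c hc => by
    have := IsPf.unique h'.tail h.tail (fun i hi j hj => hBA _ (add_two_lt hi) _ (add_two_lt hj)
      (zero_le.trans_lt ((lt_add_one' 1).trans_le le_add_self)).ne'
      (zero_le.trans_lt ((lt_add_one' 1).trans_le le_add_self)).ne') (zero_add p) hc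
    rwa [zero_add] at this
  have hp : C 1 p = pf p (fun i j => A (i + (1 + 1)) (j + (1 + 1))) := by
    rw [← h.tail.eq_pf, zero_add]
  -- The Pfaffian is the last coefficient. Its summand c = p meets the first subdiagonal and gives
  -- a_12 times the Pfaffian of the trailing block; the others contain the rest of the first row
  -- linearly.
  rw [← h'.eq_pf, h'.2 0 p (by rw [zero_add]) (p + 1) (by rw [← add_assoc]; exact lt_add_one' _),
    S_succ]
  simp only [zero_add]
  rw [hCD p (lt_add_one' p), hp, toep, if_neg (lt_add_one' p).not_gt, if_neg (lt_add_one' p).ne',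
    if_pos rfl, add_comm, ← S_rearrange p (p + p) (fun l => B 0 (l + (1 + 1)))]
  congr 1
  refine S_congr fun c hc => ?_
  have hc1 : c + 1 < p + 1 := add_lt_add_left hc 1
  rw [hCD c (hc.trans (lt_add_one' p)), toep, if_neg ((lt_add_one' c).trans hc1).not_gt,
    if_neg ((lt_add_one' c).trans hc1).ne', if_neg hc1.ne', blk]
  congr 1
  refine S_congr fun i _ => ?_
  rw [powCol_congr hBA]

end Pfaffian

section Idx

/-! ### Renumbering rows and columns -/

variable {M : TwoSorted.{u, v}} [IsModel M]

/-- The discreteness of the order, which lets `grind` settle the case distinctions of the index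
maps. -/
theorem nat_facts : (0 : M.N) < 1 ∧ (∀ a b : M.N, a < b ↔ a + 1 ≤ b) ∧ (∀ a : M.N, 0 ≤ a) ∧ ∀ a b : M.N, a ≤ b ∨ b + 1 ≤ a :=
  ⟨zero_lt_one, fun _ _ => succ_le_iff.symm, fun _ => zero_le, fun a b => (le_or_gt a b).imp id succ_le_iff.2⟩

open scoped Classical in
/-- The transposition of `i` and `j`. -/
noncomputable def sw (i j r : M.N) : M.N := if r = i then j else if r = j then i else r

open scoped Classical in
/-- The cycle `0 ← j`, `r + 1 ← r` for `r < j`. -/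
noncomputable def kap (j r : M.N) : M.N := if r < j then r + 1 else if r = j then 0 else r

/-- If the value `b` is omitted, the number `a ≠ b` becomes `pd a b`. -/
noncomputable def pd (a b : M.N) : M.N := open scoped Classical in if b < a then tsub a 1 else a

noncomputable def tau (i r : M.N) : M.N := open scoped Classical in
  if r = 0 then i else if i < r then r else tsub r 1

theorem zero_or_succ (a : M.N) : a = 0 ∨ ∃ b, tsub (b + 1) 1 = b ∧ a = b + 1 := by
  by_cases h : a = 0
  · exact Or.inl h
  · obtain ⟨b, rfl⟩ := exists_succ h
    exact Or.inr ⟨b, tsub_eq (add_comm 1 b), rfl⟩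

instance : NF (M := M) fun w => kap (fst w) (snd w) := by unfold kap; infer_instance
instance : NF (M := M) fun w => pd (fst w) (snd w) := by unfold pd; infer_instance
instance : NF (M := M) fun w => tau (fst w) (snd w) := by unfold tau; infer_instance
instance (i j f : M.N → M.N) [NF i] [NF j] [NF f] : NF fun z => sw (i z) (j z) (f z) := by
  unfold sw; infer_instance

/-- After the transposition of 1 and j + 2, the indices from 2 on enumerate all indices except 0 and
j + 2, in increasing order up to the cycle `kap j`. -/
theorem sk_kap (j r : M.N) : sk (j + 1) (kap j r) + 1 = sw 1 (j + (1 + 1)) (r + (1+1)) := by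
  obtain ⟨h0, d1, nn, d2⟩ := nat_facts (M := M)
  have := nn r; have := nn j
  grind [sk, kap, sw]

/-- Exhibits `kap j` as a product of j transpositions, which yields its sign. -/
theorem kap_succ (j r : M.N) : kap (j + 1) r = kap j (sw j (j + 1) r) := by
  obtain ⟨h0, d1, nn, d2⟩ := nat_facts (M := M)
  grind [sk, kap, sw]

theorem kap_lt {j r n : M.N} (hj : j < n) (hr : r < n) : kap j r < n := by
  obtain ⟨h0, d1, nn, d2⟩ := nat_facts (M := M)
  have := nn r; have := nn j
  grind [kap]

/-- The cycle `tau j`, which brings j to the front and keeps the order of the others, is a product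
of j transpositions. -/
theorem tau_succ_zero (j r : M.N) : tau (j + 1) r = tau j (sw 0 (j + 1) r) := by
  obtain ⟨h0, d1, nn, d2⟩ := nat_facts (M := M)
  obtain rfl | ⟨a, ha, rfl⟩ := zero_or_succ r
  · have := nn j
    grind [tau, sw]
  · have := nn a; have := nn j
    grind [tau, sw]

theorem tau_lt {j r n : M.N} (hj : j < n) (hr : r < n) : tau j r < n := by
  obtain ⟨h0, d1, nn, d2⟩ := nat_facts (M := M)
  obtain rfl | ⟨a, ha, rfl⟩ := zero_or_succ r
  · grind [tau]
  · have := nn a; have := nn j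
    grind [tau]

theorem tau_succ (j r : M.N) : tau j (r + 1) = sk j r := by
  obtain ⟨h0, d1, nn, d2⟩ := nat_facts (M := M)
  have := tsub_eq (add_comm 1 r)
  have := nn r
  grind [tau, sk]

theorem sk_lt (i : M.N) {r n : M.N} (hr : r < n) : sk i r < n + 1 := by
  obtain ⟨h0, d1, nn, d2⟩ := nat_facts (M := M)
  grind [sk]

theorem sk_ne (i r : M.N) : sk i r ≠ i := by
  obtain ⟨h0, d1, nn, d2⟩ := nat_facts (M := M)
  grind [sk]

theorem pd_lt {a b n : M.N} (ha : a < n + 1) (hb : b < n + 1) (h : a ≠ b) : pd a b < n := by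
  obtain ⟨h0, d1, nn, d2⟩ := nat_facts (M := M)
  have := nn b
  obtain rfl | ⟨a, ha, rfl⟩ := zero_or_succ a
  · grind [pd]
  · grind [pd]

theorem sk_pd {a b : M.N} (h : a ≠ b) : sk b (pd a b) = a := by
  obtain ⟨h0, d1, nn, d2⟩ := nat_facts (M := M)
  have := nn b
  obtain rfl | ⟨a, ha, rfl⟩ := zero_or_succ a
  · grind [pd, sk]
  · grind [pd, sk]

theorem pd_sk (a b : M.N) : pd (sk b a) b = a := by
  obtain ⟨h0, d1, nn, d2⟩ := nat_facts (M := M)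
  have := tsub_eq (add_comm 1 a)
  grind [pd, sk]

theorem pd_sk_self (a b : M.N) : pd a (sk a b) = pd a b := by
  obtain ⟨h0, d1, nn, d2⟩ := nat_facts (M := M)
  have := nn b
  obtain rfl | ⟨a, ha, rfl⟩ := zero_or_succ a
  · grind [pd, sk]
  · grind [pd, sk]

/-- Two indices can be omitted in either order: both sides enumerate the complement of a and `sk a
b` increasingly. -/
theorem sk_sk (a b r : M.N) : sk (sk a b) (sk (pd a b) r) = sk a (sk b r) := by
  obtain ⟨h0, d1, nn, d2⟩ := nat_facts (M := M)
  have := nn b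
  obtain rfl | ⟨a, ha, rfl⟩ := zero_or_succ a
  · grind [pd, sk]
  · grind [pd, sk]

end Idx

section Expansion

/-! ### Alternation implies the cofactor expansion -/

variable {M : TwoSorted.{u, v}} [IsModel M]

theorem ev_succ (t : M.N) : Ev (t + 1) ↔ ¬ Ev t := by
  obtain ⟨h0, d1, nn, d2⟩ := nat_facts (M := M)
  have h : ∃ k < t + 1, t = k + k ∨ t = k + k + 1 := by
    refine Def.induction (P := fun t => ∃ k < t + 1, t = k + k ∨ t = k + k + 1)
      ⟨0, lt_add_one' 0, Or.inl (add_zero 0).symm⟩ ?_ t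
    rintro t ⟨k, hk, rfl | rfl⟩
    · exact ⟨k, hk.trans (lt_add_one' _), Or.inr rfl⟩
    · exact ⟨k + 1, add_lt_add_left hk 1, Or.inl (by ring)⟩
  -- No number is both even and odd.
  have hne : ∀ k l : M.N, k + k ≠ l + l + 1 := fun k l hkl => by
    rcases lt_or_ge l k with h | h
    · obtain ⟨c, rfl⟩ := exists_add_of_le (succ_le_iff.2 h)
      have : l + l + 1 < l + 1 + c + (l + 1 + c) := by
        have e : l + 1 + c + (l + 1 + c) = l + l + 1 + 1 + (c + c) := by ring
        rw [e]
        exact (lt_add_one' _).trans_le le_self_add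
      exact this.ne' hkl
    · exact ((add_le_add h h).trans_lt (lt_add_one' _)).ne hkl
  obtain ⟨k, hk, hkt⟩ := h
  constructor
  · rintro ⟨l, -, hl⟩ ⟨m, -, rfl⟩
    exact hne _ _ hl.symm
  · intro h
    rcases hkt with rfl | rfl
    · exact absurd ⟨k, hk, rfl⟩ h
    · exact ⟨k + 1, add_lt_add_left hk 1, by ring⟩

theorem ev_zero : Ev (0 : M.N) := ⟨0, lt_add_one' 0, (add_zero 0).symm⟩

open scoped Classical in
/-- The power `(-1) ^ t`. -/
noncomputable def sgn (t : M.N) : ZInt M := if Ev t then 1 else -1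

instance : Inl (M := M) sgn :=
  (inferInstance : Inl fun t : M.N => open scoped Classical in if Ev t then (1 : ZInt M) else -1)

@[simp] theorem sgn_zero : sgn (0 : M.N) = 1 := if_pos ev_zero

theorem sgn_succ (t : M.N) : sgn (t + 1) = - sgn t := by
  by_cases h : Ev t
  · rw [sgn, sgn, if_pos h, if_neg fun h' => (ev_succ t).1 h' h]
  · rw [sgn, sgn, if_neg h, if_pos ((ev_succ t).2 h), neg_neg]

theorem sgn_add (s t : M.N) : sgn (s + t) = sgn s * sgn t :=
  Def.induction (P := fun t => sgn (s + t) = sgn s * sgn t) (by simp)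
    (fun t ih => by rw [← add_assoc, sgn_succ, sgn_succ, ih]; ring) t

theorem sgn_mul_self (t : M.N) : sgn t * sgn t = 1 := by
  rw [sgn]; split_ifs <;> ring

open scoped Classical in
theorem S_single {n j : M.N} (hj : j < n) {f : M.N → ZInt M} [Inl f]
    (h : ∀ k < n, k ≠ j → f k = 0) : S n f = f j := by
  obtain ⟨m, rfl⟩ := exists_succ (zero_le.trans_lt hj).ne'
  rw [S_remove m j hj, S_eq_zero, add_zero]
  exact fun k hk => h _ (sk_lt j hk) (sk_ne j k)

/-- Skew symmetry of a matrix of size `n`. -/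
def Skew (n : M.N) (A : M.N → M.N → ZInt M) : Prop := ∀ i < n, ∀ j < n, A i j = - A j i

theorem Skew.comp {n m : M.N} {A : M.N → M.N → ZInt M} (h : Skew n A) (f : M.N → M.N)
    (hf : ∀ i < m, f i < n) : Skew m fun i j => A (f i) (f j) :=
  fun i hi j hj => h _ (hf i hi) _ (hf j hj)

variable (M) in
/-- The Pfaffian changes its sign under simultaneous transpositions of rows and columns. -/
def Alternating : Prop := ∀ (n : M.N) (A : M.N → M.N → ZInt M) [Inl fun w => A (fst w) (snd w)],
  Skew (n + n) A → ∀ i < n + n, ∀ j < n + n, i ≠ j →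
    pf n (fun r c => A (sw i j r) (sw i j c)) = - pf n A

variable (M) in
/-- The expansion of the Pfaffian along every row. -/
def Expandable : Prop := ∀ (p : M.N) (A : M.N → M.N → ZInt M) [Inl fun w => A (fst w) (snd w)],
  Skew (p + 1 + (p + 1)) A → ∀ i < p + 1 + (p + 1), pf (p + 1) A =
    S (p + p + 1) fun c => sgn i * sgn c * A i (sk i c) *
      pf p (fun r s => A (sk i (sk c r)) (sk i (sk c s)))

/-- Induction on j, one transposition at a time. It is admissible because the permuted matrices form
an internal family, so their Pfaffians are internal in j. -/
theorem Alternating.kap (h : Alternating M) {n j : M.N} (A : M.N → M.N → ZInt M)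
    [Inl fun w => A (fst w) (snd w)] (hA : Skew (n + n) A) (hj : j < n + n) :
    pf n (fun r c => A (kap j r) (kap j c)) = sgn j * pf n A := by
  refine Def.induction (P := fun j => j < n + n →
    pf n (fun r c => A (VSharpL.kap j r) (VSharpL.kap j c)) = sgn j * pf n A) (fun _ => ?_)
    (fun j ih hj => ?_) j hj
  · have : ∀ r : M.N, VSharpL.kap 0 r = r := fun r => by
      rw [VSharpL.kap, if_neg zero_le.not_gt]
      split_ifs with h
      · exact h.symm
      · rfl
    simp only [this, sgn_zero, one_mul]
  · have hj' := (lt_add_one' j).trans hj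
    simp only [kap_succ]
    rw [h n (fun r c => A (VSharpL.kap j r) (VSharpL.kap j c))
      (hA.comp _ fun i hi => kap_lt hj' hi) j hj' (j + 1) hj (lt_add_one' j).ne, ih hj', sgn_succ]
    ring

theorem Alternating.tau (h : Alternating M) {n j : M.N} (A : M.N → M.N → ZInt M)
    [Inl fun w => A (fst w) (snd w)] (hA : Skew (n + n) A) (hj : j < n + n) :
    pf n (fun r c => A (tau j r) (tau j c)) = sgn j * pf n A := by
  refine Def.induction (P := fun j => j < n + n →
    pf n (fun r c => A (VSharpL.tau j r) (VSharpL.tau j c)) = sgn j * pf n A) (fun _ => ?_)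
    (fun j ih hj => ?_) j hj
  · have : ∀ r : M.N, VSharpL.tau 0 r = r := fun r => by
      rw [VSharpL.tau]
      split_ifs with h h'
      · exact h.symm
      · rfl
      · exact absurd (zero_le.lt_of_ne' h) h'
    simp only [this, sgn_zero, one_mul]
  · have hj' := (lt_add_one' j).trans hj
    simp only [tau_succ_zero]
    rw [h n (fun r c => A (VSharpL.tau j r) (VSharpL.tau j c))
      (hA.comp _ fun i hi => tau_lt hj' hi) 0 (zero_le.trans_lt hj) (j + 1) hj
      (zero_le.trans_lt (lt_add_one' j)).ne, ih hj', sgn_succ]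
    ring

theorem sk_lt_two {p c r : M.N} (hr : r < p + p) : sk c r + 1 < p + 1 + (p + 1) := by
  have := add_lt_add_left (sk_lt c hr) 1
  rwa [add_assoc, add_add_add_comm] at this

theorem two_ne_zero' (k : M.N) : k + (1 + 1) ≠ 0 :=
  (zero_le.trans_lt ((lt_add_one' 1).trans_le le_add_self)).ne'

theorem Alternating.first_row (h : Alternating M) (p : M.N) (A : M.N → M.N → ZInt M)
    [Inl fun w => A (fst w) (snd w)] (hA : Skew (p + 1 + (p + 1)) A) :
    pf (p + 1) A = S (p + p + 1) fun c => sgn c * A 0 (c + 1) *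
      pf p (fun r s => A (sk c r + 1) (sk c s + 1)) := by
  classical
  obtain ⟨V, hV, hVA⟩ := exists_pf_succ p A
  rw [hVA A fun _ _ _ _ _ _ => rfl, S_succ_left]
  congr 1
  · have : ∀ r : M.N, sk 0 r + 1 = r + (1 + 1) := fun r => by
      rw [sk, if_neg zero_le.not_gt, add_assoc]
    simp only [this, sgn_zero, one_mul, zero_add]
  refine S_congr fun j hj => ?_
  have ej := two_ne_zero' (M := M)
  -- The test matrix: the first row is the unit vector at j + 2, the first column its negative, and
  -- the rest is A. Its Pfaffian is V j, since V ignores the first row and column.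
  let B : M.N → M.N → ZInt M := fun r s => if r = 0 then (if s = j + (1 + 1) then 1 else 0)
    else if s = 0 then (if r = j + (1 + 1) then -1 else 0) else A r s
  have iB : Inl fun w : M.N => B (sw 1 (j + (1 + 1)) (fst w)) (sw 1 (j + (1 + 1)) (snd w)) :=
    inferInstance
  have hBs : Skew (p + 1 + (p + 1)) B := fun r hr s hs => by
    simp only [B]
    by_cases h1 : r = 0
    · by_cases h2 : s = 0
      · simp [h1, h2, (ej j).symm]
      · simp only [h1, h2, if_true, if_false]
        split_ifs <;> simp
    · by_cases h2 : s = 0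
      · simp only [h1, h2, if_true, if_false]
        split_ifs <;> simp
      · simp only [h1, h2, if_false]
        exact hA r hr s hs
  have e1 : (1 : M.N) ≠ j + (1 + 1) := ((lt_add_one' 1).trans_le le_add_self).ne
  have b1 : pf (p + 1) B = V j := by
    rw [hVA B fun r _ s _ h1 h2 => by simp only [B, if_neg h1, if_neg h2]]
    have : B 0 1 = 0 := by simp [B, e1]
    rw [this, zero_mul, zero_add, S_single hj]
    · simp [B]
    · intro k _ hkj
      simp [B, hkj]
  -- The transposition of 1 and j + 2 turns the first row into (0, 1, 0, ...), so only the Pfaffian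
  -- of the trailing block is left.
  have b2 : pf (p + 1) (fun r c => B (sw 1 (j + (1 + 1)) r) (sw 1 (j + (1 + 1)) c)) =
      pf p (fun i k => B (sw 1 (j + (1 + 1)) (i + (1 + 1))) (sw 1 (j + (1 + 1)) (k + (1 + 1)))) := by
    obtain ⟨W, hW, hWB⟩ :=
      exists_pf_succ p (fun r c => B (sw 1 (j + (1 + 1)) r) (sw 1 (j + (1 + 1)) c))
    rw [hWB _ fun _ _ _ _ _ _ => rfl]
    have s0 : sw 1 (j + (1 + 1)) 0 = 0 := by simp [sw, (ej j).symm]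
    have s1 : sw 1 (j + (1 + 1)) 1 = j + (1 + 1) := by simp [sw]
    have : B (sw 1 (j + (1 + 1)) 0) (sw 1 (j + (1 + 1)) 1) = 1 := by simp [s0, s1, B]
    rw [this, one_mul, S_eq_zero, add_zero]
    intro k _
    have : B (sw 1 (j + (1 + 1)) 0) (sw 1 (j + (1 + 1)) (k + (1 + 1))) = 0 := by
      have e3 : k + (1 + 1) ≠ 1 := ((lt_add_one' 1).trans_le le_add_self).ne'
      rw [s0]
      by_cases hk : k = j
      · simp [B, sw, hk, e1, e1.symm]
      · simp [B, sw, hk, e3]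
    rw [this, zero_mul]
  rw [h (p + 1) B hBs 1 (one_lt_two_succ p) (j + (1 + 1)) (add_two_lt hj) e1, b1] at b2
  simp only [← sk_kap] at b2
  have b3 : pf p (fun i k => B (sk (j + 1) (VSharpL.kap j i) + 1) (sk (j + 1) (VSharpL.kap j k) + 1)) =
      pf p (fun i k => A (sk (j + 1) (VSharpL.kap j i) + 1) (sk (j + 1) (VSharpL.kap j k) + 1)) := by
    have : ∀ a : M.N, a + 1 ≠ 0 := fun a => (zero_le.trans_lt (lt_add_one' a)).ne'
    simp only [B, this, if_false]
  rw [b3, h.kap (fun i k => A (sk (j + 1) i + 1) (sk (j + 1) k + 1))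
    (hA.comp _ fun i hi => sk_lt_two hi) hj] at b2
  -- The transposition contributes one minus sign and the cycle contributes the sign of j, together
  -- the sign of c = j + 1.
  rw [← neg_neg (V j), b2, sgn_succ, add_assoc]
  ring

/-- The expansion along the first row, applied after the cycle `tau i` has moved row i to the front;
the sign of the cycle is the factor `sgn i`. -/
theorem Alternating.expandable (h : Alternating M) : Expandable M := by
  intro p A _ hA i hi
  have t0 : VSharpL.tau i 0 = i := if_pos rfl
  have h1 := h.first_row p (fun r c => A (VSharpL.tau i r) (VSharpL.tau i c))
    (hA.comp _ fun _ hr => tau_lt hi hr)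
  rw [h.tau A hA hi] at h1
  simp only [t0, tau_succ] at h1
  rw [← one_mul (pf (p + 1) A), ← sgn_mul_self i, mul_assoc, h1, ← S_mul_left]
  exact S_congr fun c _ => by ring

end Expansion

section Axioms

/-! ### The cofactor expansion implies the axioms -/

variable {M : TwoSorted.{u, v}} [IsModel M]

/-- Exactly one of two distinct indices is renumbered when the other is removed. This is the source
of the antisymmetry in double expansions. -/
theorem sgn_sk_mul_sgn_pd (b u : M.N) : sgn (sk b u) * sgn (pd b u) = - (sgn b * sgn u) := by
  by_cases h : u < b
  · obtain rfl | ⟨a, ha, rfl⟩ := zero_or_succ b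
    · exact absurd h zero_le.not_gt
    · rw [sk, pd, if_pos h, if_pos h, ha, sgn_succ]
      ring
  · rw [sk, pd, if_neg h, if_neg h, sgn_succ]
    ring

theorem sk_sk_pd (b u : M.N) : sk (sk b u) (pd b u) = b := by
  rw [← pd_sk_self, sk_pd (sk_ne b u).symm]

theorem sk_inj {i r s : M.N} (h : sk i r = sk i s) : r = s := by
  rw [← pd_sk r i, h, pd_sk]

/-- The pairs (u, c) stand for ordered pairs of distinct indices (u, `sk u c`). The map (u, c) ↦
(`sk u c`, `pd u c`) exchanges the two members, so this is Fubini for a matrix with zero diagonal.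
-/
theorem S_reindex (m : M.N) (F : M.N → M.N → ZInt M) [Inl fun w => F (fst w) (snd w)] :
    (S (m + 1) fun u => S m fun c => F u c) = S (m + 1) fun u => S m fun c => F (sk u c) (pd u c) := by
  classical
  let G : M.N → M.N → ZInt M := fun u v => if u = v then 0 else F u (pd v u)
  have h1 : ∀ u, u < m + 1 → (S m fun c => F u c) = S (m + 1) fun v => G u v := fun u hu => by
    rw [S_remove m u hu]
    simp only [G, if_true, zero_add]
    refine S_congr fun c _ => ?_
    rw [if_neg (sk_ne u c).symm, pd_sk]
  have h2 : ∀ u, u < m + 1 → (S m fun c => F (sk u c) (pd u c)) = S (m + 1) fun v => G v u :=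
    fun u hu => by
    rw [S_remove m u hu]
    simp only [G, if_true, zero_add]
    refine S_congr fun c _ => ?_
    rw [if_neg (sk_ne u c), pd_sk_self]
  rw [S_congr h1, S_congr h2]
  exact S_comm (m + 1) (m + 1) G

open scoped Classical in
theorem Expandable.scale (h : Expandable M) {n i : M.N} (A : M.N → M.N → ZInt M)
    [Inl fun w => A (fst w) (snd w)] (hA : Skew (n + n) A) (l : ZInt M) (hi : i < n + n) :
    pf n (fun r c => if c = i then l * (if r = i then l * A r c else A r c)
      else (if r = i then l * A r c else A r c)) = l * pf n A := by
  have hn : n ≠ 0 := by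
    rintro rfl
    rw [add_zero] at hi
    exact zero_le.not_gt hi
  obtain ⟨p, rfl⟩ := exists_succ hn
  have hB : Skew (p + 1 + (p + 1)) (fun r c => if c = i then l * (if r = i then l * A r c else A r c)
      else (if r = i then l * A r c else A r c)) := fun r hr c hc => by
    dsimp only
    rw [hA r hr c hc]
    split_ifs <;> ring
  -- In the expansion along row i each entry carries one factor l, and the minors do not contain the
  -- index i.
  rw [h p _ hB i hi, h p A hA i hi, ← S_mul_left]
  refine S_congr fun c _ => ?_
  have e : ∀ r : M.N, sk i r ≠ i := sk_ne i
  simp only [e, if_true, if_false]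
  ring

/-- The part of the expansion along i whose minors still contain j = `sk i b`. Each such minor is
expanded along j, which has the number `pd b u` in it. -/
theorem Expandable.two_rows (h : Expandable M) (q : M.N) (A : M.N → M.N → ZInt M)
    [Inl fun w => A (fst w) (snd w)] (hA : Skew (q + 1 + 1 + (q + 1 + 1)) A) {i b : M.N}
    (hb : b < q + 1 + (q + 1) + 1) :
    (S (q + 1 + (q + 1)) fun u => sgn i * sgn (sk b u) * A i (sk i (sk b u)) *
        pf (q + 1) (fun r s => A (sk i (sk (sk b u) r)) (sk i (sk (sk b u) s)))) =
      - sgn i * sgn b * S (q + 1 + (q + 1)) fun u => S (q + q + 1) fun c =>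
        sgn u * sgn c * A i (sk i (sk b u)) * A (sk i b) (sk i (sk b (sk u c))) *
        pf q (fun r s => A (sk i (sk b (sk u (sk c r)))) (sk i (sk b (sk u (sk c s))))) := by
  rw [← S_mul_left]
  refine S_congr fun u hu => ?_
  have hpd : pd b u < q + 1 + (q + 1) := by
    rw [← pd_sk_self]
    exact pd_lt hb (sk_lt b hu) (sk_ne b u).symm
  have e2 : q + 1 + 1 + (q + 1 + 1) = q + 1 + (q + 1) + 1 + 1 := by ring
  rw [h q (fun r s => A (sk i (sk (sk b u) r)) (sk i (sk (sk b u) s)))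
    (hA.comp _ fun r hr => by rw [e2]; exact sk_lt _ (sk_lt _ hr)) _ hpd, ← S_mul_left, ← S_mul_left]
  refine S_congr fun c _ => ?_
  simp only [sk_sk, sk_sk_pd]
  have := sgn_sk_mul_sgn_pd b u
  linear_combination (sgn i * A i (sk i (sk b u)) * sgn c * A (sk i b) (sk i (sk b (sk u c))) *
        pf q (fun r s => A (sk i (sk b (sk u (sk c r)))) (sk i (sk b (sk u (sk c s)))))) * this

theorem Expandable.alternating (h : Expandable M) : Alternating M := by
  classical
  intro n A _ hA i hi j hj hij
  have hn : n ≠ 0 := by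
    rintro rfl
    rw [add_zero] at hi
    exact zero_le.not_gt hi
  obtain ⟨p, rfl⟩ := exists_succ hn
  have e1 : p + 1 + (p + 1) = p + p + 1 + 1 := by ring
  obtain ⟨b, hb, rfl⟩ : ∃ b < p + p + 1, j = sk i b := by
    rw [e1] at hi hj
    exact ⟨pd j i, pd_lt hj hi hij.symm, (sk_pd hij.symm).symm⟩
  have s1 : sw i (sk i b) i = sk i b := if_pos rfl
  have s2 : sw i (sk i b) (sk i b) = i := by simp [sw, hij.symm]
  have s3 : ∀ r, sw i (sk i b) (sk i (sk b r)) = sk i (sk b r) := fun r => by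
    rw [sw, if_neg (sk_ne _ _), if_neg fun h' => sk_ne _ _ (sk_inj h')]
  have hB : Skew (p + 1 + (p + 1)) fun r c => A (sw i (sk i b) r) (sw i (sk i b) c) :=
    hA.comp _ fun r hr => by
      rw [sw]; split_ifs
      exacts [hj, hi, hr]
  -- Both Pfaffians are expanded along i, and the summand of the column j is separated. Its minor
  -- does not see the swap and its coefficient changes sign by skew symmetry.
  rw [h p _ hB i hi, h p A hA i hi, S_remove _ b hb, S_remove _ b hb]
  simp only [s1, s2, s3]
  rw [neg_add, hA _ hj i hi]
  congr 1
  · ring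
  -- A 2 × 2 matrix has no further summands, and its minors cannot be expanded again.
  by_cases hp : p = 0
  · subst hp
    rw [add_zero, S_zero, S_zero, neg_zero]
  obtain ⟨q, rfl⟩ := exists_succ hp
  have t1 := h.two_rows q A hA (i := i) hb
  have t2 := h.two_rows q (fun r c => A (sw i (sk i b) r) (sw i (sk i b) c)) hB (i := i) hb
  simp only [s1, s2, s3] at t2
  have e2 : q + 1 + (q + 1) = q + q + 1 + 1 := by ring
  -- The swap exchanges the roles of the two columns in the double sum; the reindexing undoes this
  -- at the cost of a sign.
  rw [t1, t2, e2, S_reindex (q + q + 1), neg_mul_eq_mul_neg, ← S_neg]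
  congr 1
  refine S_congr fun u _ => ?_
  rw [← S_neg]
  refine S_congr fun c _ => ?_
  simp only [sk_sk, sk_sk_pd]
  have := sgn_sk_mul_sgn_pd u c
  linear_combination (A (sk i b) (sk i (sk b (sk u c))) * A i (sk i (sk b u)) *
        pf q (fun r s => A (sk i (sk b (sk u (sk c r)))) (sk i (sk b (sk u (sk c s)))))) * this

/-- Induction on n: in the first row only a_12 = 1 is nonzero, and the trailing block of J is again
J. -/
theorem pf_Jm (n : M.N) : pf n (Jm (M := M)) = 1 := by
  refine Def.induction (P := fun n => pf n (Jm (M := M)) = 1) (pf_zero _) (fun p ih => ?_) n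
  obtain ⟨V, hV, hVA⟩ := exists_pf_succ p (Jm (M := M))
  have e : (fun i j : M.N => Jm (i + (1 + 1)) (j + (1 + 1))) = Jm := by
    funext i j
    have e1 : ∀ a : M.N, Ev (a + (1 + 1)) ↔ Ev a := fun a => by
      rw [← add_assoc, ev_succ, ev_succ, not_not]
    have e2 : ∀ a b : M.N, a + (1 + 1) = b + (1 + 1) + 1 ↔ a = b + 1 := fun a b => by
      rw [add_right_comm, add_left_inj]
    classical
    exact if_congr (and_congr (e1 i) (e2 j i)) rfl (if_congr (and_congr (e1 j) (e2 i j)) rfl rfl)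
  have h1 : Jm (0 : M.N) 1 = 1 := if_pos ⟨ev_zero, (zero_add 1).symm⟩
  rw [hVA _ fun _ _ _ _ _ _ => rfl, e, ih, h1, S_eq_zero]
  · ring
  · intro k _
    have e1 : k + (1 + 1) ≠ 0 + 1 := by
      rw [zero_add]; exact ((lt_add_one' 1).trans_le le_add_self).ne'
    have e2 : (0 : M.N) ≠ k + (1 + 1) + 1 := (zero_le.trans_lt (lt_add_one' _)).ne
    rw [Jm, if_neg fun h => e1 h.2, if_neg fun h => e2 h.2, zero_mul]

end Axioms

section PfaffianExpressions

/-! ### Evaluation of the expressions for the Pfaffian -/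

variable {M : TwoSorted.{u, v}} [IsModel M] {w : World M}

theorem NumD.congr {t : NTerm} {m n : M.N} (ht : NumD w t m) (h : m = n) : NumD w t n := h ▸ ht

theorem NumD.two : NumD (M := M) w (1 + 1) (1 + 1) := NumD.one.add NumD.one

theorem NumD.double {t : NTerm} {n : M.N} (ht : NumD w t n) : NumD w ((1 + 1) * t) (n + n) :=
  (NumD.two.mul ht).congr (by ring)

theorem ZD.sumLt {m : NTerm} {n : M.N} {e : NTerm → ZExp} {f : M.N → ZInt M} [Inl f]
    (hm : NumD w m n) (he : ∀ w' ≥ w, ∀ x k, NumD w' x k → k < n → ZD w' (e x) (f k)) :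
    ZD w (sumLt m e) (S n f) := (ZRel.sumLt hm he).congr fun _ => isSum_iff_eq

theorem ZRel.exNum {e : NTerm → ZExp} {Q : M.N → ZInt M → Prop}
    (h : ∀ w' ≥ w, ∀ x k, NumD w' x k → ZRel w' (e x) (Q k)) :
    ZRel w (fun z => VSharpL.exNum fun x => e x z) fun r => ∃ k, Q k r := fun w1 h1 z c hz =>
  FmD.exNum fun w2 h2 x k hx => h w2 (h1.trans h2) x k hx w2 le_rfl z c (hz.mono h2)

theorem ev_iff {k : M.N} : Ev k ↔ ∃ c, k = (1 + 1) * c := by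
  constructor
  · rintro ⟨c, -, rfl⟩
    exact ⟨c, by ring⟩
  · rintro ⟨c, rfl⟩
    have e : (1 + 1) * c = c + c := by ring
    rw [e]
    exact ⟨c, lt_succ_iff.2 le_self_add, rfl⟩

theorem not_ev_iff {k : M.N} : ¬ Ev k ↔ ∃ c, k = (1 + 1) * c + 1 := by
  constructor
  · intro h
    have hk : k ≠ 0 := by
      rintro rfl
      exact h ev_zero
    obtain ⟨l, rfl⟩ := exists_succ hk
    rw [ev_succ, not_not, ev_iff] at h
    obtain ⟨c, rfl⟩ := h
    exact ⟨c, rfl⟩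
  · rintro ⟨c, rfl⟩
    rw [ev_succ, not_not, ev_iff]
    exact ⟨c, rfl⟩

theorem FmD.isEven {t : NTerm} {n : M.N} (ht : NumD w t n) : FmD w (isEven t) (Ev n) :=
  (FmD.exNum fun w1 h1 x k hx => FmD.eqNum (ht.mono h1) (NumD.two.mul hx)).congr ev_iff.symm

theorem ZD.signPow {t : NTerm} {n : M.N} (ht : NumD w t n) : ZD w (signPow t) (sgn n) :=
  ((ZRel.when (FmD.isEven ht) fun _ => ZD.one).orElse
    (ZRel.when ((FmD.exNum fun w1 h1 x k hx =>
      FmD.eqNum (ht.mono h1) ((NumD.two.mul hx).add NumD.one)).congr not_ev_iff.symm)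
      fun _ => ZD.neg ZD.one)).congr fun r => by
    by_cases h : Ev n <;> simp [h, sgn]

theorem MatD.matJ (n : M.N) : MatD w n matJ Jm := fun w' _ x y i j hi hj _ _ =>
  have h1 := (FmD.isEven hi).conj fun _ => FmD.eqNum hj (hi.add NumD.one)
  have h2 := (FmD.isEven hj).conj fun _ => FmD.eqNum hi (hj.add NumD.one)
  ((ZRel.when h1 fun _ => ZD.one).orElse ((ZRel.when h2 fun _ => ZD.neg ZD.one).orElse
    (ZRel.when (h1.neg.conj fun _ => h2.neg) fun _ => ZD.zero))).congr fun r => by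
      have : Ev i ∧ j = i + 1 → ¬ (Ev j ∧ i = j + 1) := by
        rintro ⟨hi, rfl⟩ ⟨hj, -⟩
        exact (ev_succ i).1 hj hi
      unfold Jm
      by_cases h : Ev i ∧ j = i + 1
      · rw [if_pos h]; tauto
      · rw [if_neg h]
        by_cases h' : Ev j ∧ i = j + 1
        · rw [if_pos h']; tauto
        · rw [if_neg h']; tauto

theorem MatD.mulMat {m : NTerm} {n : M.N} {A B : Mat} {F G : M.N → M.N → ZInt M}
    [Inl fun w => F (fst w) (snd w)] [Inl fun w => G (fst w) (snd w)] (hm : NumD w m n)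
    (hA : MatD w n A F) (hB : MatD w n B G) :
    MatD w n (mulMat m A B) fun i j => S n fun k => F i k * G k j :=
  fun w1 h1 x y i j hx hy hi hj => ZD.sumLt (hm.mono h1) fun w2 h2 z k hz hk =>
    (hA w2 (h1.trans h2) _ _ _ _ (hx.mono h2) hz hi hk).mul
      (hB w2 (h1.trans h2) _ _ _ _ hz (hy.mono h2) hk hj)

theorem MatD.powMat {m t : NTerm} {n k : M.N} {A : Mat} {F : M.N → M.N → ZInt M}
    [Inl fun w => F (fst w) (snd w)] (hm : NumD w m n) (ht : NumD w t k) (hA : MatD w n A F) :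
    MatD w n (powMat m A t) (Pow n F k) := fun w1 h1 x y i j hx hy hi hj w2 h2 z d hz =>
  (FmD.exPair fun w3 h3 B b hB =>
    (FmD.isPow (hm.mono ((h1.trans h2).trans h3)) (ht.mono ((h1.trans h2).trans h3))
      (hA.mono ((h1.trans h2).trans h3)) (MatD.matVar hB n)).conj fun _ =>
    ZD.entry hB ((hx.mono (h2.trans h3)).pair (hy.mono (h2.trans h3))) w3 le_rfl z d
      (hz.mono h3)).congr (by
    constructor
    · rintro ⟨b, ⟨c, hc, hb⟩, hd⟩
      rw [hd, hb i hi j hj]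
      exact hc.eq_Pow le_rfl hi hj
    · intro hd
      obtain ⟨q, hq, h⟩ := exists_isPowSeq n k F
      obtain ⟨c, hc⟩ := exists_ent q (pr (k + 1) (pr n n))
      -- The list of powers with exponents up to k has a code c, and its last matrix has a code b of
      -- its own, as the formula requires.
      obtain ⟨b, hb⟩ := exists_ent (fun z => ent c (pr k z)) (pr n n)
      have hlt : ∀ t, t ≤ k → ∀ i < n, ∀ j < n, ent c (pr t (pr i j)) = q (pr t (pr i j)) :=
        fun t ht i hi j hj => hc _ (pr_lt_pr (lt_succ_iff.2 ht) (pr_lt_pr hi hj))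
      refine ⟨b, ⟨c, ⟨fun i hi j hj => ?_, fun t ht i hi j hj => ?_⟩,
        fun i hi j hj => hb _ (pr_lt_pr hi hj)⟩, ?_⟩
      · dsimp only
        rw [hlt 0 zero_le i hi j hj]
        exact h.1 i hi j hj
      · dsimp only
        rw [hlt _ (succ_le_iff.2 ht) i hi j hj]
        exact (h.2 t ht i hi j hj).congr fun x hx => by rw [hlt t ht.le i hi x hx]
      · rw [hd, hb _ (pr_lt_pr hi hj), hlt k le_rfl i hi j hj]
        exact (h.eq_Pow le_rfl hi hj).symm)

theorem ZD.blockProd {p s : NTerm} {k l : M.N} {A : Mat} {F : M.N → M.N → ZInt M}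
    [Inl fun w => F (fst w) (snd w)] (hp : NumD w p k) (hs : NumD w s l)
    (hA : MatD w (k + 1 + (k + 1)) A F) : ZD w (blockProd p A s) (blk k F l) := by
  unfold VSharpL.blockProd blk powCol
  have hm := hp.double
  refine ZD.sumLt hm fun w1 h1 x i hx hi => (ZD.sumLt (hm.mono h1) fun w2 h2 y j hy hj => ?_).mul
    (ZD.sumLt (hm.mono h1) fun w2 h2 y j hy hj => ?_)
  · exact (hA w2 (h1.trans h2) _ _ _ _ NumD.zero (hy.add NumD.two) (zero_lt_two_succ k)
      (add_two_lt hj)).mul (MatD.matJ (k + k) w2 le_rfl _ _ _ _ hy (hx.mono h2) hj hi)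
  · refine (MatD.powMat (hm.mono (h1.trans h2)) (hs.mono (h1.trans h2)) ?_ w2 le_rfl _ _ _ _
      (hx.mono h2) hy hi hj).mul (hA w2 (h1.trans h2) _ _ _ _ (hy.add NumD.two) NumD.one
        (add_two_lt hj) (one_lt_two_succ k))
    refine MatD.mulMat (F := fun i j => F (i + (1 + 1)) (j + (1 + 1))) (hm.mono (h1.trans h2)) ?_
      (MatD.matJ _)
    exact fun w3 h3 x y i j hx hy hi hj => hA w3 ((h1.trans h2).trans h3) _ _ _ _
      (hx.add NumD.two) (hy.add NumD.two) (add_two_lt hi) (add_two_lt hj)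

theorem ZD.matP {p r c : NTerm} {k i j : M.N} {A : Mat} {F : M.N → M.N → ZInt M}
    [Inl fun w => F (fst w) (snd w)] (hp : NumD w p k) (hr : NumD w r i) (hc : NumD w c j)
    (hA : MatD w (k + 1 + (k + 1)) A F) : ZD w (matP p A r c) (toep k F i j) :=
  ((ZRel.when (FmD.ltNum hr hc) fun _ => ZD.zero).orElse
    ((ZRel.when (FmD.eqNum hr hc) fun _ => ZD.one).orElse
    ((ZRel.when (FmD.eqNum hr (hc.add NumD.one)) fun _ =>
      hA w le_rfl _ _ _ _ NumD.zero NumD.one (zero_lt_two_succ k) (one_lt_two_succ k)).orElse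
    (ZRel.exNum fun w1 h1 s l hs => ZRel.when (FmD.eqNum (hr.mono h1) (((hc.mono h1).add hs).add NumD.two))
      fun _ => ZD.blockProd (hp.mono h1) hs (hA.mono h1))))).congr fun v => by
    -- The four cases are exclusive and exhaustive, so the case expression has exactly one value; in
    -- the last case the exponent s is determined by r = c + s + 2.
    have e0 := lt_add_one' j
    have e1 : ∀ l, j + 1 < j + l + (1 + 1) := fun l => by
      rw [← add_assoc]
      exact add_lt_add_left (lt_succ_iff.2 le_self_add) 1
    have e2 : ∀ l, i = j + l + (1 + 1) → tsub i (j + (1 + 1)) = l := fun l hl =>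
      tsub_eq (by rw [hl, add_right_comm])
    unfold toep
    by_cases h1 : i < j
    · rw [if_pos h1]
      have n1 : i ≠ j := h1.ne
      have n2 : i ≠ j + 1 := (h1.trans e0).ne
      have n3 : ∀ l, i ≠ j + l + (1 + 1) := fun l => ((h1.trans e0).trans (e1 l)).ne
      simp [h1, n1, n2, n3]
    by_cases h2 : i = j
    · subst h2
      have n3 : ∀ l, i ≠ i + l + (1 + 1) := fun l => (e0.trans (e1 l)).ne
      simp [n3]
    by_cases h3 : i = j + 1
    · subst h3
      have n3 : ∀ l, j + 1 ≠ j + l + (1 + 1) := fun l => (e1 l).ne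
      simp only [if_neg h1, if_neg h2]
      simp only [h1, h2, n3]
      simp
    · rw [if_neg h1, if_neg h2, if_neg h3]
      simp only [h1, h2, h3, false_and, false_or]
      constructor
      · rintro ⟨l, hl, hv⟩
        rw [hv, e2 l hl]
      · intro hv
        have hle : j + (1 + 1) ≤ i := by
          rw [← add_assoc, succ_le_iff]
          exact lt_of_le_of_ne (succ_le_iff.2 (lt_of_le_of_ne (not_lt.1 h1) (Ne.symm h2))) (Ne.symm h3)
        obtain ⟨l, hl⟩ := exists_add_of_le hle
        have hl' : i = j + l + (1 + 1) := by rw [hl, add_right_comm]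
        exact ⟨l, hl', by rw [hv, e2 l hl']⟩

theorem MatD.tailMat {k : NTerm} {l n m : M.N} {A : Mat} {F : M.N → M.N → ZInt M}
    (hk : NumD w k l) (h : l + l + m ≤ n) (hA : MatD w n A F) :
    MatD w m (tailMat A k) fun i j => F (l + l + i) (l + l + j) :=
  fun w1 h1 x y i j hx hy hi hj => hA w1 h1 _ _ _ _ ((hk.mono h1).double.add hx)
    ((hk.mono h1).double.add hy) ((add_lt_add_right hi _).trans_le h) ((add_lt_add_right hj _).trans_le h)

theorem ZD.pfaff {t : NTerm} {n : M.N} {A : Mat} {F : M.N → M.N → ZInt M}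
    [Inl fun w => F (fst w) (snd w)] (ht : NumD w t n) (hA : MatD w (n + n) A F) :
    ZD w (pfaff t A) (pf n F) := fun w1 h1 z d hz => by
  replace ht := ht.mono h1
  replace hA := hA.mono h1
  refine (FmD.exPair (P := fun c => IsPf n F (fun k r => ent c (pr k r)) ∧ val d = ent c (pr 0 n))
    fun w2 h2 C c hC => FmD.congr ((FmD.eqZ (ZD.entry hC ((ht.mono h2).pair NumD.zero)) ZD.one).conj
      fun _ => (FmD.allNum fun w3 h3 k k' hk => FmD.allNum fun w4 h4 p p' hp =>
        (FmD.eqNum (((hk.mono h4).add hp).add NumD.one) ((ht.mono h2).mono (h3.trans h4))).impl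
        fun hn => FmD.allLt (hp.add NumD.two) fun w5 h5 r r' hr _ =>
          FmD.eqZ (ZD.entry (hC.mono ((h3.trans h4).trans h5)) ((hk.mono (h4.trans h5)).pair hr))
            (ZD.sumLt (f := fun x => toep p' (fun i j => F (k' + k' + i) (k' + k' + j)) r' x *
              ent c (pr (k' + 1) x)) ((hp.mono h5).add NumD.one) fun w6 h6 x x' hx _ =>
              (ZD.matP (F := fun i j => F (k' + k' + i) (k' + k' + j)) ((hp.mono h5).mono h6)
                (hr.mono h6) hx (MatD.tailMat (hk.mono ((h4.trans h5).trans h6)) ?_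
                  (hA.mono (h2.trans (((h3.trans h4).trans h5).trans h6))))).mul
              (ZD.entry (hC.mono (((h3.trans h4).trans h5).trans h6))
                (((hk.mono ((h4.trans h5).trans h6)).add NumD.one).pair hx)))).conj fun _ =>
      ZD.entry hC (NumD.zero.pair (ht.mono h2)) w2 le_rfl z d (hz.mono h2)) and_assoc.symm).congr ?_
  · rw [← hn]
    exact (by ring : k' + k' + (p' + 1 + (p' + 1)) = k' + p' + 1 + (k' + p' + 1)).le
  · constructor
    · rintro ⟨c, hc, hd⟩
      rw [hd]
      exact hc.eq_pf
    · intro hd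
      obtain ⟨C, hC, h⟩ := exists_isPf_single n F
      -- The bounds cover the rows k ≤ n and all coefficient numbers that occur.
      obtain ⟨c, hc⟩ := exists_ent (fun z => C (fst z) (snd z)) (pr (n + 1) (n + (1 + 1)))
      have e : ∀ k r, k ≤ n → r < n + (1 + 1) → ent c (pr k r) = C k r := fun k r hk hr => by
        rw [hc _ (pr_lt_pr (lt_succ_iff.2 hk) hr)]
        simp
      have e0 : 0 < n + (1 + 1) := zero_le.lt_of_ne (two_ne_zero' n).symm
      refine ⟨c, ⟨?_, fun k p hkp r hr => ?_⟩, ?_⟩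
      · dsimp only
        rw [e _ _ le_rfl e0, h.1]
      · dsimp only
        have hk : k + 1 ≤ n := by
          rw [← hkp, add_right_comm]
          exact le_self_add
        have hp : p + 1 ≤ n := by
          rw [← hkp, add_assoc]
          exact le_add_self
        have hr' : r < n + (1 + 1) :=
          hr.trans_le (add_le_add_left ((lt_add_one' p).le.trans hp) _)
        rw [e _ _ ((lt_add_one' k).le.trans hk) hr', h.2 k p hkp r hr]
        exact S_congr fun x hx => by rw [e _ _ hk ((hx.trans_le hp).trans_le le_self_add)]
      · rw [hd, e _ _ zero_le ((lt_add_one' n).trans (add_lt_add_right (lt_add_one' 1) n)), h.eq_pf]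

end PfaffianExpressions

section Principles

/-! ### Evaluation of the two principles -/

variable {M : TwoSorted.{u, v}} [IsModel M] {w : World M}

theorem FmD.skipLt {i j r r' : NTerm} {a b x y : M.N} (hi : NumD w i a) (hj : NumD w j b)
    (hr : NumD w r x) (hr' : NumD w r' y) : FmD w (skipLt i j r r')
      ((x < a ∧ y = x) ∨ (a ≤ x ∧ x + 1 < b ∧ y = x + 1) ∨ (b ≤ x + 1 ∧ y = x + (1 + 1))) :=
  ((FmD.ltNum hr hi).conj fun _ => FmD.eqNum hr' hr).disj
    (((FmD.leNum hi hr).conj fun _ => (FmD.ltNum (hr.add NumD.one) hj).conj fun _ =>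
      FmD.eqNum hr' (hr.add NumD.one)).disj
    ((FmD.leNum hj (hr.add NumD.one)).conj fun _ => FmD.eqNum hr' (hr.add NumD.two)))

/-- Omitting a and b at once, by cases on their order, amounts to omitting a and then the number `pd
b a` that b has among the remaining indices. -/
theorem skip_iff {a b x y : M.N} (h : a ≠ b) :
    (((a < b ∧ ((x < a ∧ y = x) ∨ (a ≤ x ∧ x + 1 < b ∧ y = x + 1) ∨ (b ≤ x + 1 ∧ y = x + (1 + 1)))) ∨
      (b < a ∧ ((x < b ∧ y = x) ∨ (b ≤ x ∧ x + 1 < a ∧ y = x + 1) ∨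
        (a ≤ x + 1 ∧ y = x + (1 + 1)))))) ↔ y = sk a (sk (pd b a) x) := by
  obtain ⟨h0, d1, nn, d2⟩ := nat_facts (M := M)
  have := nn a
  have := nn x
  rcases lt_or_gt_of_ne h with h | h
  · obtain rfl | ⟨c, hc, rfl⟩ := zero_or_succ b
    · exact absurd h zero_le.not_gt
    · simp only [h, h.not_gt, true_and, false_and, or_false, pd, if_true, hc]
      clear hc
      have := d2 x a; have := d2 a x; have := d2 x c; have := d2 c x
      grind [sk]
  · have := nn b
    simp only [h, h.not_gt, true_and, false_and, false_or, pd, if_false]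
    have := d2 x a; have := d2 a x; have := d2 x b; have := d2 b x; have := d2 a (x + 1)
    grind [sk]

theorem FmD.skip {i j r r' : NTerm} {a b x y : M.N} (hi : NumD w i a) (hj : NumD w j b)
    (h : a ≠ b) (hr : NumD w r x) (hr' : NumD w r' y) :
    FmD w (skip i j r r') (y = sk a (sk (pd b a) x)) :=
  (((FmD.ltNum hi hj).conj fun _ => FmD.skipLt hi hj hr hr').disj
    ((FmD.ltNum hj hi).conj fun _ => FmD.skipLt hj hi hr hr')).congr (skip_iff h)

theorem MatD.removeMat {i j : NTerm} {a b n m : M.N} {A : Mat} {F : M.N → M.N → ZInt M}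
    (hi : NumD w i a) (hj : NumD w j b) (h : a ≠ b) (hn : m + 1 + 1 ≤ n) (hA : MatD w n A F) :
    MatD w m (removeMat A i j) fun r c => F (sk a (sk (pd b a) r)) (sk a (sk (pd b a) c)) :=
  fun w1 h1 r c x y hr hc hx hy => by
  refine (ZRel.exNum fun w2 h2 r' x' hr' => ZRel.exNum fun w3 h3 c' y' hc' =>
    ZRel.when (FmD.skip (hi.mono (h1.trans (h2.trans h3))) (hj.mono (h1.trans (h2.trans h3))) h
      (hr.mono (h2.trans h3)) (hr'.mono h3)) fun e1 =>
    ZRel.when (FmD.skip (hi.mono (h1.trans (h2.trans h3))) (hj.mono (h1.trans (h2.trans h3))) h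
      (hc.mono (h2.trans h3)) hc') fun e2 =>
    hA w3 (h1.trans (h2.trans h3)) _ _ _ _ (hr'.mono h3) hc' ?_ ?_).congr fun v => ?_
  · rw [e1]; exact (sk_lt _ (sk_lt _ hx)).trans_le hn
  · rw [e2]; exact (sk_lt _ (sk_lt _ hy)).trans_le hn
  · simp

theorem FmD.transp {i j r r' : NTerm} {a b x y : M.N} (hi : NumD w i a) (hj : NumD w j b)
    (hr : NumD w r x) (hr' : NumD w r' y) : FmD w (transp i j r r') (y = sw a b x) :=
  (((FmD.eqNum hr hi).conj fun _ => FmD.eqNum hr' hj).disj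
    (((FmD.eqNum hr hj).conj fun _ => FmD.eqNum hr' hi).disj
    ((FmD.eqNum hr hi).neg.conj fun _ => (FmD.eqNum hr hj).neg.conj fun _ => FmD.eqNum hr' hr))).congr (by
    unfold sw
    by_cases h1 : x = a <;> by_cases h2 : x = b <;> simp [h1, h2] <;> grind)

theorem sw_lt {a b x n : M.N} (ha : a < n) (hb : b < n) (hx : x < n) : sw a b x < n := by
  unfold sw; split_ifs <;> assumption

theorem MatD.swapMat {i j : NTerm} {a b n : M.N} {A : Mat} {F : M.N → M.N → ZInt M}
    (hi : NumD w i a) (hj : NumD w j b) (ha : a < n) (hb : b < n) (hA : MatD w n A F) :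
    MatD w n (swapMat A i j) fun r c => F (sw a b r) (sw a b c) :=
  fun w1 h1 r c x y hr hc hx hy => by
  refine (ZRel.exNum fun w2 h2 r' x' hr' => ZRel.exNum fun w3 h3 c' y' hc' =>
    ZRel.when (FmD.transp (hi.mono (h1.trans (h2.trans h3))) (hj.mono (h1.trans (h2.trans h3)))
      (hr.mono (h2.trans h3)) (hr'.mono h3)) fun e1 =>
    ZRel.when (FmD.transp (hi.mono (h1.trans (h2.trans h3))) (hj.mono (h1.trans (h2.trans h3)))
      (hc.mono (h2.trans h3)) hc') fun e2 =>
    hA w3 (h1.trans (h2.trans h3)) _ _ _ _ (hr'.mono h3) hc' ?_ ?_).congr fun v => ?_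
  · rw [e1]; exact sw_lt ha hb hx
  · rw [e2]; exact sw_lt ha hb hy
  · simp

theorem ZD.cases {e f : ZExp} {φ : Fm} {P : Prop} [Decidable P] {r s : ZInt M} (hφ : FmD w φ P) (he : ZD w e r)
    (hf : ZD w f s) : ZD w ((e.when φ) ∥ (f.when (VSharpL.neg φ))) (if P then r else s) :=
  ((ZRel.when hφ fun _ => he).orElse (ZRel.when hφ.neg fun _ => hf)).congr fun v => by
    by_cases h : P <;> simp [h]

open scoped Classical in
theorem MatD.scaleMat {i : NTerm} {a n : M.N} {A : Mat} {F : M.N → M.N → ZInt M} {l : ZExp}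
    {r : ZInt M} (hi : NumD w i a) (hl : ZD w l r) (hA : MatD w n A F) :
    MatD w n (scaleMat A l i) fun x y => if y = a then r * (if x = a then r * F x y else F x y)
      else (if x = a then r * F x y else F x y) :=
  fun w1 h1 s t x y hs ht hx hy =>
    have hF := hA w1 h1 _ _ _ _ hs ht hx hy
    have hr := hl.mono h1
    have hR := ZD.cases (FmD.eqNum hs (hi.mono h1)) (hr.mul hF) hF
    ZD.cases (FmD.eqNum ht (hi.mono h1)) (hr.mul hR) hR

open scoped Classical in
/-- The value of the summand of the cofactor expansion. -/
noncomputable def cof (p : M.N) (F : M.N → M.N → ZInt M) (i j : M.N) : ZInt M :=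
  if j = i then 0 else (if i < j then sgn (i + j + 1) else sgn (i + j)) *
    (F i j * pf p fun r c => F (sk i (sk (pd j i) r)) (sk i (sk (pd j i) c)))

instance (p i : M.N) (F : M.N → M.N → ZInt M) [Inl fun w => F (fst w) (snd w)] :
    Inl fun j => cof p F i j := by
  unfold cof; infer_instance

theorem ZD.cofactorTerm {t i j : NTerm} {p a b : M.N} {A : Mat} {F : M.N → M.N → ZInt M}
    [Inl fun w => F (fst w) (snd w)] (ht : NumD w t p) (hi : NumD w i a) (hj : NumD w j b)
    (hA : MatD w (p + 1 + (p + 1)) A F) (ha : a < p + 1 + (p + 1)) (hb : b < p + 1 + (p + 1)) :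
    ZD w (cofactorTerm t A i j) (cof p F a b) := by
  have e : p + p + 1 + 1 ≤ p + 1 + (p + 1) := (by ring : p + p + 1 + 1 = p + 1 + (p + 1)).le
  have hF := fun h : a ≠ b => (hA w le_rfl _ _ _ _ hi hj ha hb).mul
    (ZD.pfaff ht (MatD.removeMat hi hj h e hA))
  refine ((ZRel.when (FmD.eqNum hj hi) fun _ => ZD.zero).orElse
    ((ZRel.when (FmD.ltNum hi hj) fun h => (ZD.signPow ((hi.add hj).add NumD.one)).mul (hF h.ne)).orElse
    (ZRel.when (FmD.ltNum hj hi) fun h => (ZD.signPow (hi.add hj)).mul (hF h.ne')))).congr fun v => ?_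
  unfold cof
  rcases lt_trichotomy a b with h | h | h
  · simp [h, h.ne', h.not_gt]
  · simp [h]
  · simp [h, h.ne, h.not_gt]

/-- For j = `sk i c` the sign with Θ does not depend on the side of i: if j < i then j = c, and if j
> i then j = c + 1 and Θ adds one more, so the sign is (-1)^(i + c) either way. -/
theorem S_cof (p : M.N) (F : M.N → M.N → ZInt M) [Inl fun w => F (fst w) (snd w)] {i : M.N}
    (hi : i < p + 1 + (p + 1)) : S (p + 1 + (p + 1)) (fun j => cof p F i j) =
      S (p + p + 1) fun c => sgn i * sgn c * F i (sk i c) *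
        pf p (fun r s => F (sk i (sk c r)) (sk i (sk c s))) := by
  have e : p + 1 + (p + 1) = p + p + 1 + 1 := by ring
  rw [e] at hi ⊢
  rw [S_remove _ i hi, cof, if_pos rfl, zero_add]
  refine S_congr fun c _ => ?_
  rw [cof, if_neg (sk_ne i c), pd_sk]
  have : (if i < sk i c then sgn (i + sk i c + 1) else sgn (i + sk i c)) = sgn i * sgn c := by
    rw [sk]
    split_ifs with h1 h2 h2
    · exact absurd h1 h2.not_gt
    · exact sgn_add i c
    · rw [← add_assoc, sgn_succ, sgn_succ, neg_neg, sgn_add]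
    · exact absurd (lt_succ_iff.2 (not_lt.1 h1)) h2
  rw [this]
  ring

theorem exists_matrix (n : M.N) (A : M.N → M.N → ZInt M) [Inl fun w => A (fst w) (snd w)] :
    ∃ c, ∀ i < n, ∀ j < n, ent c (pr i j) = A i j := by
  obtain ⟨c, hc⟩ := exists_ent (fun z => A (fst z) (snd z)) (pr n n)
  exact ⟨c, fun i hi j hj => by rw [hc _ (pr_lt_pr hi hj)]; simp⟩

theorem FmD.isSkew {t : NTerm} {n : M.N} {A : Mat} {F : M.N → M.N → ZInt M} (ht : NumD w t n)
    (hA : MatD w n A F) : FmD w (isSkew t A) (Skew n F) :=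
  FmD.eqMat (G := fun i j => - F j i) ht hA fun w1 h1 x y i j hx hy hi hj =>
    (hA w1 h1 _ _ _ _ hy hx hj hi).neg

theorem Skew.congr {n : M.N} {A B : M.N → M.N → ZInt M} (hA : Skew n A)
    (h : ∀ i < n, ∀ j < n, B i j = A i j) : Skew n B := fun i hi j hj => by
  rw [h i hi j hj, h j hj i hi, hA i hi j hj]

theorem FmD.PCE (w : World M) : FmD w PCE (Expandable M) := by
  refine (FmD.allNum fun w1 h1 t p ht => FmD.allPair fun w2 h2 a c ha =>
    (FmD.isSkew ((ht.mono h2).add NumD.one).double (MatD.matVar ha _)).impl fun hs =>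
    FmD.allLt ((ht.mono h2).add NumD.one).double fun w3 h3 x i hx hi =>
      FmD.eqZ (ZD.pfaff ((ht.mono (h2.trans h3)).add NumD.one) (MatD.matVar (ha.mono h3) _))
        (ZD.sumLt (f := fun j => cof p (fun i j => ent c (pr i j)) i j)
          ((ht.mono (h2.trans h3)).add NumD.one).double fun w4 h4 y j hy hj =>
          ZD.cofactorTerm (ht.mono ((h2.trans h3).trans h4)) (hx.mono h4) hy
            (MatD.matVar (ha.mono (h3.trans h4)) _) hi hj)).congr ?_
  constructor
  -- The formula quantifies over coded matrices, `Expandable` over internal ones. Every internal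
  -- matrix has a code within the relevant range, and Pfaffians depend on that range only.
  · intro h p A _ hA i hi
    obtain ⟨c, hc⟩ := exists_matrix (p + 1 + (p + 1)) A
    have := h p c (hA.congr hc) i hi
    rw [S_cof p _ hi, pf_congr hc] at this
    rw [this]
    refine S_congr fun x hx => ?_
    have e : p + p + 1 + 1 = p + 1 + (p + 1) := by ring
    rw [hc i hi _ ((sk_lt i hx).trans_eq e)]
    congr 1
    exact pf_congr fun r hr s hs => hc _ ((sk_lt _ (sk_lt _ hr)).trans_eq e) _
      ((sk_lt _ (sk_lt _ hs)).trans_eq e)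
  · intro h p c hA i hi
    rw [S_cof p _ hi]
    exact h p _ hA i hi

theorem FmD.alternation (w : World M) : FmD w alternation (Alternating M) := by
  refine (FmD.allNum fun w1 h1 t n ht => FmD.allPair fun w2 h2 a c ha =>
    (FmD.isSkew (ht.mono h2).double (MatD.matVar ha _)).impl fun hs =>
    FmD.allLt (ht.mono h2).double fun w3 h3 x i hx hi =>
    FmD.allLt (ht.mono (h2.trans h3)).double fun w4 h4 y j hy hj =>
      (FmD.eqNum (hx.mono h4) hy).neg.impl fun _ =>
      FmD.eqZ (ZD.pfaff (ht.mono ((h2.trans h3).trans h4))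
          (MatD.swapMat (hx.mono h4) hy hi hj (MatD.matVar (ha.mono (h3.trans h4)) _)))
        (ZD.pfaff (ht.mono ((h2.trans h3).trans h4)) (MatD.matVar (ha.mono (h3.trans h4)) _)).neg).congr ?_
  constructor
  · intro h n A _ hA i hi j hj hij
    obtain ⟨c, hc⟩ := exists_matrix (n + n) A
    have := h n c (hA.congr hc) i hi j hj hij
    rw [pf_congr hc] at this
    rw [← this]
    exact pf_congr fun r hr s hs => (hc _ (sw_lt hi hj hr) _ (sw_lt hi hj hs)).symm
  · intro h n c hA i hi j hj hij
    exact h n _ hA i hi j hj hij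

variable (M) in
open scoped Classical in
/-- The Pfaffian is linear in every row and column. -/
def Scalable : Prop := ∀ (n : M.N) (c : M.S × M.S), Skew (n + n) (fun i j => ent c (pr i j)) →
  ∀ l : M.S × M.S, ∀ i < n + n, pf n (fun r s => if s = i
    then val l * (if r = i then val l * ent c (pr r s) else ent c (pr r s))
    else (if r = i then val l * ent c (pr r s) else ent c (pr r s))) =
      val l * pf n (fun i j => ent c (pr i j))

theorem FmD.multilinearity (w : World M) : FmD w multilinearity (Scalable M) :=
  FmD.allNum fun w1 h1 t n ht => FmD.allPair fun w2 h2 a c ha =>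
    (FmD.isSkew (ht.mono h2).double (MatD.matVar ha _)).impl fun hs =>
    FmD.allPair fun w3 h3 l d hl => FmD.allLt (ht.mono (h2.trans h3)).double fun w4 h4 x i hx hi =>
      FmD.eqZ (ZD.pfaff (ht.mono ((h2.trans h3).trans h4))
          (MatD.scaleMat hx (ZD.intVar (hl.mono h4)) (MatD.matVar (ha.mono (h3.trans h4)) _)))
        ((ZD.intVar (hl.mono h4)).mul
          (ZD.pfaff (ht.mono ((h2.trans h3).trans h4)) (MatD.matVar (ha.mono (h3.trans h4)) _)))

theorem FmD.identity (w : World M) : FmD w identity (∀ n : M.N, 1 ≤ n → pf n (Jm (M := M)) = 1) :=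
  FmD.allNum fun w1 h1 t n ht => (FmD.leNum NumD.one ht).impl fun _ =>
    FmD.eqZ (ZD.pfaff ht (MatD.matJ _)) ZD.one

theorem Expandable.scalable (h : Expandable M) : Scalable M := fun n c hA l i hi =>
  h.scale (fun i j => ent c (pr i j)) hA (val l) hi

end Principles
end VSharpL

/-! ### The equivalence in every model. -/

theorem mainTheorem3 :
    VSharpL.Entails.{u, v} VSharpL.theory ((VSharpL.equi VSharpL.PCE VSharpL.PAD) 0) := by
  intro M hM
  have : VSharpL.IsModel M := ⟨hM⟩
  -- Evaluation turns the sentence into a statement on the model: expandability is equivalent to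
  -- scaling, alternation and the identity for J together.
  refine VSharpL.FmD.satisfies (fun w => (VSharpL.FmD.PCE w).equi
    ((VSharpL.FmD.multilinearity w).conj fun _ => (VSharpL.FmD.alternation w).conj fun _ =>
      VSharpL.FmD.identity w)) ⟨fun h => ?_, fun h => h.2.1.expandable⟩
  exact ⟨h.scalable, h.alternating, fun n _ => VSharpL.pf_Jm n⟩
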